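/- **Proposition 2.3.** Let $U_i\subset\mathbb R^{d_i}$ ($i=1,2$) be open, $\dot T^*U=U\times(\mathbb R^d\setminus\{0\})$, and let $\gamma_i\subset\dot T^*U_i$ be arbitrary cones (stable under $(x,\xi)\mapsto(x,t\xi)$, $t>0$). Put $$\gamma=\gamma_1\dot\times\gamma_2=(\gamma_1\times\gamma_2)\cup(\gamma_1\times(U_2\times\{0\}))\cup((U_1\times\{0\})\times\gamma_2)\subset\dot T^*(U_1\times U_2).$$ *Spaces.* Let $WF(u)$ be the $C^\infty$ wave front set of a (complex-valued) distribution $u$, $WF_s(u)$ its $H^s$ wave front set, and $DWF(u)=\bigcup_{s\in\mathbb R}WF_s(u)$. For $U$ open and $\gamma\subset\Lambda\subset\overline\gamma$ cones in $\dot T^*U$ (closures taken in $\dot T^*U$), let $\mathcal D'_{\gamma,\Lambda}(U)=\mathcal D'_{\gamma,\Lambda}(U,\mathcal F)=\{u\in\mathcal D'(U): DWF(u)\subset\gamma,\ WF(u)\subset\Lambda\}$, where $\mathcal F$ means that there is no restriction on the supports. *Topologies.* - For a closed cone $\Gamma\subset\dot T^*U$, the normal topology of $\mathcal D'_{\Gamma,\Gamma}(U)$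 is given by the seminorms of the strong topology of $\mathcal D'(U)$ and by $u\mapsto\sup_{\xi\in V}(1+|\xi|)^k|\mathcal F(fu)(\xi)|$, for $k\in\mathbb N$, $f\in\mathcal D(U)$ and closed cones $V\subset\mathbb R^d$ with $(\operatorname{supp}f\times V)\cap\Gamma=\emptyset$. - $\mathcal I_{iii}$ on $\mathcal D'_{\gamma,\gamma}(U)$ is the locally convex inductive limit of the spaces $\mathcal D'_{\Gamma,\Gamma}(U)$ with their normal topologies, over the closed cones $\Gamma\subset\gamma$. - $\mathcal I_{ppp}$ on $\mathcal D'_{\gamma,\overline\gamma}(U)$ is the topology given by the seminorms $u\mapsto\sup_{\varphi\in B}|\langle u,\varphi\rangle|$, where $B$ runs over the sets of complex-valued test functions on $U$ that are supported in a common compact subset of $U$ and are bounded in $\mathcal D'_{\Gamma,\Gamma}(U)$ for some closed cone $\Gamma\subset-\gamma^c=\{(x,\xi)\in\dot T^*U:(x,-\xi)\notin\gamma\}$. For $D>0$ and an integer $k\ge1$ let $$C_{D,k,1}=\{(\xi,\eta): D|\eta|^k\ge|\xi|\},\qquad C_{D,k,2}=\{(\xi,\eta): D|\xi|^k\ge|\eta|\}\subset\mathbb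 R^{d_1}\times\mathbb R^{d_2},$$ and for $l\in\mathbb N$, a set $A\subset\mathbb R^{d_1}\times\mathbb R^{d_2}$ and $f\in\mathcal D(U_1\times U_2)$ let $$p_{l,A,f}(u)=\sup_{(\xi,\eta)\in A}(1+|\xi|+|\eta|)^l\,|\mathcal F(fu)(\xi,\eta)|\in[0,\infty].$$ $\mathcal I_\beta$ is generated by the seminorms of $\mathcal I_{ppp}$ together with all $$p_{l,\,C_{D,k,1}\cap(\mathbb R^{d_1}\times V_2),\,\varphi_1\otimes\varphi_2}\quad\text{and}\quad p_{l,\,C_{D,k,2}\cap(V_1\times\mathbb R^{d_2}),\,\varphi_1\otimes\varphi_2},$$ where $D>0$, $k\ge1$, $l\ge0$, $\varphi_i\in\mathcal D(U_i)$ and the $V_i\subset\mathbb R^{d_i}$ are closed cones with $(\operatorname{supp}\varphi_i\times V_i)\cap\gamma_i=\emptyset$. Since these additional seminorms may be infinite at some elements of $\mathcal D'_{\gamma,\overline\gamma}(U_1\times U_2)$, on that whole space $\mathcal I_\beta$ is understood as the translation-invariant uniform structure whose basic entourages are given by finitely many conditions $p(u-v)<\varepsilon$; it is a locally convex topology on the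 subspace $\mathcal D'_\beta\subset\mathcal D'_{\gamma,\overline\gamma}(U_1\times U_2)$ on which all the additional seminorms are finite. *Conclusion.* $(\mathcal D'_{\gamma,\overline\gamma}(U_1\times U_2),\mathcal I_\beta)$ is complete, and so is its subspace $(\mathcal D'_\beta,\mathcal I_\beta)$. The tensor product of distributions takes values in $\mathcal D'_\beta$ and is a $\gamma$-hypocontinuous bilinear map $$\cdot\otimes\cdot:(\mathcal D'_{\gamma_1,\gamma_1}(U_1),\mathcal I_{iii})\times(\mathcal D'_{\gamma_2,\gamma_2}(U_2),\mathcal I_{iii})\to(\mathcal D'_\beta,\mathcal I_\beta)\subset(\mathcal D'_{\gamma,\overline\gamma}(U_1\times U_2),\mathcal I_\beta),$$ that is, it is separately continuous, and for every absolutely convex compact subset $K$ of one factor and every neighborhood $W$ of $0$ in the target there is a neighborhood $V$ of $0$ in the other factor such that the tensor products of the elements of $K$ with those of $V$ lie in $W$. -/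

import Mathlib

open Set Filter Topology TopologicalSpace MeasureTheory
open scoped Distributions ENNReal ContDiff

noncomputable section

namespace GenHormander

/-! ### Uniform structures generated by seminorms that may take the value `∞` -/

/-- A seminorm on a complex vector space, with the value `∞` allowed. -/
structure ExtSeminorm (M : Type*) [AddCommGroup M] [Module ℂ M] where
  toFun : M → ℝ≥0∞
  add_le : ∀ u v, toFun (u + v) ≤ toFun u + toFun v
  smul_eq : ∀ (c : ℂ) (u : M), toFun (c • u) = ‖c‖ₑ * toFun u

namespace ExtSeminorm

variable {M : Type*} [AddCommGroup M] [Module ℂ M]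

instance : CoeFun (ExtSeminorm M) (fun _ => M → ℝ≥0∞) := ⟨ExtSeminorm.toFun⟩

theorem map_zero (p : ExtSeminorm M) : p 0 = 0 := by
  simpa using p.smul_eq 0 0

theorem map_neg (p : ExtSeminorm M) (u : M) : p (-u) = p u := by
  simpa using p.smul_eq (-1) u

/-- The weighted supremum `u ↦ sup_i w i * |L i u|` of a family of linear forms. -/
def ofFamily {ι : Type*} (w : ι → ℝ≥0∞) (L : ι → M →ₗ[ℂ] ℂ) : ExtSeminorm M where
  toFun u := ⨆ i, w i * ‖L i u‖ₑ
  add_le u v := by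
    refine iSup_le fun i => ?_
    calc w i * ‖L i (u + v)‖ₑ ≤ w i * (‖L i u‖ₑ + ‖L i v‖ₑ) := by
          rw [_root_.map_add]; gcongr; exact enorm_add_le _ _
      _ = w i * ‖L i u‖ₑ + w i * ‖L i v‖ₑ := mul_add _ _ _
      _ ≤ _ := add_le_add (le_iSup (fun i => w i * ‖L i u‖ₑ) i)
          (le_iSup (fun i => w i * ‖L i v‖ₑ) i)
  smul_eq c u := by
    rw [ENNReal.mul_iSup]
    refine iSup_congr fun i => ?_
    rw [_root_.map_smul, smul_eq_mul, enorm_mul, mul_left_comm]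

/-- The (extended) pseudometric `(u, v) ↦ p (u - v)`. -/
abbrev pseudoEMetricSpace (p : ExtSeminorm M) : PseudoEMetricSpace M where
  edist u v := p (u - v)
  edist_self u := by simpa using p.map_zero
  edist_comm u v := by rw [← p.map_neg, neg_sub]
  edist_triangle u v w := by simpa using p.add_le (u - v) (v - w)

/-- The translation invariant uniform structure generated by a set of extended seminorms. When all
of them are finite this is the uniform structure of a locally convex topology. -/
abbrev uniformSpace (P : Set (ExtSeminorm M)) : UniformSpace M :=
  ⨅ p ∈ P, p.pseudoEMetricSpace.toUniformSpace

/-- The subspace on which all the extended seminorms of a given set are finite. -/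
def finitePart (P : Set (ExtSeminorm M)) : Submodule ℂ M where
  carrier := {u | ∀ p ∈ P, p u < ⊤}
  zero_mem' p _ := by simp [p.map_zero]
  add_mem' {u v} hu hv p hp := (p.add_le u v).trans_lt (ENNReal.add_lt_top.2 ⟨hu p hp, hv p hp⟩)
  smul_mem' c u hu p hp := by
    rw [p.smul_eq]
    exact ENNReal.mul_lt_top enorm_lt_top (hu p hp)

end ExtSeminorm

/-! ### Hypocontinuity with respect to absolutely convex compact sets -/

/-- A bilinear map is `γ`-hypocontinuous if it is separately continuous, and equicontinuous in each
variable when the other one is confined to an absolutely convex compact set. -/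
def GammaHypocontinuous {X Y Z : Type*}
    [AddCommGroup X] [Module ℂ X] [Module ℝ X] [TopologicalSpace X]
    [AddCommGroup Y] [Module ℂ Y] [Module ℝ Y] [TopologicalSpace Y]
    [AddCommGroup Z] [Module ℂ Z] [TopologicalSpace Z] (T : X →ₗ[ℂ] Y →ₗ[ℂ] Z) : Prop :=
  (∀ x, Continuous fun y => T x y) ∧ (∀ y, Continuous fun x => T x y) ∧
  (∀ K : Set X, IsCompact K → AbsConvex ℝ K → ∀ W ∈ 𝓝 (0 : Z), ∃ V ∈ 𝓝 (0 : Y),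
    ∀ x ∈ K, ∀ y ∈ V, T x y ∈ W) ∧
  (∀ K : Set Y, IsCompact K → AbsConvex ℝ K → ∀ W ∈ 𝓝 (0 : Z), ∃ V ∈ 𝓝 (0 : X),
    ∀ y ∈ K, ∀ x ∈ V, T x y ∈ W)

/-! ### Distributions and the Fourier transform of their localizations

The cotangent space of `E` at every point is `StrongDual ℝ E`. -/

section Distributions

variable {E : Type*} [NormedAddCommGroup E] [NormedSpace ℝ E]

/-- The product of a real test function and a smooth complex function. -/
def mulSmooth {Ω : Opens E} (f : 𝓓(Ω, ℝ)) (g : E → ℂ) (hg : ContDiff ℝ ∞ g) : 𝓓(Ω, ℂ) where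
  toFun x := f x • g x
  contDiff' := f.contDiff.smul hg
  hasCompactSupport' := f.hasCompactSupport.smul_right
  tsupport_subset' := (tsupport_smul_subset_left f g).trans f.tsupport_subset

/-- The value of a complex distribution on a complex test function, as a linear form in the
distribution. -/
def pair {Ω : Opens E} (φ : 𝓓(Ω, ℂ)) : 𝓓'(Ω, ℂ) →ₗ[ℂ] ℂ where
  toFun u := u (TestFunction.postcompCLM Complex.reCLM φ)
    + Complex.I * u (TestFunction.postcompCLM Complex.imCLM φ)
  map_add' u v := by
    change (u _ + v _) + Complex.I * (u _ + v _) = _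
    ring
  map_smul' c u := by
    change c * u _ + Complex.I * (c * u _) = c * (_ + _)
    ring

/-- The character `x ↦ exp (-i ⟨ξ, x⟩)`. -/
def character (ξ : StrongDual ℝ E) (x : E) : ℂ := Complex.exp (-(Complex.I * (ξ x : ℂ)))

theorem contDiff_character (ξ : StrongDual ℝ E) : ContDiff ℝ ∞ (character ξ) := by
  unfold character
  refine Complex.contDiff_exp.comp (contDiff_const.mul ?_).neg
  exact Complex.ofRealCLM.contDiff.comp ξ.contDiff

/-- `localFourier f ξ u` is the Fourier transform at `ξ` of the compactly supported distribution
`f u`, that is, the value of `u` on `x ↦ f x * exp (-i ⟨ξ, x⟩)`. -/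
def localFourier {Ω : Opens E} (f : 𝓓(Ω, ℝ)) (ξ : StrongDual ℝ E) : 𝓓'(Ω, ℂ) →ₗ[ℂ] ℂ :=
  pair (mulSmooth f (character ξ) (contDiff_character ξ))

/-- The distribution `ψ ↦ ∫ ψ φ` defined by a test function `φ`. -/
def toDistribution [MeasureSpace E] [OpensMeasurableSpace E] {Ω : Opens E} (φ : 𝓓(Ω, ℂ)) : 𝓓'(Ω, ℂ) :=
  (TestFunction.integralAgainstBilinCLM (ContinuousLinearMap.lsmul ℝ ℝ) volume φ :
    𝓓(Ω, ℝ) →L[ℝ] ℂ)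

/-! ### Cones and wave front sets -/

/-- A cone in the cotangent space of `Ω` without its zero section. -/
structure IsCone (Ω : Opens E) (γ : Set (E × StrongDual ℝ E)) : Prop where
  subset : ∀ z ∈ γ, z.1 ∈ Ω ∧ z.2 ≠ 0
  smul_mem : ∀ z ∈ γ, ∀ t : ℝ, 0 < t → (z.1, t • z.2) ∈ γ

/-- A cone which is closed in the cotangent space of `Ω` without its zero section. -/
structure IsClosedCone (Ω : Opens E) (Γ : Set (E × StrongDual ℝ E)) : Prop
    extends IsCone Ω Γ where
  closed : ∀ z ∈ closure Γ, z.1 ∈ Ω → z.2 ≠ 0 → z ∈ Γ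

/-- A closed cone in the space of covectors. -/
def IsClosedCovectorCone (V : Set (StrongDual ℝ E)) : Prop :=
  IsClosed V ∧ ∀ ξ ∈ V, ∀ t : ℝ, 0 < t → t • ξ ∈ V

/-- The `C^∞` wave front set. A point `(x, ξ)` is not in it if and only if the Fourier transforms
of all `φ u`, with `φ` supported near `x`, decay rapidly in one conic neighborhood of `ξ`. -/
def WF {Ω : Opens E} (u : 𝓓'(Ω, ℂ)) : Set (E × StrongDual ℝ E) :=
  {z | z.1 ∈ Ω ∧ z.2 ≠ 0 ∧
    ¬ ∃ O ∈ 𝓝 z.1, ∃ V ∈ 𝓝 z.2, IsClosedCovectorCone V ∧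
      ∀ φ : 𝓓(Ω, ℝ), tsupport φ ⊆ O → ∀ N : ℕ, ∃ C : ℝ, ∀ ξ ∈ V,
        (1 + ‖ξ‖) ^ N * ‖localFourier φ ξ u‖ ≤ C}

/-- The Sobolev `H^s` wave front set. A point `(x, ξ)` is not in it if and only if the Fourier
transforms of all `φ u`, with `φ` supported near `x`, are square integrable with weight
`(1 + |ξ|²)^s` on one conic neighborhood of `ξ`. -/
def WFSobolev [FiniteDimensional ℝ E] (s : ℝ) {Ω : Opens E} (u : 𝓓'(Ω, ℂ)) :
    Set (E × StrongDual ℝ E) :=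
  {z | z.1 ∈ Ω ∧ z.2 ≠ 0 ∧
    ¬ ∃ O ∈ 𝓝 z.1, ∃ V ∈ 𝓝 z.2, IsClosedCovectorCone V ∧
      ∀ φ : 𝓓(Ω, ℝ), tsupport φ ⊆ O →
        MemLp (fun ξ => (1 + ‖ξ‖ ^ 2) ^ (s / 2) • localFourier φ ξ u) 2
          ((Measure.addHaar : Measure (StrongDual ℝ E)).restrict V)}

/-- The dual wave front set: the union of all Sobolev wave front sets. -/
def DWF [FiniteDimensional ℝ E] {Ω : Opens E} (u : 𝓓'(Ω, ℂ)) : Set (E × StrongDual ℝ E) :=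
  ⋃ s : ℝ, WFSobolev s u

theorem WF_zero {Ω : Opens E} : WF (0 : 𝓓'(Ω, ℂ)) = ∅ := by
  refine eq_empty_of_forall_notMem fun z hz => hz.2.2 ⟨univ, univ_mem, univ, univ_mem,
    ⟨isClosed_univ, fun _ _ _ _ => mem_univ _⟩, fun φ _ N => ⟨0, fun ξ _ => ?_⟩⟩
  simp

theorem WF_add_subset {Ω : Opens E} (u v : 𝓓'(Ω, ℂ)) : WF (u + v) ⊆ WF u ∪ WF v := by
  rintro z ⟨h1, h2, h3⟩
  by_contra hz
  have hu : z ∉ WF u := fun h => hz (Or.inl h)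
  have hv : z ∉ WF v := fun h => hz (Or.inr h)
  simp only [WF, mem_ofPred_eq, not_and, not_not] at hu hv
  obtain ⟨O, hO, V, hV, hVc, H⟩ := hu h1 h2
  obtain ⟨O', hO', V', hV', hVc', H'⟩ := hv h1 h2
  refine h3 ⟨O ∩ O', inter_mem hO hO', V ∩ V', inter_mem hV hV',
    ⟨hVc.1.inter hVc'.1, fun ξ hξ t ht => ⟨hVc.2 ξ hξ.1 t ht, hVc'.2 ξ hξ.2 t ht⟩⟩,
    fun φ hφ N => ?_⟩
  obtain ⟨C, hC⟩ := H φ (hφ.trans inter_subset_left) N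
  obtain ⟨C', hC'⟩ := H' φ (hφ.trans inter_subset_right) N
  refine ⟨C + C', fun ξ hξ => ?_⟩
  rw [map_add]
  calc (1 + ‖ξ‖) ^ N * ‖localFourier φ ξ u + localFourier φ ξ v‖
      ≤ (1 + ‖ξ‖) ^ N * (‖localFourier φ ξ u‖ + ‖localFourier φ ξ v‖) := by
        gcongr; exact norm_add_le _ _
    _ ≤ C + C' := by rw [mul_add]; exact add_le_add (hC ξ hξ.1) (hC' ξ hξ.2)

theorem WF_smul_subset {Ω : Opens E} (c : ℂ) (u : 𝓓'(Ω, ℂ)) : WF (c • u) ⊆ WF u := by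
  rintro z ⟨h1, h2, h3⟩
  refine ⟨h1, h2, fun ⟨O, hO, V, hV, hVc, H⟩ => h3 ⟨O, hO, V, hV, hVc, fun φ hφ N => ?_⟩⟩
  obtain ⟨C, hC⟩ := H φ hφ N
  refine ⟨‖c‖ * C, fun ξ hξ => ?_⟩
  rw [map_smul, norm_smul, mul_left_comm]
  exact mul_le_mul_of_nonneg_left (hC ξ hξ) (norm_nonneg c)

theorem DWF_zero [FiniteDimensional ℝ E] {Ω : Opens E} : DWF (0 : 𝓓'(Ω, ℂ)) = ∅ := by
  refine iUnion_eq_empty.2 fun s => eq_empty_of_forall_notMem fun z hz => hz.2.2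
    ⟨univ, univ_mem, univ, univ_mem, ⟨isClosed_univ, fun _ _ _ _ => mem_univ _⟩, fun φ _ => ?_⟩
  simp

theorem DWF_add_subset [FiniteDimensional ℝ E] {Ω : Opens E} (u v : 𝓓'(Ω, ℂ)) :
    DWF (u + v) ⊆ DWF u ∪ DWF v := by
  rw [DWF, DWF, DWF, ← iUnion_union_distrib]
  refine iUnion_mono fun s => ?_
  rintro z ⟨h1, h2, h3⟩
  by_contra hz
  have hu : z ∉ WFSobolev s u := fun h => hz (Or.inl h)
  have hv : z ∉ WFSobolev s v := fun h => hz (Or.inr h)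
  simp only [WFSobolev, mem_ofPred_eq, not_and, not_not] at hu hv
  obtain ⟨O, hO, V, hV, hVc, H⟩ := hu h1 h2
  obtain ⟨O', hO', V', hV', hVc', H'⟩ := hv h1 h2
  refine h3 ⟨O ∩ O', inter_mem hO hO', V ∩ V', inter_mem hV hV',
    ⟨hVc.1.inter hVc'.1, fun ξ hξ t ht => ⟨hVc.2 ξ hξ.1 t ht, hVc'.2 ξ hξ.2 t ht⟩⟩,
    fun φ hφ => ?_⟩
  have A := (H φ (hφ.trans inter_subset_left)).mono_measure
    (Measure.restrict_mono_set _ (inter_subset_left (s := V) (t := V')))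
  have A' := (H' φ (hφ.trans inter_subset_right)).mono_measure
    (Measure.restrict_mono_set _ (inter_subset_right (s := V) (t := V')))
  simpa only [map_add, smul_add] using! A.add A'

theorem DWF_smul_subset [FiniteDimensional ℝ E] {Ω : Opens E} (c : ℂ) (u : 𝓓'(Ω, ℂ)) :
    DWF (c • u) ⊆ DWF u := by
  refine iUnion_mono fun s => ?_
  rintro z ⟨h1, h2, h3⟩
  refine ⟨h1, h2, fun ⟨O, hO, V, hV, hVc, H⟩ => h3 ⟨O, hO, V, hV, hVc, fun φ hφ => ?_⟩⟩
  have A := (H φ hφ).const_smul c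
  refine A.congr_norm (A.1.congr (.of_forall fun ξ => ?_)) (.of_forall fun ξ => ?_) <;>
  simp [mul_left_comm]

/-- The space `𝓓'_{γ,Λ}(Ω)` of distributions with dual wave front set in `γ` and wave front set in
`Λ`, without condition on the supports. -/
def wfSpace [FiniteDimensional ℝ E] (Ω : Opens E) (γ Λ : Set (E × StrongDual ℝ E)) :
    Submodule ℂ 𝓓'(Ω, ℂ) where
  carrier := {u | DWF u ⊆ γ ∧ WF u ⊆ Λ}
  zero_mem' := by simp [DWF_zero, WF_zero]
  add_mem' hu hv := ⟨(DWF_add_subset _ _).trans (union_subset hu.1 hv.1),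
    (WF_add_subset _ _).trans (union_subset hu.2 hv.2)⟩
  smul_mem' c _ hu := ⟨(DWF_smul_subset c _).trans hu.1, (WF_smul_subset c _).trans hu.2⟩

/-! ### The normal topology and its inductive limit -/

/-- The seminorm `u ↦ sup_{ψ ∈ B} |u ψ|`. -/
def strongSeminorm {Ω : Opens E} (B : Set 𝓓(Ω, ℂ)) : ExtSeminorm 𝓓'(Ω, ℂ) :=
  ExtSeminorm.ofFamily (ι := B) (fun _ => 1) fun φ => pair φ.1

/-- The seminorm `u ↦ sup_{ξ ∈ V} (1 + |ξ|)^k |𝓕(f u)(ξ)|`. -/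
def fourierSeminorm {Ω : Opens E} (k : ℕ) (f : 𝓓(Ω, ℝ)) (V : Set (StrongDual ℝ E)) :
    ExtSeminorm 𝓓'(Ω, ℂ) :=
  ExtSeminorm.ofFamily (ι := V) (fun ξ => ENNReal.ofReal ((1 + ‖ξ.1‖) ^ k)) fun ξ =>
    localFourier f ξ.1

/-- The seminorms of the normal (Hörmander) topology of `𝓓'_{Γ,Γ}(Ω)`, `Γ` a closed cone: those
of the strong topology of distributions, and the Fourier seminorms of rapid decay outside `Γ`. -/
def normalSeminorms (Ω : Opens E) (Γ : Set (E × StrongDual ℝ E)) : Set (ExtSeminorm 𝓓'(Ω, ℂ)) :=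
  {p | ∃ B : Set 𝓓(Ω, ℂ), Bornology.IsVonNBounded ℝ B ∧ p = strongSeminorm B} ∪
  {p | ∃ (k : ℕ) (f : 𝓓(Ω, ℝ)) (V : Set (StrongDual ℝ E)), IsClosedCovectorCone V ∧
    Disjoint (tsupport f ×ˢ V) Γ ∧ p = fourierSeminorm k f V}

/-- The normal topology of `𝓓'_{Γ,Γ}(Ω)`. -/
abbrev normalTopology [FiniteDimensional ℝ E] (Ω : Opens E) (Γ : Set (E × StrongDual ℝ E)) :
    TopologicalSpace (wfSpace Ω Γ Γ) :=
  .induced Subtype.val (ExtSeminorm.uniformSpace (normalSeminorms Ω Γ)).toTopologicalSpace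

/-- The space `𝓓'_{γ,γ}(Ω)`, to be endowed with the inductive limit topology `I_iii`. -/
def SpaceIII [FiniteDimensional ℝ E] (Ω : Opens E) (γ : Set (E × StrongDual ℝ E)) : Type _ :=
  wfSpace Ω γ γ

namespace SpaceIII

variable [FiniteDimensional ℝ E] (Ω : Opens E) (γ : Set (E × StrongDual ℝ E))

instance : AddCommGroup (SpaceIII Ω γ) := inferInstanceAs (AddCommGroup (wfSpace Ω γ γ))
instance : Module ℂ (SpaceIII Ω γ) := inferInstanceAs (Module ℂ (wfSpace Ω γ γ))
instance : Module ℝ (SpaceIII Ω γ) := inferInstanceAs (Module ℝ (wfSpace Ω γ γ))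

/-- The underlying distribution. -/
def val {Ω : Opens E} {γ : Set (E × StrongDual ℝ E)} (u : SpaceIII Ω γ) : 𝓓'(Ω, ℂ) := Subtype.val u

/-- The inclusion of `𝓓'_{Γ,Γ}(Ω)` for `Γ ⊆ γ`. -/
def incl {Γ : Set (E × StrongDual ℝ E)} (h : Γ ⊆ γ) (u : wfSpace Ω Γ Γ) : SpaceIII Ω γ :=
  ⟨u.1, u.2.1.trans h, u.2.2.trans h⟩

/-- The locally convex inductive limit of the spaces `𝓓'_{Γ,Γ}(Ω)` with their normal topologies,
over the closed cones `Γ ⊆ γ`: the finest locally convex vector space topology for which all the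
inclusions are continuous. -/
instance : TopologicalSpace (SpaceIII Ω γ) :=
  sInf {t | @IsTopologicalAddGroup _ t _ ∧ @ContinuousSMul ℂ _ _ _ t ∧
    @LocallyConvexSpace ℝ (SpaceIII Ω γ) _ _ _ _ t ∧
    ∀ (Γ : Set (E × StrongDual ℝ E)) (h : Γ ⊆ γ), IsClosedCone Ω Γ →
      @Continuous _ _ (normalTopology Ω Γ) t (incl Ω γ h)}

end SpaceIII

/-! ### The topology `I_ppp` -/

/-- Sets of test functions which have their supports in a common compact subset of `Ω` and are
bounded in `𝓓'_{Γ,Γ}(Ω)` for some closed cone `Γ ⊆ -γᶜ`. -/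
def IsDualBounded [MeasureSpace E] [OpensMeasurableSpace E] (Ω : Opens E)
    (γ : Set (E × StrongDual ℝ E)) (B : Set 𝓓(Ω, ℂ)) : Prop :=
  (∃ K : Set E, IsCompact K ∧ K ⊆ Ω ∧ ∀ φ ∈ B, tsupport φ ⊆ K) ∧
  ∃ Γ : Set (E × StrongDual ℝ E), IsClosedCone Ω Γ ∧ (∀ z ∈ Γ, (z.1, -z.2) ∉ γ) ∧
    ∀ p ∈ normalSeminorms Ω Γ, (⨆ φ ∈ B, p (toDistribution φ)) < ⊤

/-- The seminorms of the topology `I_ppp` of `𝓓'_{γ,Λ}(Ω)`: uniform convergence on the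
equicontinuous subsets of its dual, the space of compactly supported distributions with wave front
set in `-γᶜ`. -/
def pppSeminorms [MeasureSpace E] [OpensMeasurableSpace E] (Ω : Opens E)
    (γ : Set (E × StrongDual ℝ E)) : Set (ExtSeminorm 𝓓'(Ω, ℂ)) :=
  {p | ∃ B : Set 𝓓(Ω, ℂ), IsDualBounded Ω γ B ∧ p = strongSeminorm B}

end Distributions

/-! ### Products and the topology `I_β` -/

section Product

variable {E₁ : Type*} [NormedAddCommGroup E₁] [NormedSpace ℝ E₁]
  {E₂ : Type*} [NormedAddCommGroup E₂] [NormedSpace ℝ E₂]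

/-- The open set `U₁ × U₂`. -/
abbrev prodOpens (U₁ : Opens E₁) (U₂ : Opens E₂) : Opens (E₁ × E₂) :=
  ⟨(U₁ : Set E₁) ×ˢ (U₂ : Set E₂), U₁.isOpen.prod U₂.isOpen⟩

/-- The cone `γ₁ ×̇ γ₂ = (γ₁ × γ₂) ∪ (γ₁ × (U₂ × {0})) ∪ ((U₁ × {0}) × γ₂)`. A covector of the
product is identified with the pair of its restrictions to the factors. -/
def dotProd (U₁ : Opens E₁) (U₂ : Opens E₂) (γ₁ : Set (E₁ × StrongDual ℝ E₁))
    (γ₂ : Set (E₂ × StrongDual ℝ E₂)) : Set ((E₁ × E₂) × StrongDual ℝ (E₁ × E₂)) :=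
  {z | ∃ (x : E₁) (ξ : StrongDual ℝ E₁) (y : E₂) (η : StrongDual ℝ E₂),
    z = ((x, y), ξ.coprod η) ∧
      (((x, ξ) ∈ γ₁ ∧ (y, η) ∈ γ₂) ∨ ((x, ξ) ∈ γ₁ ∧ y ∈ U₂ ∧ η = 0) ∨
        (x ∈ U₁ ∧ ξ = 0 ∧ (y, η) ∈ γ₂))}

/-- The test function `(x, y) ↦ φ₁ x * φ₂ y`. -/
def tensor {U₁ : Opens E₁} {U₂ : Opens E₂} (φ₁ : 𝓓(U₁, ℝ)) (φ₂ : 𝓓(U₂, ℝ)) :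
    𝓓(prodOpens U₁ U₂, ℝ) where
  toFun z := φ₁ z.1 * φ₂ z.2
  contDiff' := (φ₁.contDiff.comp contDiff_fst).mul (φ₂.contDiff.comp contDiff_snd)
  hasCompactSupport' := by
    refine HasCompactSupport.intro (φ₁.hasCompactSupport.prod φ₂.hasCompactSupport) fun z hz => ?_
    by_cases h : z.1 ∈ tsupport φ₁
    · have h' : z.2 ∉ tsupport φ₂ := fun h' => hz ⟨h, h'⟩
      simp [image_eq_zero_of_notMem_tsupport h']
    · simp [image_eq_zero_of_notMem_tsupport h]
  tsupport_subset' := by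
    refine (closure_minimal (fun z hz => ?_)
      ((isClosed_tsupport φ₁).prod (isClosed_tsupport φ₂))).trans
      (prod_mono φ₁.tsupport_subset φ₂.tsupport_subset)
    exact ⟨subset_tsupport _ (left_ne_zero_of_mul hz), subset_tsupport _ (right_ne_zero_of_mul hz)⟩

/-- The region `C_{D,k,1} = {(ξ, η) : D |η|^k ≥ |ξ|}`. -/
def region₁ (D : ℝ) (k : ℕ) : Set (StrongDual ℝ E₁ × StrongDual ℝ E₂) :=
  {ζ | ‖ζ.1‖ ≤ D * ‖ζ.2‖ ^ k}

/-- The region `C_{D,k,2} = {(ξ, η) : D |ξ|^k ≥ |η|}`. -/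
def region₂ (D : ℝ) (k : ℕ) : Set (StrongDual ℝ E₁ × StrongDual ℝ E₂) :=
  {ζ | ‖ζ.2‖ ≤ D * ‖ζ.1‖ ^ k}

/-- The seminorm `p_{l,A,f}(u) = sup_{(ξ,η) ∈ A} (1 + |ξ| + |η|)^l |𝓕(f u)(ξ,η)|`. -/
def prodSeminorm {U₁ : Opens E₁} {U₂ : Opens E₂} (l : ℕ)
    (A : Set (StrongDual ℝ E₁ × StrongDual ℝ E₂)) (f : 𝓓(prodOpens U₁ U₂, ℝ)) :
    ExtSeminorm 𝓓'(prodOpens U₁ U₂, ℂ) :=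
  ExtSeminorm.ofFamily (ι := A) (fun ζ => ENNReal.ofReal ((1 + ‖ζ.1.1‖ + ‖ζ.1.2‖) ^ l)) fun ζ =>
    localFourier f (ζ.1.1.coprod ζ.1.2)

/-- The Fourier seminorms that are added to those of `I_ppp`. -/
def extraSeminorms (U₁ : Opens E₁) (U₂ : Opens E₂) (γ₁ : Set (E₁ × StrongDual ℝ E₁))
    (γ₂ : Set (E₂ × StrongDual ℝ E₂)) : Set (ExtSeminorm 𝓓'(prodOpens U₁ U₂, ℂ)) :=
  {p | ∃ (φ₁ : 𝓓(U₁, ℝ)) (φ₂ : 𝓓(U₂, ℝ)) (V₁ : Set (StrongDual ℝ E₁))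
    (V₂ : Set (StrongDual ℝ E₂)) (D : ℝ) (k l : ℕ),
    IsClosedCovectorCone V₁ ∧ IsClosedCovectorCone V₂ ∧
    Disjoint (tsupport φ₁ ×ˢ V₁) γ₁ ∧ Disjoint (tsupport φ₂ ×ˢ V₂) γ₂ ∧ 0 < D ∧ 1 ≤ k ∧
    (p = prodSeminorm l (region₁ D k ∩ univ ×ˢ V₂) (tensor φ₁ φ₂) ∨
      p = prodSeminorm l (region₂ D k ∩ V₁ ×ˢ univ) (tensor φ₁ φ₂))}

variable [FiniteDimensional ℝ E₁] [MeasureSpace E₁] [BorelSpace E₁]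
  [FiniteDimensional ℝ E₂] [MeasureSpace E₂] [BorelSpace E₂]

/-- All the seminorms generating `I_β`. -/
def betaSeminorms (U₁ : Opens E₁) (U₂ : Opens E₂) (γ₁ : Set (E₁ × StrongDual ℝ E₁))
    (γ₂ : Set (E₂ × StrongDual ℝ E₂)) : Set (ExtSeminorm 𝓓'(prodOpens U₁ U₂, ℂ)) :=
  pppSeminorms (prodOpens U₁ U₂) (dotProd U₁ U₂ γ₁ γ₂) ∪ extraSeminorms U₁ U₂ γ₁ γ₂

/-- The space `𝓓'_{γ,γ̄}(U₁ × U₂)` for `γ = γ₁ ×̇ γ₂`. -/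
abbrev fullSpace (U₁ : Opens E₁) (U₂ : Opens E₂) (γ₁ : Set (E₁ × StrongDual ℝ E₁))
    (γ₂ : Set (E₂ × StrongDual ℝ E₂)) : Submodule ℂ 𝓓'(prodOpens U₁ U₂, ℂ) :=
  wfSpace (prodOpens U₁ U₂) (dotProd U₁ U₂ γ₁ γ₂) (closure (dotProd U₁ U₂ γ₁ γ₂))

/-- The space `𝓓'_{γ,γ̄}(U₁ × U₂)` with the uniform structure of `I_β`; the added seminorms may be
infinite on it. -/
def FullBeta (U₁ : Opens E₁) (U₂ : Opens E₂) (γ₁ : Set (E₁ × StrongDual ℝ E₁))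
    (γ₂ : Set (E₂ × StrongDual ℝ E₂)) : Type _ :=
  fullSpace U₁ U₂ γ₁ γ₂

/-- The space of those elements of `𝓓'_{γ,γ̄}(U₁ × U₂)` on which the added seminorms are finite,
with the locally convex topology `I_β`. -/
def Beta (U₁ : Opens E₁) (U₂ : Opens E₂) (γ₁ : Set (E₁ × StrongDual ℝ E₁))
    (γ₂ : Set (E₂ × StrongDual ℝ E₂)) : Type _ :=
  (fullSpace U₁ U₂ γ₁ γ₂ ⊓ ExtSeminorm.finitePart (extraSeminorms U₁ U₂ γ₁ γ₂) :
    Submodule ℂ 𝓓'(prodOpens U₁ U₂, ℂ))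

variable (U₁ : Opens E₁) (U₂ : Opens E₂) (γ₁ : Set (E₁ × StrongDual ℝ E₁))
  (γ₂ : Set (E₂ × StrongDual ℝ E₂))

instance : UniformSpace (FullBeta U₁ U₂ γ₁ γ₂) :=
  .comap Subtype.val (ExtSeminorm.uniformSpace (betaSeminorms U₁ U₂ γ₁ γ₂))

instance : UniformSpace (Beta U₁ U₂ γ₁ γ₂) :=
  .comap Subtype.val (ExtSeminorm.uniformSpace (betaSeminorms U₁ U₂ γ₁ γ₂))

instance : AddCommGroup (Beta U₁ U₂ γ₁ γ₂) :=
  inferInstanceAs (AddCommGroup (fullSpace U₁ U₂ γ₁ γ₂ ⊓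
    ExtSeminorm.finitePart (extraSeminorms U₁ U₂ γ₁ γ₂) : Submodule ℂ 𝓓'(prodOpens U₁ U₂, ℂ)))

instance : Module ℂ (Beta U₁ U₂ γ₁ γ₂) :=
  inferInstanceAs (Module ℂ (fullSpace U₁ U₂ γ₁ γ₂ ⊓
    ExtSeminorm.finitePart (extraSeminorms U₁ U₂ γ₁ γ₂) : Submodule ℂ 𝓓'(prodOpens U₁ U₂, ℂ)))

/-- The underlying distribution. -/
def Beta.val {U₁ : Opens E₁} {U₂ : Opens E₂} {γ₁ : Set (E₁ × StrongDual ℝ E₁)}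
    {γ₂ : Set (E₂ × StrongDual ℝ E₂)} (u : Beta U₁ U₂ γ₁ γ₂) : 𝓓'(prodOpens U₁ U₂, ℂ) :=
  Subtype.val u

end Product

end GenHormander

end

/-!
# Completeness and hypocontinuity of the tensor product for the topology `I_β`

Both halves of the result rest on a description of the spaces `𝓓'_{γ,γ̄}` by duality: a distribution
lies in such a space as soon as it is bounded on each dual bounded set of test functions, that is,
on each set whose elements are supported in a common compact set and which is bounded in `𝓓'_{Γ,Γ}`
for a closed cone `Γ ⊆ -γᶜ`. Indeed, if the localized Fourier transform of `u` fails to have some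
polynomial decay near `(x, ξ) ∉ γ`, then a sequence of waves concentrating at this point, with
polynomially growing amplitudes, is bounded for the cone `Γ` consisting of the single ray opposite
to `(x, ξ)`, while `u` is unbounded on it (`DWF_subset_of_bounded`). Waves with all frequencies of a
cone away from `γ` similarly control the smooth wave front set (`WF_subset_closure_of_bounded`).
Conversely, by Parseval's formula and the Cauchy–Schwarz inequality a distribution with dual wave
front set in `γ` is bounded on dual bounded sets (`exists_pair_bound_of_DWF`).

*Completeness.* A Cauchy filter converges pointwise on test functions. Its limit is bounded on dual
bounded sets, since the members of the filter are. Hence it is a distribution, because it is bounded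
on bounded sequences of test functions, and it belongs to the space by the duality criterion. All
the seminorms of `I_β`, finite or not, are suprema of pairings with test functions and so lower
semicontinuous; the convergence holds for them as well (`exists_limit_betaSeminorms`). Finiteness of
the seminorms passes to the limit, which settles the subspace.

*The tensor product* is defined on the Fourier side: with cutoffs `χᵢ` equal to `1` near the
projections of the support of `φ`, its value on `φ` is the integral of the Fourier transforms of
`χ₁ u₁` and `χ₂ u₂` against that of `φ`. Let `φ` range over a dual bounded set for
`Γ₁ ×̇ Γ₂`. Near a given point of the product, `ft φ (-(ξ, η))` decays rapidly and uniformly when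
each of `ξ`, `η` is close to the fiber of its cone or small with respect to the other one
(`exists_local_kernel`), and in all other directions one of the factors decays rapidly. Integrating
first over the covector of a factor which ranges over a normally bounded set leaves a function of
the other covector which decays rapidly off a cone on which the other factor does; the integral over
this cone is controlled by a Fourier seminorm and the rest by a strong seminorm
(`dominated_tensorDist_right`, `dominated_tensorDist_left`). The duality criterion then places the
tensor product in the target space. The added seminorms of `I_β` are products of localized Fourier
transforms (`localFourier_tensorDist`), and in their regions one covector is bounded by a power of
the other one, which lies in a cone of rapid decay (`dominated_of_rapidOn`, `dominated_of_growth`).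

*Hypocontinuity.* These estimates give seminorms which are continuous on each step of the inductive
limit, hence on the limit (`SpaceIII.tendsto_of_dominated`), uniformly as the other factor ranges
over a set which is bounded for a closed cone contained in `γᵢ`. By Baire's theorem each absolutely
convex compact set is of this kind: if uniform decay failed near a point outside of `γᵢ`, it would
fail for countably many cutoffs and cones shrinking to this point, whereas each element of the
compact set decays on one of them (`WFset_subset_of_isCompact`).
-/

open Set Filter Topology TopologicalSpace MeasureTheory
open scoped Distributions ENNReal ContDiff

noncomputable section

namespace GenHormander

set_option linter.unusedSectionVars false

/-! ### Fourier transforms of compactly supported smooth functions -/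

section Fourier

variable {E : Type*} [NormedAddCommGroup E] [NormedSpace ℝ E]

@[simp] theorem norm_character (ξ : StrongDual ℝ E) (x : E) : ‖character ξ x‖ = 1 := by
  rw [character, ← mul_neg, ← Complex.ofReal_neg, mul_comm, Complex.norm_exp_ofReal_mul_I]

theorem character_add (ξ η : StrongDual ℝ E) (x : E) :
    character (ξ + η) x = character ξ x * character η x := by
  simp only [character, ← Complex.exp_add]
  congr 1
  simp only [add_apply, Complex.ofReal_add]
  ring

@[simp] theorem character_zero (x : E) : character (0 : StrongDual ℝ E) x = 1 := by
  simp [character]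

theorem continuous_character_uncurry :
    Continuous fun p : StrongDual ℝ E × E => character p.1 p.2 := by
  unfold character
  have : Continuous fun p : StrongDual ℝ E × E => p.1 p.2 := isBoundedBilinearMap_apply.continuous
  fun_prop

/-- The Haar measure on covectors. -/
abbrev dualHaar (E : Type*) [NormedAddCommGroup E] [NormedSpace ℝ E] [FiniteDimensional ℝ E] :
    Measure (StrongDual ℝ E) := Measure.addHaar

/-- An integer exponent `r` for which `(1 + |ξ|)⁻ʳ` is integrable on covectors. -/
abbrev decayExp (E : Type*) [NormedAddCommGroup E] [NormedSpace ℝ E] : ℕ :=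
  Module.finrank ℝ (StrongDual ℝ E) + 1

theorem integrable_decay [FiniteDimensional ℝ E] :
    Integrable (fun ξ => ((1 + ‖ξ‖) ^ decayExp E)⁻¹) (dualHaar E) := by
  have := integrable_one_add_norm (E := StrongDual ℝ E) (μ := dualHaar E)
    (r := (decayExp E : ℝ)) (by simp [decayExp])
  refine this.congr (.of_forall fun ξ => ?_)
  simp only
  rw [Real.rpow_neg (by positivity), Real.rpow_natCast]

variable [MeasureSpace E]

/-- The Fourier transform of a function, as a function of the covector. -/
def ft (φ : E → ℂ) (ξ : StrongDual ℝ E) : ℂ := ∫ x, φ x * character ξ x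

theorem ft_mul_character (φ : E → ℂ) (ξ η : StrongDual ℝ E) :
    ft (fun x => φ x * character ξ x) η = ft φ (ξ + η) := by
  simp only [ft, character_add, mul_assoc]

theorem ft_const_mul (c : ℂ) (φ : E → ℂ) (ξ : StrongDual ℝ E) :
    ft (fun x => c * φ x) ξ = c * ft φ ξ := by
  simp only [ft, mul_assoc, integral_const_mul]

variable [FiniteDimensional ℝ E] [BorelSpace E] [(volume : Measure E).IsAddHaarMeasure]

/-- The duality of `E` with its covectors, normalized for the Fourier transform of Mathlib. -/
def fourierPairing (E : Type*) [NormedAddCommGroup E] [NormedSpace ℝ E] :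
    E →L[ℝ] StrongDual ℝ E →L[ℝ] ℝ :=
  (2 * Real.pi)⁻¹ • NormedSpace.inclusionInDoubleDual ℝ E

theorem fourierChar_pairing (x : E) (ξ : StrongDual ℝ E) :
    (Real.fourierChar (-(fourierPairing E x ξ)) : ℂ) = character ξ x := by
  rw [Real.fourierChar_apply, character]
  congr 1
  simp only [fourierPairing, smul_apply, smul_eq_mul,
    NormedSpace.dual_def]
  push_cast
  have : (Real.pi : ℂ) ≠ 0 := by exact_mod_cast Real.pi_ne_zero
  field_simp

theorem ft_eq_fourierIntegral (φ : E → ℂ) :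
    ft φ = VectorFourier.fourierIntegral Real.fourierChar volume
      (fourierPairing E).toLinearMap₁₂ φ := by
  ext ξ
  simp only [ft, VectorFourier.fourierIntegral]
  refine integral_congr_ae (.of_forall fun x => ?_)
  simp only [Circle.smul_def, smul_eq_mul]
  rw [mul_comm]
  congr 1
  exact (fourierChar_pairing x ξ).symm

theorem continuous_ft {φ : E → ℂ} (hφ : Integrable φ) : Continuous (ft φ) := by
  rw [ft_eq_fourierIntegral]
  refine VectorFourier.fourierIntegral_continuous Real.continuous_fourierChar ?_ hφ
  exact (fourierPairing E).continuous₂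

/-- Rapid decay of Fourier transforms; the constant depends only on the order of decay and on a
compact set containing the support. -/
theorem exists_ft_bound {K : Set E} (hK : IsCompact K) (n : ℕ) :
    ∃ C : ℝ, 0 ≤ C ∧ ∀ φ : E → ℂ, ContDiff ℝ ∞ φ → tsupport φ ⊆ K → ∀ A : ℝ,
      (∀ i ≤ n, ∀ x, ‖iteratedFDeriv ℝ i φ x‖ ≤ A) → ∀ ξ, ‖ξ‖ ^ n * ‖ft φ ξ‖ ≤ C * A := by
  set v : ℝ := (volume K).toReal
  refine ⟨(4 * Real.pi) ^ n * (2 ^ n * ((n + 1) * v)), by positivity, fun φ hφ hs A hA ξ => ?_⟩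
  have hA0 : 0 ≤ A := (norm_nonneg _).trans (hA 0 (Nat.zero_le _) 0)
  have hcs : HasCompactSupport φ := hK.of_isClosed_subset (isClosed_tsupport φ) hs
  have hint : ∀ (k i : ℕ), (k : ℕ∞) ≤ 0 → (i : ℕ∞) ≤ ⊤ →
      Integrable (fun x => ‖x‖ ^ k * ‖iteratedFDeriv ℝ i φ x‖) volume := by
    intro k i _ _
    refine Continuous.integrable_of_hasCompactSupport ?_ ?_
    · exact (continuous_norm.pow k).mul (hφ.continuous_iteratedFDeriv (mod_cast le_top)).norm
    · exact (hcs.iteratedFDeriv i).norm.mul_left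
  have key : ∀ x : E, |ξ x| ^ n * ‖ft φ ξ‖ ≤
      ‖x‖ ^ n * ((2 * Real.pi) ^ n * (2 ^ n * ((n + 1) * v * A))) := by
    intro x
    have := VectorFourier.pow_mul_norm_iteratedFDeriv_fourierIntegral_le (K := 0) (N := ⊤)
      (fourierPairing E) hφ hint (k := 0) (n := n) le_rfl le_top x ξ
    rw [← ft_eq_fourierIntegral, norm_iteratedFDeriv_zero] at this
    have hsum : ∑ p ∈ Finset.range (0 + 1) ×ˢ Finset.range (n + 1),
        ∫ x, ‖x‖ ^ p.1 * ‖iteratedFDeriv ℝ p.2 φ x‖ ≤ (n + 1) * v * A := by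
      calc _ ≤ ∑ p ∈ Finset.range (0 + 1) ×ˢ Finset.range (n + 1), v * A := by
            refine Finset.sum_le_sum fun p hp => ?_
            simp only [zero_add, Finset.range_one, Finset.mem_product, Finset.mem_singleton,
              Finset.mem_range] at hp
            rw [hp.1]
            simp only [pow_zero, one_mul]
            rw [← setIntegral_eq_integral_of_forall_compl_eq_zero (s := K)]
            · calc _ ≤ ∫ x in K, A := by
                    refine setIntegral_mono_on ?_ ?_ hK.measurableSet fun x _ =>
                      hA _ (by lia) x
                    · have := hint 0 p.2 le_rfl le_top
                      simp only [pow_zero, one_mul] at this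
                      exact this.integrableOn
                    · exact integrableOn_const hK.measure_lt_top.ne
                _ = v * A := by simp [v, Measure.real]
            · intro x hx
              rw [norm_eq_zero]
              exact image_eq_zero_of_notMem_tsupport
                fun h => hx (hs (tsupport_iteratedFDeriv_subset _ h))
        _ = (n + 1) * v * A := by
            rw [Finset.sum_const]; simp; ring
    have hpair : fourierPairing E x ξ = (2 * Real.pi)⁻¹ * ξ x := by
      simp [fourierPairing]
    rw [hpair, abs_mul, mul_pow, abs_of_pos (by positivity : (0:ℝ) < (2 * Real.pi)⁻¹)] at this
    have h2 : (2 * Real.pi)⁻¹ ^ n * (|ξ x| ^ n * ‖ft φ ξ‖) ≤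
        ‖x‖ ^ n * (2 ^ n * ((n + 1) * v * A)) := by
      rw [← mul_assoc]
      refine this.trans ?_
      rw [mul_assoc, mul_assoc]
      refine mul_le_mul_of_nonneg_left ?_ (by positivity)
      simp only [pow_zero, one_mul, Nat.cast_zero, mul_zero, zero_add]
      exact mul_le_mul_of_nonneg_left hsum (by positivity)
    rw [inv_pow, inv_mul_le_iff₀ (by positivity)] at h2
    refine h2.trans (le_of_eq (by ring))
  -- A vector which almost realizes the norm of `ξ`.
  by_cases h0 : ‖ξ‖ = 0
  · rcases Nat.eq_zero_or_pos n with rfl | hn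
    · have := key 0
      simp only [pow_zero, one_mul] at this ⊢
      refine this.trans (le_of_eq (by ring))
    · rw [h0, zero_pow hn.ne', zero_mul]; positivity
  have hpos : 0 < ‖ξ‖ := lt_of_le_of_ne (norm_nonneg _) (Ne.symm h0)
  obtain ⟨x, hx1, hx2⟩ := ξ.exists_lt_apply_of_lt_opNorm (half_lt_self hpos)
  have h1 := key x
  rw [← Real.norm_eq_abs] at h1
  have h3 : (‖ξ‖ / 2) ^ n * ‖ft φ ξ‖ ≤ (2 * Real.pi) ^ n * (2 ^ n * ((n + 1) * v * A)) := by
    calc _ ≤ ‖ξ x‖ ^ n * ‖ft φ ξ‖ := by gcongr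
      _ ≤ _ := h1
      _ ≤ 1 ^ n * ((2 * Real.pi) ^ n * (2 ^ n * ((n + 1) * v * A))) := by gcongr
      _ = _ := by ring
  rw [div_pow, div_mul_eq_mul_div, div_le_iff₀ (by positivity)] at h3
  refine h3.trans (le_of_eq ?_)
  have : (4 * Real.pi) ^ n = (2 * Real.pi) ^ n * 2 ^ n := by rw [← mul_pow]; ring
  rw [this]; ring

theorem exists_ft_weighted_bound {K : Set E} (hK : IsCompact K) (n : ℕ) :
    ∃ C : ℝ, 0 ≤ C ∧ ∀ φ : E → ℂ, ContDiff ℝ ∞ φ → tsupport φ ⊆ K → ∀ A : ℝ,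
      (∀ i ≤ n, ∀ x, ‖iteratedFDeriv ℝ i φ x‖ ≤ A) → ∀ ξ, (1 + ‖ξ‖) ^ n * ‖ft φ ξ‖ ≤ C * A := by
  obtain ⟨C0, h0, H0⟩ := exists_ft_bound hK 0
  obtain ⟨C1, h1, H1⟩ := exists_ft_bound hK n
  refine ⟨2 ^ n * (C0 + C1), by positivity, fun φ hφ hs A hA ξ => ?_⟩
  have a0 := H0 φ hφ hs A (fun i hi => hA i (by lia)) ξ
  have a1 := H1 φ hφ hs A hA ξ
  have : (1 + ‖ξ‖) ^ n ≤ 2 ^ n * (1 + ‖ξ‖ ^ n) := by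
    rcases le_total ‖ξ‖ 1 with h | h
    · calc (1 + ‖ξ‖) ^ n ≤ 2 ^ n := by gcongr; linarith
        _ ≤ _ := le_mul_of_one_le_right (by positivity) (by simp)
    · calc (1 + ‖ξ‖) ^ n ≤ (2 * ‖ξ‖) ^ n := by gcongr; linarith
        _ = 2 ^ n * ‖ξ‖ ^ n := mul_pow _ _ _
        _ ≤ _ := by gcongr; simp
  calc _ ≤ 2 ^ n * (1 + ‖ξ‖ ^ n) * ‖ft φ ξ‖ := by gcongr
    _ = 2 ^ n * (‖ξ‖ ^ 0 * ‖ft φ ξ‖ + ‖ξ‖ ^ n * ‖ft φ ξ‖) := by ring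
    _ ≤ 2 ^ n * (C0 * A + C1 * A) := by gcongr
    _ = _ := by ring

theorem ft_rapid_decay {φ : E → ℂ} (hφ : ContDiff ℝ ∞ φ) (hs : HasCompactSupport φ) (n : ℕ) :
    ∃ C : ℝ, 0 ≤ C ∧ ∀ ξ, (1 + ‖ξ‖) ^ n * ‖ft φ ξ‖ ≤ C := by
  obtain ⟨C, hC, H⟩ := exists_ft_weighted_bound hs.isCompact n
  have hb : ∀ i : ℕ, ∃ A, ∀ x, ‖iteratedFDeriv ℝ i φ x‖ ≤ A := fun i =>
    (hφ.continuous_iteratedFDeriv (mod_cast le_top)).bounded_above_of_compact_support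
      (hs.iteratedFDeriv i)
  choose A hA using hb
  have hA0 : ∀ i, 0 ≤ A i := fun i => (norm_nonneg _).trans (hA i 0)
  refine ⟨C * ∑ i ∈ Finset.range (n + 1), A i,
    mul_nonneg hC (Finset.sum_nonneg fun i _ => hA0 i), H φ hφ subset_rfl _ fun i hi x => ?_⟩
  exact (hA i x).trans (Finset.single_le_sum (f := A) (fun i _ => hA0 i) (by simp; lia))

theorem integrable_of_decay {f : StrongDual ℝ E → ℂ} (hf : AEStronglyMeasurable f (dualHaar E))
    {C : ℝ} (h : ∀ ξ, (1 + ‖ξ‖) ^ decayExp E * ‖f ξ‖ ≤ C) : Integrable f (dualHaar E) := by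
  refine (integrable_decay.const_mul C).mono' hf (.of_forall fun ξ => ?_)
  rw [← div_eq_mul_inv, le_div_iff₀ (by positivity), mul_comm]
  exact h ξ

theorem integrable_ft {φ : E → ℂ} (hφ : ContDiff ℝ ∞ φ) (hs : HasCompactSupport φ) :
    Integrable (ft φ) (dualHaar E) := by
  obtain ⟨C, -, hC⟩ := ft_rapid_decay hφ hs (decayExp E)
  exact integrable_of_decay
    (continuous_ft (hφ.continuous.integrable_of_hasCompactSupport hs)).aestronglyMeasurable hC

theorem integrable_weighted_ft {φ : E → ℂ} (hφ : ContDiff ℝ ∞ φ) (hs : HasCompactSupport φ)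
    (i : ℕ) : Integrable (fun ξ => (1 + ‖ξ‖) ^ i * ‖ft φ ξ‖) (dualHaar E) := by
  obtain ⟨C, -, hC⟩ := ft_rapid_decay hφ hs (i + decayExp E)
  have hc := continuous_ft (hφ.continuous.integrable_of_hasCompactSupport (μ := volume) hs)
  refine (integrable_decay.const_mul C).mono'
    (((continuous_const.add continuous_norm).pow i).mul hc.norm).aestronglyMeasurable
    (.of_forall fun ξ => ?_)
  rw [← div_eq_mul_inv, le_div_iff₀ (by positivity), Real.norm_of_nonneg (by positivity)]
  refine le_trans (le_of_eq ?_) (hC ξ)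
  rw [pow_add]; ring

end Fourier

/-! ### Fourier inversion and products -/

section FourierInversion

variable {E : Type*} [NormedAddCommGroup E] [NormedSpace ℝ E] [FiniteDimensional ℝ E]
  [MeasureSpace E] [BorelSpace E] [(volume : Measure E).IsAddHaarMeasure]

variable (E) in
/-- Fourier inversion, with an unspecified constant since both Haar measures are arbitrary. It is
transported from the inversion formula of Schwartz functions on a Euclidean space. -/
theorem exists_ft_inversion : ∃ c : ℂ, ∀ φ : E → ℂ, ContDiff ℝ ∞ φ → HasCompactSupport φ →
    ∀ x, φ x = c * ∫ ξ, ft φ ξ * character (-ξ) x ∂dualHaar E := by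
  let F := EuclideanSpace ℝ (Fin (Module.finrank ℝ E))
  let e : E ≃L[ℝ] F := toEuclidean
  -- `w ↦ 2π ⟨w, e ·⟩` identifies the two kinds of frequencies.
  let L : F →ₗ[ℝ] StrongDual ℝ E :=
    { toFun := fun w => (2 * Real.pi) • (innerSL ℝ w).comp (e : E →L[ℝ] F)
      map_add' := fun w w' => by ext x; simp
      map_smul' := fun a w => by ext x; simp; ring }
  have hLapp : ∀ w x, L w x = 2 * Real.pi * inner ℝ w (e x) := fun w x => rfl
  have hLinj : Function.Injective L := by
    rw [injective_iff_map_eq_zero]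
    intro w hw
    have := DFunLike.congr_fun hw (e.symm w)
    rw [hLapp] at this
    rw [e.apply_symm_apply] at this
    exact inner_self_eq_zero.1 ((mul_eq_zero.1 this).resolve_left (by positivity))
  have hfin : Module.finrank ℝ F = Module.finrank ℝ (StrongDual ℝ E) := by
    have h1 : Module.finrank ℝ F = Module.finrank ℝ E := by simp [F]
    have h2 : Module.finrank ℝ (StrongDual ℝ E) = Module.finrank ℝ (Module.Dual ℝ E) :=
      (LinearMap.toContinuousLinearMap (𝕜 := ℝ) (E := E) (F' := ℝ)).finrank_eq.symm
    rw [h1, h2, Subspace.dual_finrank_eq]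
  let Le : F ≃L[ℝ] StrongDual ℝ E :=
    (LinearEquiv.ofInjectiveOfFinrankEq L hLinj hfin).toContinuousLinearEquiv
  have hLe : ∀ w x, Le w x = 2 * Real.pi * inner ℝ w (e x) := fun w x => rfl
  have hm1 : (Measure.map e (volume : Measure E)).IsAddHaarMeasure := e.isAddHaarMeasure_map _
  have hm2 : (Measure.map Le (volume : Measure F)).IsAddHaarMeasure := Le.isAddHaarMeasure_map _
  obtain ⟨k, hk⟩ : ∃ k : NNReal, (volume : Measure F) = k • Measure.map e (volume : Measure E) :=
    ⟨_, Measure.isAddLeftInvariant_eq_smul _ _⟩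
  obtain ⟨k', hk'⟩ : ∃ k' : NNReal, Measure.map Le (volume : Measure F) = k' • dualHaar E :=
    ⟨_, Measure.isAddLeftInvariant_eq_smul _ _⟩
  have he : ∀ g : F → ℂ, ∫ v, g v = (k : ℝ) • ∫ x, g (e x) := by
    intro g
    rw [hk, integral_smul_nnreal_measure]
    congr 1
    exact e.toHomeomorph.measurableEmbedding.integral_map g
  have hL' : ∀ g : StrongDual ℝ E → ℂ, ∫ w, g (Le w) = (k' : ℝ) • ∫ ξ, g ξ ∂dualHaar E := by
    intro g
    have h : ∫ y, g y ∂(Measure.map Le volume) = ∫ w, g (Le w) :=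
      Le.toHomeomorph.measurableEmbedding.integral_map g
    rw [← h, hk', integral_smul_nnreal_measure]
    rfl
  refine ⟨((k : ℝ) : ℂ) * ((k' : ℝ) : ℂ), fun φ hφ hs x => ?_⟩
  let f : F → ℂ := fun v => φ (e.symm v)
  have hfc : ContDiff ℝ ∞ f := hφ.comp e.symm.contDiff
  have hfs : HasCompactSupport f := hs.comp_homeomorph e.symm.toHomeomorph
  let fS : SchwartzMap F ℂ := hfs.toSchwartzMap hfc
  have hfS : (fS : F → ℂ) = f := rfl
  have hFint : Integrable (FourierTransform.fourier f) := by
    have := (FourierTransform.fourier fS).integrable (μ := volume)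
    rwa [SchwartzMap.fourier_coe] at this
  have hinv := congrFun (hfc.continuous.fourierInv_fourier_eq
    (hfc.continuous.integrable_of_hasCompactSupport hfs) hFint) (e x)
  have hF : ∀ w, FourierTransform.fourier f w = (k : ℝ) * ft φ (Le w) := by
    intro w
    rw [Real.fourier_eq', he, ft, Complex.real_smul]
    congr 1
    refine integral_congr_ae (.of_forall fun y => ?_)
    simp only [f, e.symm_apply_apply, smul_eq_mul, character, hLe]
    rw [mul_comm, real_inner_comm]
    congr 2
    push_cast
    ring
  rw [Real.fourierInv_eq'] at hinv
  have h1 : φ x = f (e x) := by simp [f]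
  rw [h1, ← hinv]
  have h2 : ∀ w : F, Complex.exp (↑(2 * Real.pi * inner ℝ w (e x)) * Complex.I) •
      FourierTransform.fourier f w =
      (k : ℝ) * (ft φ (Le w) * character (-(Le w)) x) := by
    intro w
    rw [hF, character, smul_eq_mul, mul_left_comm]
    congr 1
    rw [mul_comm]
    congr 2
    simp only [neg_apply, hLe]
    push_cast
    ring
  simp_rw [h2]
  rw [integral_const_mul, hL' (fun ξ => ft φ ξ * character (-ξ) x), Complex.real_smul, mul_assoc]

variable (E) in
/-- The constant in the Fourier inversion formula. -/
def invConst : ℂ := (exists_ft_inversion E).choose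

theorem ft_inversion {φ : E → ℂ} (hφ : ContDiff ℝ ∞ φ) (hs : HasCompactSupport φ) (x : E) :
    φ x = invConst E * ∫ ξ, ft φ ξ * character (-ξ) x ∂dualHaar E :=
  (exists_ft_inversion E).choose_spec φ hφ hs x

/-- The Fourier transform of a product is a convolution. -/
theorem ft_mul {χ φ : E → ℂ} (hχ : ContDiff ℝ ∞ χ) (hχs : HasCompactSupport χ)
    (hφ : ContDiff ℝ ∞ φ) (hφs : HasCompactSupport φ) (ξ : StrongDual ℝ E) :
    ft (fun x => χ x * φ x) ξ =
      invConst E * ∫ η, ft χ (ξ + η) * ft φ (-η) ∂dualHaar E := by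
  have hint : Integrable (fun p : E × StrongDual ℝ E =>
      (χ p.1 * ft φ p.2) * (character ξ p.1 * character (-p.2) p.1))
      ((volume : Measure E).prod (dualHaar E)) := by
    have h1 := (hχ.continuous.integrable_of_hasCompactSupport (μ := volume) hχs).mul_prod
      (integrable_ft hφ hφs)
    refine h1.mul_bdd (c := 1) ?_ (.of_forall fun p => by simp)
    refine Continuous.aestronglyMeasurable ?_
    have h2 : Continuous fun p : E × StrongDual ℝ E => character ξ p.1 :=
      (contDiff_character ξ).continuous.comp continuous_fst
    have h3 : Continuous fun p : E × StrongDual ℝ E => character (-p.2) p.1 :=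
      continuous_character_uncurry.comp (continuous_snd.neg.prodMk continuous_fst)
    exact h2.mul h3
  calc ft (fun x => χ x * φ x) ξ
      = ∫ x, invConst E * ∫ η, (χ x * ft φ η) * (character ξ x * character (-η) x) ∂dualHaar E := by
        refine integral_congr_ae (.of_forall fun x => ?_)
        simp only
        rw [ft_inversion hφ hφs x]
        rw [mul_left_comm, mul_assoc, ← integral_const_mul, ← integral_mul_const]
        congr 1
        refine integral_congr_ae (.of_forall fun η => ?_)
        simp only
        ring
    _ = invConst E * ∫ η, ∫ x, (χ x * ft φ η) * (character ξ x * character (-η) x)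
          ∂volume ∂dualHaar E := by
        rw [integral_const_mul, integral_integral_swap hint]
    _ = invConst E * ∫ η, ft χ (ξ + -η) * ft φ η ∂dualHaar E := by
        congr 1
        refine integral_congr_ae (.of_forall fun η => ?_)
        simp only [ft, character_add, ← integral_mul_const]
        refine integral_congr_ae (.of_forall fun x => ?_)
        simp only
        ring
    _ = _ := by
        rw [← integral_neg_eq_self]
        simp

/-- Derivatives are bounded by weighted integrals of the Fourier transform. -/
theorem exists_iteratedFDeriv_bound (i : ℕ) : ∃ C : ℝ, 0 ≤ C ∧
    ∀ φ : E → ℂ, ContDiff ℝ ∞ φ → HasCompactSupport φ →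
      ∀ x, ‖iteratedFDeriv ℝ i φ x‖ ≤ C * ∫ ξ, (1 + ‖ξ‖) ^ i * ‖ft φ ξ‖ ∂dualHaar E := by
  let L : StrongDual ℝ E →L[ℝ] E →L[ℝ] ℝ := -(fourierPairing E).flip
  refine ⟨‖invConst E‖ * ((2 * Real.pi * ‖L‖) ^ i * (i + 1)),
    by positivity, fun φ hφ hs x => ?_⟩
  have hcont := continuous_ft (hφ.continuous.integrable_of_hasCompactSupport (μ := volume) hs)
  have hrep : φ = fun x => invConst E • VectorFourier.fourierIntegral Real.fourierChar (dualHaar E)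
      L.toLinearMap₁₂ (ft φ) x := by
    ext x
    rw [ft_inversion hφ hs x, smul_eq_mul]
    congr 1
    refine integral_congr_ae (.of_forall fun ξ => ?_)
    simp only [Circle.smul_def, smul_eq_mul]
    rw [mul_comm]
    congr 1
    rw [← fourierChar_pairing]
    simp [L]
  have hbd : ∀ k ≤ i, ∀ ξ, ‖ξ‖ ^ k * ‖ft φ ξ‖ ≤ (1 + ‖ξ‖) ^ i * ‖ft φ ξ‖ := by
    intro k hk ξ
    gcongr
    calc ‖ξ‖ ^ k ≤ (1 + ‖ξ‖) ^ k := by gcongr; linarith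
      _ ≤ _ := by gcongr; linarith [norm_nonneg ξ]
  have hI : Integrable (fun ξ => (1 + ‖ξ‖) ^ i * ‖ft φ ξ‖) (dualHaar E) :=
    integrable_weighted_ft hφ hs i
  have hint : ∀ (k n : ℕ), (k : ℕ∞) ≤ i → (n : ℕ∞) ≤ 0 →
      Integrable (fun ξ => ‖ξ‖ ^ k * ‖iteratedFDeriv ℝ n (ft φ) ξ‖) (dualHaar E) := by
    intro k n hk hn
    obtain rfl : n = 0 := by simpa using hn
    simp only [norm_iteratedFDeriv_zero]
    refine hI.mono' ((continuous_norm.pow k).mul hcont.norm).aestronglyMeasurable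
      (.of_forall fun ξ => ?_)
    rw [Real.norm_of_nonneg (by positivity)]
    exact hbd k (by exact_mod_cast hk) ξ
  have hcd : ContDiff ℝ i (VectorFourier.fourierIntegral Real.fourierChar (dualHaar E)
      L.toLinearMap₁₂ (ft φ)) := by
    have := VectorFourier.contDiff_fourierIntegral (L := L) (μ := dualHaar E) (f := ft φ)
      (N := i) (fun n hn => by simpa using hint n 0 hn le_rfl)
    exact this
  conv_lhs => rw [hrep]
  rw [iteratedFDeriv_const_smul_apply' hcd.contDiffAt, norm_smul, mul_assoc]
  refine mul_le_mul_of_nonneg_left ?_ (norm_nonneg _)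
  have h0 : ContDiff ℝ ((0 : ℕ∞) : ℕ∞ω) (ft φ) := contDiff_zero.2 hcont
  have := VectorFourier.pow_mul_norm_iteratedFDeriv_fourierIntegral_le (K := i) (N := 0)
    L h0 hint (k := i) (n := 0) le_rfl (by simp) 0 x
  simp only [pow_zero, one_mul, mul_one] at this
  refine this.trans ?_
  rw [mul_assoc ((2 * Real.pi * ‖L‖) ^ i)]
  refine mul_le_mul_of_nonneg_left ?_ (by positivity)
  calc _ ≤ ∑ p ∈ Finset.range (i + 1) ×ˢ Finset.range (0 + 1),
        ∫ ξ, (1 + ‖ξ‖) ^ i * ‖ft φ ξ‖ ∂dualHaar E := by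
        refine Finset.sum_le_sum fun p hp => ?_
        simp only [zero_add, Finset.range_one, Finset.mem_product, Finset.mem_singleton,
              Finset.mem_range] at hp
        rw [hp.2]
        refine integral_mono (hint p.1 0 (by exact_mod_cast (by lia : p.1 ≤ i)) (by simp))
          hI fun ξ => ?_
        simpa using hbd p.1 (by lia) ξ
    _ = _ := by rw [Finset.sum_const]; simp

theorem integral_weighted_ft_le {φ : E → ℂ} {i : ℕ} {A : ℝ}
    (hA : ∀ ξ, (1 + ‖ξ‖) ^ (i + decayExp E) * ‖ft φ ξ‖ ≤ A) :
    ∫ ξ, (1 + ‖ξ‖) ^ i * ‖ft φ ξ‖ ∂dualHaar E ≤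
      (∫ ξ, ((1 + ‖ξ‖) ^ decayExp E)⁻¹ ∂dualHaar E) * A := by
  rw [mul_comm, ← integral_const_mul]
  refine integral_mono_of_nonneg (.of_forall fun ξ => by positivity)
    (integrable_decay.const_mul A) (.of_forall fun ξ => ?_)
  simp only
  rw [← div_eq_mul_inv, le_div_iff₀ (by positivity)]
  refine le_trans (le_of_eq ?_) (hA ξ)
  rw [pow_add]; ring

/-- Peetre's inequality. -/
theorem peetre (ξ η : StrongDual ℝ E) (n : ℕ) :
    (1 + ‖ξ‖) ^ n ≤ (1 + ‖ξ + η‖) ^ n * (1 + ‖η‖) ^ n := by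
  rw [← mul_pow]
  have h : ‖ξ‖ ≤ ‖ξ + η‖ + ‖η‖ := by simpa using norm_sub_le (ξ + η) η
  gcongr
  nlinarith [norm_nonneg η, norm_nonneg (ξ + η)]

variable (E) in
/-- Weighted bounds on the Fourier transform of a product, one factor of which has a rapidly
decreasing Fourier transform. -/
theorem exists_ft_mul_bound (n : ℕ) : ∃ C : ℝ, 0 ≤ C ∧ ∀ χ φ : E → ℂ, ContDiff ℝ ∞ χ →
    HasCompactSupport χ → ContDiff ℝ ∞ φ → HasCompactSupport φ → ∀ B A : ℝ,
      (∀ ζ, (1 + ‖ζ‖) ^ (n + decayExp E) * ‖ft χ ζ‖ ≤ B) →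
      ((∀ ξ, (1 + ‖ξ‖) ^ n * ‖ft φ ξ‖ ≤ A) →
        ∀ ξ, (1 + ‖ξ‖) ^ n * ‖ft (fun x => χ x * φ x) ξ‖ ≤ C * B * A) ∧
      ((∀ ξ, ‖ft φ ξ‖ ≤ A * (1 + ‖ξ‖) ^ n) →
        ∀ ξ, ‖ft (fun x => χ x * φ x) ξ‖ ≤ C * B * A * (1 + ‖ξ‖) ^ n) := by
  set J := ∫ ξ, ((1 + ‖ξ‖) ^ decayExp E)⁻¹ ∂dualHaar E
  have hJ : 0 ≤ J := integral_nonneg fun ξ => by positivity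
  refine ⟨‖invConst E‖ * J, by positivity, fun χ φ hχ hχs hφ hs B A hB => ?_⟩
  have hB0 : 0 ≤ B := le_trans (by positivity) (hB 0)
  have hχb : ∀ ζ, ‖ft χ ζ‖ ≤ B * ((1 + ‖ζ‖) ^ n)⁻¹ * ((1 + ‖ζ‖) ^ decayExp E)⁻¹ := by
    intro ζ
    rw [mul_assoc, ← mul_inv, ← pow_add, ← div_eq_mul_inv, le_div_iff₀ (by positivity), mul_comm]
    exact hB ζ
  -- It suffices to bound the integrand pointwise.
  have main : ∀ ξ (D : ℝ),
      (∀ η, ((1 + ‖ξ + η‖) ^ n)⁻¹ * ‖ft φ (-η)‖ ≤ D) →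
      ‖ft (fun x => χ x * φ x) ξ‖ ≤ ‖invConst E‖ * J * B * D := by
    intro ξ D hD
    rw [ft_mul hχ hχs hφ hs, norm_mul, mul_assoc, mul_assoc]
    refine mul_le_mul_of_nonneg_left ?_ (norm_nonneg _)
    have hint : Integrable (fun η => B * D * ((1 + ‖ξ + η‖) ^ decayExp E)⁻¹) (dualHaar E) :=
      ((integrable_decay (E := E)).comp_add_left ξ).const_mul (B * D)
    calc _ ≤ ∫ η, B * D * ((1 + ‖ξ + η‖) ^ decayExp E)⁻¹ ∂dualHaar E := by
          refine norm_integral_le_of_norm_le hint (.of_forall fun η => ?_)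
          rw [norm_mul]
          calc _ ≤ B * ((1 + ‖ξ + η‖) ^ n)⁻¹ * ((1 + ‖ξ + η‖) ^ decayExp E)⁻¹ * ‖ft φ (-η)‖ := by
                gcongr; exact hχb _
            _ = B * (((1 + ‖ξ + η‖) ^ n)⁻¹ * ‖ft φ (-η)‖) * ((1 + ‖ξ + η‖) ^ decayExp E)⁻¹ := by
                ring
            _ ≤ _ := by gcongr; exact hD η
      _ = B * D * J := by
          rw [integral_const_mul]
          congr 1
          exact integral_add_left_eq_self
            (fun η : StrongDual ℝ E => ((1 + ‖η‖) ^ decayExp E)⁻¹) ξ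
      _ = _ := by ring
  constructor
  · intro hA ξ
    have := main ξ (A * ((1 + ‖ξ‖) ^ n)⁻¹) fun η => by
      have h1 := hA (-η)
      rw [norm_neg] at h1
      rw [← div_eq_mul_inv, le_div_iff₀ (by positivity), mul_assoc, inv_mul_le_iff₀ (by positivity)]
      calc ‖ft φ (-η)‖ * (1 + ‖ξ‖) ^ n
          ≤ ‖ft φ (-η)‖ * ((1 + ‖ξ + η‖) ^ n * (1 + ‖η‖) ^ n) := by gcongr; exact peetre ξ η n
        _ = (1 + ‖ξ + η‖) ^ n * ((1 + ‖η‖) ^ n * ‖ft φ (-η)‖) := by ring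
        _ ≤ _ := by gcongr
    calc _ ≤ (1 + ‖ξ‖) ^ n * (‖invConst E‖ * J * B * (A * ((1 + ‖ξ‖) ^ n)⁻¹)) := by gcongr
      _ = _ := by field_simp
  · intro hA ξ
    have hA0 : 0 ≤ A := by
      have := (norm_nonneg _).trans (hA 0)
      simpa using this
    rw [mul_assoc]
    refine main ξ _ fun η => ?_
    rw [inv_mul_le_iff₀ (by positivity)]
    refine (hA (-η)).trans ?_
    have := peetre (-η) (ξ + η) n
    rw [neg_add_cancel_comm_assoc] at this
    calc _ ≤ A * ((1 + ‖ξ‖) ^ n * (1 + ‖ξ + η‖) ^ n) := by gcongr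
      _ = _ := by ring

end FourierInversion

/-! ### Complex test functions -/

section TestFunctions

variable {E : Type*} [NormedAddCommGroup E] [NormedSpace ℝ E] {Ω : Opens E}

/-- The product of a real and a complex test function. -/
def cut (f : 𝓓(Ω, ℝ)) (φ : 𝓓(Ω, ℂ)) : 𝓓(Ω, ℂ) := mulSmooth f φ φ.contDiff

theorem cut_apply (f : 𝓓(Ω, ℝ)) (φ : 𝓓(Ω, ℂ)) (x : E) : cut f φ x = (f x : ℂ) * φ x := rfl

/-- The wave `x ↦ f x * exp (-i ⟨ξ, x⟩)`. -/
def wave (f : 𝓓(Ω, ℝ)) (ξ : StrongDual ℝ E) : 𝓓(Ω, ℂ) :=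
  mulSmooth f (character ξ) (contDiff_character ξ)

theorem wave_apply (f : 𝓓(Ω, ℝ)) (ξ : StrongDual ℝ E) (x : E) :
    wave f ξ x = (f x : ℂ) * character ξ x := rfl

theorem localFourier_eq_pair (f : 𝓓(Ω, ℝ)) (ξ : StrongDual ℝ E) (u : 𝓓'(Ω, ℂ)) :
    localFourier f ξ u = pair (wave f ξ) u := rfl

/-- The product of a test function and a character. -/
def modulate (φ : 𝓓(Ω, ℂ)) (ξ : StrongDual ℝ E) : 𝓓(Ω, ℂ) where
  toFun x := φ x * character ξ x
  contDiff' := φ.contDiff.mul (contDiff_character ξ)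
  hasCompactSupport' := φ.hasCompactSupport.mul_right
  tsupport_subset' := (tsupport_mul_subset_left).trans φ.tsupport_subset

/-- A real test function as a complex test function. -/
def complexify (f : 𝓓(Ω, ℝ)) : 𝓓(Ω, ℂ) := TestFunction.postcompCLM Complex.ofRealCLM f

theorem complexify_apply (f : 𝓓(Ω, ℝ)) (x : E) : complexify f x = (f x : ℂ) := rfl

theorem pair_apply (φ : 𝓓(Ω, ℂ)) (u : 𝓓'(Ω, ℂ)) :
    pair φ u = u (TestFunction.postcompCLM Complex.reCLM φ)
      + Complex.I * u (TestFunction.postcompCLM Complex.imCLM φ) := rfl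

theorem pair_add_left (φ ψ : 𝓓(Ω, ℂ)) (u : 𝓓'(Ω, ℂ)) :
    pair (φ + ψ) u = pair φ u + pair ψ u := by
  simp only [pair_apply, map_add]; ring

theorem pair_smul_left (c : ℂ) (φ : 𝓓(Ω, ℂ)) (u : 𝓓'(Ω, ℂ)) :
    pair (c • φ) u = c * pair φ u := by
  have h1 : TestFunction.postcompCLM Complex.reCLM (c • φ) =
      c.re • TestFunction.postcompCLM Complex.reCLM φ
        - c.im • TestFunction.postcompCLM Complex.imCLM φ := by
    ext x
    simp
  have h2 : TestFunction.postcompCLM Complex.imCLM (c • φ) =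
      c.re • TestFunction.postcompCLM Complex.imCLM φ
        + c.im • TestFunction.postcompCLM Complex.reCLM φ := by
    ext x
    simp
  simp only [pair_apply, h1, h2, map_add, map_sub, map_smul, Complex.real_smul]
  apply Complex.ext <;> simp <;> ring

/-- The value of a distribution, as a linear form in the complex test function. -/
def pairLin (u : 𝓓'(Ω, ℂ)) : 𝓓(Ω, ℂ) →ₗ[ℂ] ℂ where
  toFun φ := pair φ u
  map_add' φ ψ := pair_add_left φ ψ u
  map_smul' c φ := pair_smul_left c φ u

theorem pair_complexify (f : 𝓓(Ω, ℝ)) (u : 𝓓'(Ω, ℂ)) : pair (complexify f) u = u f := by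
  have h1 : TestFunction.postcompCLM Complex.reCLM (complexify f) = f := by
    ext x; simp [complexify]
  have h2 : TestFunction.postcompCLM Complex.imCLM (complexify f) = 0 := by
    ext x; simp [complexify]
  rw [pair_apply, h1, h2, map_zero, mul_zero, add_zero]

theorem continuous_pair (u : 𝓓'(Ω, ℂ)) : Continuous fun φ : 𝓓(Ω, ℂ) => pair φ u := by
  simp only [pair_apply]
  have h : ∀ T : ℂ →L[ℝ] ℝ, Continuous fun φ : 𝓓(Ω, ℂ) => u (TestFunction.postcompCLM T φ) :=
    fun T => (map_continuous u).comp (TestFunction.postcompCLM T).continuous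
  exact (h _).add (continuous_const.mul (h _))

theorem tsupport_cut_subset (f : 𝓓(Ω, ℝ)) (φ : 𝓓(Ω, ℂ)) :
    tsupport (cut f φ) ⊆ tsupport f ∩ tsupport φ :=
  subset_inter (tsupport_smul_subset_left f φ) (tsupport_smul_subset_right f φ)

theorem tsupport_wave_subset (f : 𝓓(Ω, ℝ)) (ξ : StrongDual ℝ E) :
    tsupport (wave f ξ) ⊆ tsupport f := tsupport_smul_subset_left f _

theorem tsupport_modulate_subset (φ : 𝓓(Ω, ℂ)) (ξ : StrongDual ℝ E) :
    tsupport (modulate φ ξ) ⊆ tsupport φ := tsupport_mul_subset_left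

theorem tsupport_complexify_subset (f : 𝓓(Ω, ℝ)) : tsupport (complexify f) ⊆ tsupport f := by
  refine closure_mono fun x hx => ?_
  simpa [Function.mem_support, complexify_apply] using hx

variable [MeasureSpace E]

theorem ft_modulate (φ : 𝓓(Ω, ℂ)) (ξ η : StrongDual ℝ E) :
    ft (modulate φ ξ) η = ft φ (ξ + η) := ft_mul_character φ ξ η

theorem ft_wave (f : 𝓓(Ω, ℝ)) (ξ η : StrongDual ℝ E) :
    ft (wave f ξ) η = ft (complexify f) (ξ + η) := ft_mul_character (complexify f) ξ η

variable [FiniteDimensional ℝ E] [BorelSpace E] [(volume : Measure E).IsAddHaarMeasure]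

theorem TestFunction_integrable (φ : 𝓓(Ω, ℂ)) : Integrable (φ : E → ℂ) :=
  φ.continuous.integrable_of_hasCompactSupport φ.hasCompactSupport

theorem ft_add (φ ψ : 𝓓(Ω, ℂ)) (ξ : StrongDual ℝ E) : ft (φ + ψ : 𝓓(Ω, ℂ)) ξ = ft φ ξ + ft ψ ξ := by
  simp only [ft]
  rw [← integral_add]
  · refine integral_congr_ae (.of_forall fun x => ?_)
    simp [add_mul]
  · exact TestFunction_integrable (modulate φ ξ)
  · exact TestFunction_integrable (modulate ψ ξ)

theorem ft_smul (c : ℂ) (φ : 𝓓(Ω, ℂ)) (ξ : StrongDual ℝ E) :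
    ft (c • φ : 𝓓(Ω, ℂ)) ξ = c * ft φ ξ := ft_const_mul c φ ξ

theorem pair_toDistribution (θ φ : 𝓓(Ω, ℂ)) :
    pair θ (toDistribution φ) = ∫ x, θ x * φ x := by
  have key : ∀ g : 𝓓(Ω, ℝ), toDistribution φ g = ∫ x, (g x : ℂ) * φ x := by
    intro g
    change TestFunction.integralAgainstBilinCLM (ContinuousLinearMap.lsmul ℝ ℝ) volume φ g = _
    rw [TestFunction.integralAgainstBilinCLM_apply,
      if_pos (φ.continuous.locallyIntegrable.locallyIntegrableOn _)]
    simp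
  rw [pair_apply, key, key, ← integral_const_mul, ← integral_add]
  · refine integral_congr_ae (.of_forall fun x => ?_)
    simp only [TestFunction.postcompCLM_apply, Function.comp_apply, Complex.reCLM_apply,
      Complex.imCLM_apply]
    conv_rhs => rw [← Complex.re_add_im (θ x)]
    ring
  · exact TestFunction_integrable (cut (TestFunction.postcompCLM Complex.reCLM θ) φ)
  · exact (TestFunction_integrable (cut (TestFunction.postcompCLM Complex.imCLM θ) φ)).const_mul _

theorem localFourier_toDistribution (f : 𝓓(Ω, ℝ)) (ξ : StrongDual ℝ E) (φ : 𝓓(Ω, ℂ)) :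
    localFourier f ξ (toDistribution φ) = ft (cut f φ) ξ := by
  rw [localFourier_eq_pair, pair_toDistribution, ft]
  refine integral_congr_ae (.of_forall fun x => ?_)
  simp only [wave_apply, cut_apply]
  ring

/-- The weighted Fourier transform, as a linear map into bounded functions. -/
def weightedFtLin (Ω : Opens E) (M : ℕ) :
    𝓓(Ω, ℂ) →ₗ[ℝ] BoundedContinuousFunction (StrongDual ℝ E) ℂ where
  toFun φ := BoundedContinuousFunction.ofNormedAddCommGroup
    (fun ξ => ((1 + ‖ξ‖ : ℝ) : ℂ) ^ M * ft φ ξ)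
    ((Complex.continuous_ofReal.comp (continuous_const.add continuous_norm)).pow M |>.mul
      (continuous_ft (TestFunction_integrable φ)))
    (ft_rapid_decay φ.contDiff φ.hasCompactSupport M).choose
    (fun ξ => by
      rw [norm_mul, norm_pow, Complex.norm_of_nonneg (by positivity)]
      exact (ft_rapid_decay φ.contDiff φ.hasCompactSupport M).choose_spec.2 ξ)
  map_add' φ ψ := by
    ext ξ
    change _ * ft (φ + ψ : 𝓓(Ω, ℂ)) ξ = _ * ft φ ξ + _ * ft ψ ξ
    rw [ft_add, mul_add]
  map_smul' c φ := by
    ext ξ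
    change _ * ft ((c : ℂ) • φ : 𝓓(Ω, ℂ)) ξ = c • (_ * ft φ ξ)
    rw [ft_smul, Complex.real_smul, mul_left_comm]

theorem continuous_weightedFtLin (Ω : Opens E) (M : ℕ) : Continuous (weightedFtLin Ω M) := by
  rw [TestFunction.continuous_iff_continuous_comp]
  intro K hK
  let p := ContDiffMapSupportedIn.seminorm ℝ E ℂ ⊤ K
  have hp : WithSeminorms p := ContDiffMapSupportedIn.withSeminorms ℝ E ℂ ⊤ K
  obtain ⟨C, hC, H⟩ := exists_ft_weighted_bound K.isCompact M
  let T : 𝓓_{K}(E, ℂ) →ₗ[ℝ] BoundedContinuousFunction (StrongDual ℝ E) ℂ :=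
    (weightedFtLin Ω M).comp
      (TestFunction.ofSupportedInCLM ℝ hK : 𝓓_{K}(E, ℂ) →L[ℝ] 𝓓(Ω, ℂ)).toLinearMap
  refine hp.continuous_normedSpace_rng _ T ⟨Finset.Iic M, ⟨C, hC⟩, fun φ => ?_⟩
  change ‖T φ‖ ≤ C * (Finset.Iic M).sup p φ
  rw [BoundedContinuousFunction.norm_le (by positivity)]
  intro ξ
  change ‖((1 + ‖ξ‖ : ℝ) : ℂ) ^ M * ft φ ξ‖ ≤ _
  rw [norm_mul, norm_pow, Complex.norm_of_nonneg (by positivity)]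
  refine H φ φ.contDiff φ.tsupport_subset _ (fun i hi x => ?_) ξ
  exact (ContDiffMapSupportedIn.norm_iteratedFDeriv_apply_le_seminorm_top ℝ).trans
    (Seminorm.le_finset_sup_apply (p := p) (Finset.mem_Iic.2 hi))

/-- The weighted Fourier transform, as a continuous linear map into bounded functions. -/
def weightedFt (Ω : Opens E) (M : ℕ) :
    𝓓(Ω, ℂ) →L[ℝ] BoundedContinuousFunction (StrongDual ℝ E) ℂ :=
  ⟨weightedFtLin Ω M, continuous_weightedFtLin Ω M⟩

theorem weightedFt_apply (M : ℕ) (φ : 𝓓(Ω, ℂ)) (ξ : StrongDual ℝ E) :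
    weightedFt Ω M φ ξ = ((1 + ‖ξ‖ : ℝ) : ℂ) ^ M * ft φ ξ := rfl

theorem le_norm_weightedFt (M : ℕ) (φ : 𝓓(Ω, ℂ)) (ξ : StrongDual ℝ E) :
    (1 + ‖ξ‖) ^ M * ‖ft φ ξ‖ ≤ ‖weightedFt Ω M φ‖ := by
  refine le_trans (le_of_eq ?_) ((weightedFt Ω M φ).norm_coe_le_norm ξ)
  rw [weightedFt_apply, norm_mul, norm_pow, Complex.norm_of_nonneg (by positivity)]

/-- A set of test functions whose Fourier transforms decay rapidly in a uniform way. -/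
def FourierBounded (B : Set 𝓓(Ω, ℂ)) : Prop :=
  ∀ M : ℕ, ∃ A : ℝ, ∀ φ ∈ B, ∀ ξ, (1 + ‖ξ‖) ^ M * ‖ft φ ξ‖ ≤ A

theorem fourierBounded_of_isVonNBounded {B : Set 𝓓(Ω, ℂ)} (hB : Bornology.IsVonNBounded ℝ B) :
    FourierBounded B := by
  intro M
  obtain ⟨A, hA⟩ := ((NormedSpace.isVonNBounded_iff ℝ).1
    (hB.image (weightedFt Ω M))).exists_norm_le
  exact ⟨A, fun φ hφ ξ => (le_norm_weightedFt M φ ξ).trans (hA _ (mem_image_of_mem _ hφ))⟩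

/-- Among sets with a common compact support, those with uniform rapid decay of the Fourier
transforms are the bounded ones. -/
theorem isVonNBounded_of_fourierBounded {B : Set 𝓓(Ω, ℂ)} {K : Set E} (hK : IsCompact K)
    (hKΩ : K ⊆ Ω) (hs : ∀ φ ∈ B, tsupport φ ⊆ K) (hB : FourierBounded B) :
    Bornology.IsVonNBounded ℝ B := by
  let K' : Compacts E := ⟨K, hK⟩
  let B' : Set 𝓓_{K'}(E, ℂ) := {φ | TestFunction.ofSupportedIn (K := K') hKΩ φ ∈ B}
  have hB' : Bornology.IsVonNBounded ℝ B' := by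
    rw [(ContDiffMapSupportedIn.withSeminorms ℝ E ℂ ⊤ K').isVonNBounded_iff_seminorm_bounded]
    intro i
    obtain ⟨C, hC, H⟩ := exists_iteratedFDeriv_bound (E := E) i
    obtain ⟨A, hA⟩ := hB (i + decayExp E)
    set J := ∫ ξ, ((1 + ‖ξ‖) ^ decayExp E)⁻¹ ∂dualHaar E
    have hJ : 0 ≤ J := integral_nonneg fun ξ => by positivity
    refine ⟨C * (J * |A|) + 1, by positivity, fun φ hφ => ?_⟩
    refine lt_of_le_of_lt ?_ (lt_add_one _)
    rw [ContDiffMapSupportedIn.seminorm_top_le_iff ℝ (by positivity)]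
    intro x _
    refine (H φ φ.contDiff φ.hasCompactSupport x).trans ?_
    gcongr
    refine (integral_weighted_ft_le (hA _ hφ)).trans ?_
    gcongr
    exact le_abs_self A
  have := hB'.image (TestFunction.ofSupportedInCLM ℝ (K := K') (Ω := Ω) (n := ⊤) (F := ℂ) hKΩ)
  refine this.subset fun φ hφ => ?_
  exact ⟨⟨φ, φ.contDiff, fun x hx => image_eq_zero_of_notMem_tsupport
    fun h => hx (hs φ hφ h)⟩, hφ, rfl⟩

/-- A linear form on real test functions which is bounded by Fourier norms is a distribution. -/
theorem continuous_of_fourier_bound (u : 𝓓(Ω, ℝ) →ₗ[ℝ] ℂ)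
    (h : ∀ K : Set E, IsCompact K → K ⊆ Ω → ∃ (M : ℕ) (C : ℝ), ∀ f : 𝓓(Ω, ℝ), tsupport f ⊆ K →
      ∀ A : ℝ, (∀ ξ, (1 + ‖ξ‖) ^ M * ‖ft (complexify f) ξ‖ ≤ A) → ‖u f‖ ≤ C * A) :
    Continuous u := by
  rw [TestFunction.continuous_iff_continuous_comp]
  intro K hK
  obtain ⟨M, C, H⟩ := h K K.isCompact hK
  let v : 𝓓_{K}(E, ℝ) →ₗ[ℝ] ℂ :=
    u.comp (TestFunction.ofSupportedInCLM ℝ hK : 𝓓_{K}(E, ℝ) →L[ℝ] 𝓓(Ω, ℝ)).toLinearMap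
  change Continuous v
  refine continuous_of_continuousAt_zero v ?_
  have h0 : Tendsto (fun f : 𝓓_{K}(E, ℝ) =>
      C * ‖weightedFt Ω M (complexify (TestFunction.ofSupportedIn hK f))‖) (𝓝 0) (𝓝 0) := by
    have hc : Continuous fun f : 𝓓_{K}(E, ℝ) =>
        C * ‖weightedFt Ω M (complexify (TestFunction.ofSupportedIn hK f))‖ := by
      refine continuous_const.mul (continuous_norm.comp ((weightedFt Ω M).continuous.comp ?_))
      exact (TestFunction.postcompCLM Complex.ofRealCLM).continuous.comp
        (TestFunction.continuous_ofSupportedIn hK)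
    have := hc.tendsto 0
    have h1 : complexify (TestFunction.ofSupportedIn hK (0 : 𝓓_{K}(E, ℝ))) = (0 : 𝓓(Ω, ℂ)) := by
      ext x; simp [complexify_apply]
    simpa [h1] using this
  rw [ContinuousAt, map_zero]
  refine squeeze_zero_norm (fun f => ?_) h0
  exact H (TestFunction.ofSupportedIn hK f) f.tsupport_subset _ (le_norm_weightedFt M _)

end TestFunctions

/-! ### Distributions on the Fourier side -/

section Pairing

variable {E : Type*} [NormedAddCommGroup E] [NormedSpace ℝ E] {Ω : Opens E}
  [MeasureSpace E] [FiniteDimensional ℝ E] [BorelSpace E] [(volume : Measure E).IsAddHaarMeasure]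

/-- A linear form dominated by the norm of a linear map into a Hilbert space is represented by a
vector. -/
theorem exists_inner_of_norm_le {V H : Type*} [AddCommGroup V] [Module ℂ V]
    [NormedAddCommGroup H] [InnerProductSpace ℂ H] [CompleteSpace H]
    (f : V →ₗ[ℂ] ℂ) (J : V →ₗ[ℂ] H) (C : ℝ) (h : ∀ v, ‖f v‖ ≤ C * ‖J v‖) :
    ∃ y : H, ∀ v, f v = inner ℂ y (J v) := by
  have hker : LinearMap.ker J ≤ LinearMap.ker f := fun v hv => by
    have h1 := h v
    rw [LinearMap.mem_ker] at hv ⊢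
    rw [hv, norm_zero, mul_zero] at h1
    exact norm_le_zero_iff.1 h1
  let f0 : LinearMap.range J →ₗ[ℂ] ℂ :=
    ((LinearMap.ker J).liftQ f hker).comp J.quotKerEquivRange.symm.toLinearMap
  have hf0 : ∀ v, f0 ⟨J v, v, rfl⟩ = f v := by
    intro v
    have : J.quotKerEquivRange.symm ⟨J v, v, rfl⟩ = (LinearMap.ker J).mkQ v := by
      rw [LinearEquiv.symm_apply_eq]
      rfl
    simp only [f0, LinearMap.comp_apply, LinearEquiv.coe_coe, this]
    simp
  have hb : ∀ z, ‖f0 z‖ ≤ C * ‖z‖ := by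
    rintro ⟨_, v, rfl⟩
    rw [hf0]
    exact h v
  obtain ⟨g, hg, -⟩ := exists_extension_norm_eq _ (f0.mkContinuous C hb)
  refine ⟨(InnerProductSpace.toDual ℂ H).symm g, fun v => ?_⟩
  rw [InnerProductSpace.toDual_symm_apply, ← hf0 v]
  exact (hg ⟨J v, v, rfl⟩).symm

theorem memLp_two_of_decay {f : StrongDual ℝ E → ℂ} (hf : AEStronglyMeasurable f (dualHaar E))
    {C : ℝ} (h : ∀ ξ, (1 + ‖ξ‖) ^ decayExp E * ‖f ξ‖ ≤ C) : MemLp f 2 (dualHaar E) := by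
  rw [memLp_two_iff_integrable_sq_norm hf]
  refine (integrable_decay.const_mul (C ^ 2)).mono' (hf.norm.pow 2) (.of_forall fun ξ => ?_)
  rw [Real.norm_of_nonneg (by positivity), ← div_eq_mul_inv, le_div_iff₀ (by positivity)]
  calc ‖f ξ‖ ^ 2 * (1 + ‖ξ‖) ^ decayExp E
      ≤ ‖f ξ‖ ^ 2 * ((1 + ‖ξ‖) ^ decayExp E) ^ 2 := by
        gcongr
        exact le_self_pow₀ (one_le_pow₀ (by linarith [norm_nonneg ξ])) two_ne_zero
    _ = ((1 + ‖ξ‖) ^ decayExp E * ‖f ξ‖) ^ 2 := by ring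
    _ ≤ C ^ 2 := by gcongr; exact h ξ

/-- On test functions supported in a fixed compact set, a distribution is bounded by a weighted `L¹`
norm of the Fourier transform, because such norms control all derivatives. -/
theorem exists_pair_le_integral (u : 𝓓'(Ω, ℂ)) {K : Set E} (hK : IsCompact K) (hKΩ : K ⊆ Ω) :
    ∃ (m : ℕ) (C : ℝ), 0 ≤ C ∧ ∀ φ : 𝓓(Ω, ℂ), tsupport φ ⊆ K →
      ‖pair φ u‖ ≤ C * ∫ ξ, (1 + ‖ξ‖) ^ m * ‖ft φ ξ‖ ∂dualHaar E := by
  let K' : Compacts E := ⟨K, hK⟩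
  let p := ContDiffMapSupportedIn.seminorm ℝ E ℂ ⊤ K'
  have hp : WithSeminorms p := ContDiffMapSupportedIn.withSeminorms ℝ E ℂ ⊤ K'
  let v : 𝓓_{K'}(E, ℂ) →ₗ[ℝ] ℂ := ((pairLin u).restrictScalars ℝ).comp
    (TestFunction.ofSupportedInCLM ℝ hKΩ : 𝓓_{K'}(E, ℂ) →L[ℝ] 𝓓(Ω, ℂ)).toLinearMap
  have hv : Continuous v := (continuous_pair u).comp (TestFunction.continuous_ofSupportedIn hKΩ)
  obtain ⟨s, C, -, hC⟩ := Seminorm.bound_of_continuous hp ((normSeminorm ℝ ℂ).comp v)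
    (continuous_norm.comp hv)
  choose D hD0 hD using exists_iteratedFDeriv_bound (E := E)
  refine ⟨s.sup id, C * ∑ i ∈ s, D i,
    mul_nonneg C.2 (Finset.sum_nonneg fun i _ => hD0 i), fun φ hφ => ?_⟩
  let φ' : 𝓓_{K'}(E, ℂ) := ⟨φ, φ.contDiff, fun x hx => image_eq_zero_of_notMem_tsupport
    fun h => hx (hφ h)⟩
  have h1 : ‖pair φ u‖ ≤ C * s.sup p φ' := hC φ'
  refine h1.trans ?_
  rw [mul_assoc]
  have hI : ∀ i, 0 ≤ ∫ ξ, (1 + ‖ξ‖) ^ i * ‖ft φ ξ‖ ∂dualHaar E :=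
    fun i => integral_nonneg fun ξ => by positivity
  refine mul_le_mul_of_nonneg_left (Seminorm.finset_sup_apply_le ?_ fun i hi => ?_) C.2
  · exact mul_nonneg (Finset.sum_nonneg fun i _ => hD0 i) (hI _)
  · rw [ContDiffMapSupportedIn.seminorm_top_le_iff ℝ
      (mul_nonneg (Finset.sum_nonneg fun i _ => hD0 i) (hI _))]
    intro x _
    refine (hD i φ φ.contDiff φ.hasCompactSupport x).trans ?_
    refine mul_le_mul (Finset.single_le_sum (fun i _ => hD0 i) hi) ?_ (hI _)
      (Finset.sum_nonneg fun i _ => hD0 i)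
    refine integral_mono (integrable_weighted_ft φ.contDiff φ.hasCompactSupport i)
      (integrable_weighted_ft φ.contDiff φ.hasCompactSupport _) fun ξ => ?_
    simp only
    gcongr
    · linarith [norm_nonneg ξ]
    · exact Finset.le_sup (f := id) hi

theorem exists_pair_bound (u : 𝓓'(Ω, ℂ)) {K : Set E} (hK : IsCompact K) (hKΩ : K ⊆ Ω) :
    ∃ (M : ℕ) (C : ℝ), 0 ≤ C ∧ ∀ φ : 𝓓(Ω, ℂ), tsupport φ ⊆ K → ∀ A : ℝ,
      (∀ ξ, (1 + ‖ξ‖) ^ M * ‖ft φ ξ‖ ≤ A) → ‖pair φ u‖ ≤ C * A := by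
  obtain ⟨m, C, hC, H⟩ := exists_pair_le_integral u hK hKΩ
  refine ⟨m + decayExp E, C * ∫ ξ, ((1 + ‖ξ‖) ^ decayExp E)⁻¹ ∂dualHaar E,
    mul_nonneg hC (integral_nonneg fun ξ => by positivity), fun φ hφ A hA => ?_⟩
  refine (H φ hφ).trans ?_
  rw [mul_assoc]
  exact mul_le_mul_of_nonneg_left (integral_weighted_ft_le hA) hC

/-- On test functions supported in a fixed compact set, a distribution is given by integration
of the Fourier transform against a function of moderate growth. -/
theorem exists_fourier_density (u : 𝓓'(Ω, ℂ)) {K : Set E} (hK : IsCompact K) (hKΩ : K ⊆ Ω) :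
    ∃ (N : ℕ) (G : StrongDual ℝ E → ℂ), AEStronglyMeasurable G (dualHaar E) ∧
      Integrable (fun ξ => ((1 + ‖ξ‖) ^ N)⁻¹ * ‖G ξ‖) (dualHaar E) ∧
      ∀ φ : 𝓓(Ω, ℂ), tsupport φ ⊆ K → pair φ u = ∫ ξ, G ξ * ft φ ξ ∂dualHaar E := by
  obtain ⟨m, C, hC, H⟩ := exists_pair_le_integral u hK hKΩ
  set d := decayExp E
  -- Up to the square integrable factor `δ`, the weighted `L¹` norm is bounded by the `L²` norm of
  -- `w * ft φ`. So the distribution is represented by a vector of `L²`.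
  let w : StrongDual ℝ E → ℂ := fun ξ => ((1 + ‖ξ‖ : ℝ) : ℂ) ^ (m + d)
  have hwc : Continuous w :=
    (Complex.continuous_ofReal.comp (continuous_const.add continuous_norm)).pow _
  have hwn : ∀ ξ, ‖w ξ‖ = (1 + ‖ξ‖) ^ (m + d) := fun ξ => by
    rw [norm_pow, Complex.norm_of_nonneg (by positivity)]
  let S : Submodule ℂ 𝓓(Ω, ℂ) :=
    { carrier := {φ | tsupport φ ⊆ K}
      zero_mem' := by
        change tsupport ((0 : 𝓓(Ω, ℂ)) : E → ℂ) ⊆ K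
        rw [FunLike.coe_zero]; simp
      add_mem' := fun {φ ψ} hφ hψ =>
        (tsupport_add (φ : E → ℂ) ψ).trans (union_subset hφ hψ)
      smul_mem' := fun c φ hφ => (tsupport_smul_subset_right (fun _ : E => c) φ).trans hφ }
  have hmem : ∀ φ : 𝓓(Ω, ℂ), MemLp (fun ξ => w ξ * ft φ ξ) 2 (dualHaar E) := by
    intro φ
    obtain ⟨A, -, hA⟩ := ft_rapid_decay φ.contDiff φ.hasCompactSupport (m + d + d)
    refine memLp_two_of_decay
      (hwc.mul (continuous_ft (TestFunction_integrable φ))).aestronglyMeasurable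
      (C := A) fun ξ => ?_
    rw [norm_mul, hwn]
    refine le_trans (le_of_eq ?_) (hA ξ)
    rw [pow_add _ (m + d) d]; ring
  let J : S →ₗ[ℂ] Lp ℂ 2 (dualHaar E) :=
    { toFun := fun φ => (hmem φ.1).toLp
      map_add' := fun φ ψ => by
        rw [← MemLp.toLp_add]
        refine MemLp.toLp_congr _ _ (.of_forall fun ξ => ?_)
        change w ξ * ft (φ.1 + ψ.1 : 𝓓(Ω, ℂ)) ξ = w ξ * ft φ.1 ξ + w ξ * ft ψ.1 ξ
        rw [ft_add, mul_add]
      map_smul' := fun c φ => by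
        rw [RingHom.id_apply, ← MemLp.toLp_const_smul]
        refine MemLp.toLp_congr _ _ (.of_forall fun ξ => ?_)
        change w ξ * ft (c • φ.1 : 𝓓(Ω, ℂ)) ξ = c * (w ξ * ft φ.1 ξ)
        rw [ft_smul, mul_left_comm] }
  -- The inverse weight, an element of `L²`.
  let δ : StrongDual ℝ E → ℂ := fun ξ => (((1 + ‖ξ‖ : ℝ) : ℂ) ^ d)⁻¹
  have hδc : Continuous δ := by
    refine ((Complex.continuous_ofReal.comp (continuous_const.add continuous_norm)).pow _).inv₀
      fun ξ => pow_ne_zero _ ?_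
    exact Complex.ofReal_ne_zero.2 (by positivity : (1 + ‖ξ‖ : ℝ) ≠ 0)
  have hδn : ∀ ξ, ‖δ ξ‖ = ((1 + ‖ξ‖) ^ d)⁻¹ := fun ξ => by
    rw [norm_inv, norm_pow, Complex.norm_of_nonneg (by positivity)]
  have hδ : MemLp δ 2 (dualHaar E) := by
    refine memLp_two_of_decay hδc.aestronglyMeasurable (C := 1) fun ξ => ?_
    rw [hδn, mul_inv_cancel₀ (by positivity)]
  have hbound : ∀ φ : S, ‖((pairLin u).comp S.subtype) φ‖ ≤
      C * (eLpNorm δ 2 (dualHaar E)).toReal * ‖J φ‖ := by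
    intro φ
    refine (H φ.1 φ.2).trans ?_
    rw [mul_assoc]
    refine mul_le_mul_of_nonneg_left ?_ hC
    have h1 : ∀ ξ, (1 + ‖ξ‖) ^ m * ‖ft φ.1 ξ‖ = ‖(δ • fun ξ => w ξ * ft φ.1 ξ) ξ‖ := by
      intro ξ
      rw [Pi.smul_apply', smul_eq_mul, norm_mul, norm_mul, hδn, hwn, pow_add _ m d]
      have hp : (1 + ‖ξ‖) ^ d ≠ 0 := by positivity
      generalize (1 + ‖ξ‖) ^ d = a at hp ⊢
      field_simp
    simp_rw [h1]
    have hsm : AEStronglyMeasurable (δ • fun ξ => w ξ * ft φ.1 ξ) (dualHaar E) :=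
      hδ.1.smul (hmem φ.1).1
    rw [integral_norm_eq_lintegral_enorm hsm, ← eLpNorm_one_eq_lintegral_enorm]
    have h2 : ‖J φ‖ = (eLpNorm (fun ξ => w ξ * ft φ.1 ξ) 2 (dualHaar E)).toReal :=
      Lp.norm_toLp _ (hmem φ.1)
    rw [h2, ← ENNReal.toReal_mul]
    exact ENNReal.toReal_mono (ENNReal.mul_ne_top hδ.eLpNorm_ne_top (hmem φ.1).eLpNorm_ne_top)
      (eLpNorm_smul_le_mul_eLpNorm (p := 2) (q := 2) (r := 1) (hmem φ.1).1 hδ.1)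
  obtain ⟨y, hy⟩ := exists_inner_of_norm_le ((pairLin u).comp S.subtype) J _ hbound
  refine ⟨m + d + d, fun ξ => star (y ξ) * w ξ, ?_, ?_, fun φ hφ => ?_⟩
  · exact (continuous_star.comp_aestronglyMeasurable (Lp.aestronglyMeasurable y)).mul
      hwc.aestronglyMeasurable
  · have := (hδ.integrable_mul (Lp.memLp y)).norm
    refine this.congr (.of_forall fun ξ => ?_)
    simp only [Pi.mul_apply, norm_mul, hδn, hwn, norm_star]
    rw [pow_add _ (m + d) d]
    have hp : (1 + ‖ξ‖) ^ d ≠ 0 := by positivity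
    have hp' : (1 + ‖ξ‖) ^ (m + d) ≠ 0 := by positivity
    generalize (1 + ‖ξ‖) ^ d = a at hp ⊢
    generalize (1 + ‖ξ‖) ^ (m + d) = b at hp' ⊢
    field_simp
  · have h1 : pair φ u = inner ℂ y (J ⟨φ, hφ⟩) := hy ⟨φ, hφ⟩
    rw [h1, L2.inner_def]
    refine integral_congr_ae ?_
    filter_upwards [MemLp.coeFn_toLp (hmem φ)] with ξ hξ
    have h2 : (J ⟨φ, hφ⟩ : StrongDual ℝ E → ℂ) ξ = w ξ * ft φ ξ := hξ
    rw [h2, RCLike.inner_apply]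
    simp only [starRingEnd_apply]
    ring

theorem exists_localFourier_growth (f : 𝓓(Ω, ℝ)) (u : 𝓓'(Ω, ℂ)) :
    ∃ (M : ℕ) (C : ℝ), 0 ≤ C ∧ ∀ ξ, ‖localFourier f ξ u‖ ≤ C * (1 + ‖ξ‖) ^ M := by
  obtain ⟨M, C, hC, H⟩ := exists_pair_bound u f.hasCompactSupport.isCompact f.tsupport_subset
  obtain ⟨A, hA0, hA⟩ := ft_rapid_decay (complexify f).contDiff (complexify f).hasCompactSupport M
  refine ⟨M, C * A, by positivity, fun ξ => ?_⟩
  rw [localFourier_eq_pair, mul_assoc]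
  refine H _ (tsupport_wave_subset f ξ) _ fun η => ?_
  rw [ft_wave]
  have := peetre η ξ M
  rw [add_comm η ξ] at this
  calc _ ≤ (1 + ‖ξ + η‖) ^ M * (1 + ‖ξ‖) ^ M * ‖ft (complexify f) (ξ + η)‖ := by gcongr
    _ = ((1 + ‖ξ + η‖) ^ M * ‖ft (complexify f) (ξ + η)‖) * (1 + ‖ξ‖) ^ M := by ring
    _ ≤ _ := by gcongr; exact hA _

theorem continuous_localFourier (f : 𝓓(Ω, ℝ)) (u : 𝓓'(Ω, ℂ)) :
    Continuous fun ξ => localFourier f ξ u := by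
  obtain ⟨N, G, hGm, hGi, hG⟩ :=
    exists_fourier_density u f.hasCompactSupport.isCompact f.tsupport_subset
  obtain ⟨A, hA0, hA⟩ := ft_rapid_decay (complexify f).contDiff (complexify f).hasCompactSupport N
  -- The density turns the localized Fourier transform into a convolution with a rapidly decreasing
  -- function, which is continuous by dominated convergence.
  have hrep : ∀ ξ, localFourier f ξ u = ∫ η, G η * ft (complexify f) (ξ + η) ∂dualHaar E := by
    intro ξ
    rw [localFourier_eq_pair, hG _ (tsupport_wave_subset f ξ)]
    simp_rw [ft_wave]
  simp_rw [hrep]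
  have hc := continuous_ft (TestFunction_integrable (complexify f))
  refine continuous_iff_continuousAt.2 fun ξ₀ => ?_
  refine continuousAt_of_dominated
    (bound := fun η => A * (2 + ‖ξ₀‖) ^ N * (((1 + ‖η‖) ^ N)⁻¹ * ‖G η‖)) ?_ ?_
    (hGi.const_mul _) (.of_forall fun η => ?_)
  · exact .of_forall fun ξ => hGm.mul (hc.comp (by fun_prop)).aestronglyMeasurable
  · filter_upwards [Metric.ball_mem_nhds ξ₀ one_pos] with ξ hξ
    refine .of_forall fun η => ?_
    rw [norm_mul]
    have h1 : ‖ξ‖ ≤ 1 + ‖ξ₀‖ := by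
      rw [mem_ball_iff_norm] at hξ
      have := norm_add_le (ξ - ξ₀) ξ₀
      rw [sub_add_cancel] at this
      linarith
    have h2 := hA (ξ + η)
    have h3 := peetre η ξ N
    rw [add_comm η ξ] at h3
    have h4 : ‖ft (complexify f) (ξ + η)‖ ≤ A * (2 + ‖ξ₀‖) ^ N * ((1 + ‖η‖) ^ N)⁻¹ := by
      rw [← div_eq_mul_inv, le_div_iff₀ (by positivity)]
      calc _ ≤ ‖ft (complexify f) (ξ + η)‖ * ((1 + ‖ξ + η‖) ^ N * (1 + ‖ξ‖) ^ N) := by gcongr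
        _ = ((1 + ‖ξ + η‖) ^ N * ‖ft (complexify f) (ξ + η)‖) * (1 + ‖ξ‖) ^ N := by ring
        _ ≤ A * (2 + ‖ξ₀‖) ^ N := by
          have : 1 + ‖ξ‖ ≤ 2 + ‖ξ₀‖ := by linarith
          gcongr
    calc _ ≤ ‖G η‖ * (A * (2 + ‖ξ₀‖) ^ N * ((1 + ‖η‖) ^ N)⁻¹) := by gcongr
      _ = _ := by ring
  · exact (continuous_const.mul (hc.comp (by fun_prop))).continuousAt

/-- Parseval's formula for the pairing of a localized distribution with a test function. -/
theorem pair_cut (f : 𝓓(Ω, ℝ)) (φ : 𝓓(Ω, ℂ)) (u : 𝓓'(Ω, ℂ)) :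
    pair (cut f φ) u = invConst E * ∫ ξ, localFourier f ξ u * ft φ (-ξ) ∂dualHaar E := by
  obtain ⟨N, G, hGm, hGi, hG⟩ :=
    exists_fourier_density u f.hasCompactSupport.isCompact f.tsupport_subset
  obtain ⟨A, hA0, hA⟩ := ft_rapid_decay (complexify f).contDiff (complexify f).hasCompactSupport N
  have hc := continuous_ft (TestFunction_integrable (complexify f))
  have hcφ := continuous_ft (TestFunction_integrable φ)
  have hφi := integrable_weighted_ft φ.contDiff φ.hasCompactSupport N
  have hint : Integrable (fun p : StrongDual ℝ E × StrongDual ℝ E =>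
      G p.1 * (ft (complexify f) (p.1 + p.2) * ft φ (-p.2))) ((dualHaar E).prod (dualHaar E)) := by
    refine ((hGi.mul_prod hφi.comp_neg).const_mul A).mono' ?_ (.of_forall fun p => ?_)
    · exact hGm.comp_fst.mul (((hc.comp (by fun_prop)).mul (hcφ.comp (by fun_prop)))
        |>.aestronglyMeasurable)
    · have h3 := peetre p.1 p.2 N
      have h2 := hA (p.1 + p.2)
      rw [norm_mul, norm_mul, norm_neg]
      have h4 : ‖ft (complexify f) (p.1 + p.2)‖ ≤ A * (1 + ‖p.2‖) ^ N * ((1 + ‖p.1‖) ^ N)⁻¹ := by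
        rw [← div_eq_mul_inv, le_div_iff₀ (by positivity)]
        calc _ ≤ ‖ft (complexify f) (p.1 + p.2)‖ *
              ((1 + ‖p.1 + p.2‖) ^ N * (1 + ‖p.2‖) ^ N) := by gcongr
          _ = ((1 + ‖p.1 + p.2‖) ^ N * ‖ft (complexify f) (p.1 + p.2)‖) * (1 + ‖p.2‖) ^ N := by
            ring
          _ ≤ _ := by gcongr
      calc _ ≤ ‖G p.1‖ * (A * (1 + ‖p.2‖) ^ N * ((1 + ‖p.1‖) ^ N)⁻¹ * ‖ft φ (-p.2)‖) := by gcongr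
        _ = _ := by ring
  rw [hG _ ((tsupport_cut_subset f φ).trans inter_subset_left)]
  have h1 : ∀ ξ, ft (cut f φ) ξ =
      invConst E * ∫ η, ft (complexify f) (ξ + η) * ft φ (-η) ∂dualHaar E := fun ξ =>
    ft_mul (complexify f).contDiff (complexify f).hasCompactSupport φ.contDiff
      φ.hasCompactSupport ξ
  calc _ = ∫ ξ, invConst E * ∫ η, G ξ * (ft (complexify f) (ξ + η) * ft φ (-η))
        ∂dualHaar E ∂dualHaar E := by
        refine integral_congr_ae (.of_forall fun ξ => ?_)
        simp only
        rw [h1, integral_const_mul]; ring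
    _ = invConst E * ∫ η, ∫ ξ, G ξ * (ft (complexify f) (ξ + η) * ft φ (-η))
        ∂dualHaar E ∂dualHaar E := by
        rw [integral_const_mul, integral_integral_swap hint]
    _ = _ := by
        congr 1
        refine integral_congr_ae (.of_forall fun η => ?_)
        simp only
        rw [localFourier_eq_pair, hG _ (tsupport_wave_subset f η), ← integral_mul_const]
        refine integral_congr_ae (.of_forall fun ξ => ?_)
        simp only [ft_wave]
        rw [add_comm η ξ]; ring

end Pairing

/-! ### Cutoff functions and partitions of unity -/

section Localization

variable {E : Type*} [NormedAddCommGroup E] [NormedSpace ℝ E] [FiniteDimensional ℝ E]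
  {Ω : Opens E}

theorem cut_eq_self {K : Set E} {f : 𝓓(Ω, ℝ)} (hf : ∀ x ∈ K, f x = 1) {φ : 𝓓(Ω, ℂ)}
    (hφ : tsupport φ ⊆ K) : cut f φ = φ := by
  ext x
  rw [cut_apply]
  by_cases hx : x ∈ tsupport φ
  · rw [hf x (hφ hx)]; simp
  · rw [image_eq_zero_of_notMem_tsupport hx, mul_zero]

theorem cut_add (f g : 𝓓(Ω, ℝ)) (φ : 𝓓(Ω, ℂ)) : cut (f + g) φ = cut f φ + cut g φ := by
  ext x; simp [cut_apply, add_mul]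

theorem cut_zero (φ : 𝓓(Ω, ℂ)) : cut (0 : 𝓓(Ω, ℝ)) φ = 0 := by
  ext x; simp [cut_apply]

theorem exists_cutoff {K O : Set E} (hK : IsCompact K) (hO : IsOpen O) (hKO : K ⊆ O)
    (hOΩ : O ⊆ Ω) : ∃ f : 𝓓(Ω, ℝ), (∀ x ∈ K, f x = 1) ∧ tsupport f ⊆ O := by
  obtain ⟨K', hK', hKK', hK'O⟩ := exists_compact_between hK hO hKO
  obtain ⟨g, hg0, hg1, -⟩ := exists_contMDiffMap_zero_one_of_isClosed (n := (⊤ : ℕ∞))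
    (modelWithCornersSelf ℝ E) (s := (interior K')ᶜ) (t := K)
    isOpen_interior.isClosed_compl hK.isClosed
    (disjoint_left.2 fun x hx hx' => hx (hKK' hx'))
  have hs : tsupport g ⊆ K' := by
    refine closure_minimal (fun x hx => ?_) hK'.isClosed
    by_contra hxK
    exact hx (hg0 fun h => hxK (interior_subset h))
  exact ⟨⟨g, g.contMDiff.contDiff, hK'.of_isClosed_subset (isClosed_tsupport _) hs,
    hs.trans (hK'O.trans hOΩ)⟩, fun x hx => hg1 hx, hs.trans hK'O⟩

/-- A property of test functions which is stable under addition holds for `f` if it holds for all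
test functions with small support in the support of `f`. -/
theorem local_induction {P : 𝓓(Ω, ℝ) → Prop} (h0 : P 0) (hadd : ∀ f g, P f → P g → P (f + g))
    (f : 𝓓(Ω, ℝ)) (hloc : ∀ x ∈ tsupport f, ∃ O ∈ 𝓝 x, ∀ g : 𝓓(Ω, ℝ),
      tsupport g ⊆ O → tsupport g ⊆ tsupport f → P g) : P f := by
  choose! O hO hP using hloc
  obtain ⟨t, ht, hcov⟩ := f.hasCompactSupport.isCompact.elim_nhds_subcover
    (fun x => interior (O x)) (fun x hx => interior_mem_nhds.2 (hO x hx))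
  obtain ⟨ρ, hρ⟩ := SmoothPartitionOfUnity.exists_isSubordinate (modelWithCornersSelf ℝ E)
    (isClosed_tsupport f) (fun i : t => interior (O i.1)) (fun i => isOpen_interior) (by
      intro x hx
      obtain ⟨y, hy, hxy⟩ := mem_iUnion₂.1 (hcov hx)
      exact mem_iUnion.2 ⟨⟨y, hy⟩, hxy⟩)
  -- The function is the sum of its products with a partition of unity subordinate to the cover.
  let F : t → 𝓓(Ω, ℝ) := fun i =>
    { toFun := fun x => f x * ρ i x
      contDiff' := f.contDiff.mul (ρ i).contMDiff.contDiff
      hasCompactSupport' := f.hasCompactSupport.mul_right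
      tsupport_subset' := tsupport_mul_subset_left.trans f.tsupport_subset }
  have hF : ∀ i, P (F i) := fun i => hP i.1 (ht _ i.2) _
    ((tsupport_mul_subset_right (f := f)).trans ((hρ i).trans interior_subset))
    (tsupport_mul_subset_left (g := ρ i))
  have hsum : ∀ s : Finset t, P (∑ i ∈ s, F i) := by
    classical
    intro s
    induction s using Finset.induction_on with
    | empty => simpa using h0
    | insert i s hi ih => rw [Finset.sum_insert hi]; exact hadd _ _ (hF i) ih
  have hfin : f = ∑ i, F i := by
    ext x
    have h1 : ∀ s : Finset t, (∑ i ∈ s, F i) x = f x * ∑ i ∈ s, ρ i x := by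
      classical
      intro s
      induction s using Finset.induction_on with
      | empty => simp
      | insert i s hi ih =>
        rw [Finset.sum_insert hi, Finset.sum_insert hi, mul_add, ← ih]; rfl
    rw [h1]
    by_cases hx : x ∈ tsupport f
    · have := ρ.sum_eq_one hx
      rw [finsum_eq_sum_of_fintype] at this
      rw [this, mul_one]
    · rw [image_eq_zero_of_notMem_tsupport hx, zero_mul]
  rw [hfin]
  exact hsum _

end Localization

/-! ### Bounded families of distributions and their wave front sets -/

section Families

variable {E : Type*} [NormedAddCommGroup E] [NormedSpace ℝ E] {Ω : Opens E}

/-- A set of distributions is strongly bounded if it is uniformly bounded on every bounded set of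
test functions. -/
def StronglyBounded (𝒰 : Set 𝓓'(Ω, ℂ)) : Prop :=
  ∀ B : Set 𝓓(Ω, ℂ), Bornology.IsVonNBounded ℝ B → ∃ C : ℝ, ∀ u ∈ 𝒰, ∀ φ ∈ B, ‖pair φ u‖ ≤ C

/-- The Fourier transforms of the localizations `f u` with `u ∈ 𝒰` decay rapidly on `V`,
uniformly. -/
def RapidOn (𝒰 : Set 𝓓'(Ω, ℂ)) (f : 𝓓(Ω, ℝ)) (V : Set (StrongDual ℝ E)) : Prop :=
  ∀ k : ℕ, ∃ C : ℝ, ∀ u ∈ 𝒰, ∀ ξ ∈ V, (1 + ‖ξ‖) ^ k * ‖localFourier f ξ u‖ ≤ C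

/-- Boundedness for the seminorms of the normal topology attached to `Γ`. -/
def NormallyBounded (Γ : Set (E × StrongDual ℝ E)) (𝒰 : Set 𝓓'(Ω, ℂ)) : Prop :=
  StronglyBounded 𝒰 ∧ ∀ (f : 𝓓(Ω, ℝ)) (V : Set (StrongDual ℝ E)), IsClosedCovectorCone V →
    Disjoint (tsupport f ×ˢ V) Γ → RapidOn 𝒰 f V

theorem enorm_le_ofReal {a : ℂ} {C : ℝ} (h : ‖a‖ ≤ C) : ‖a‖ₑ ≤ ENNReal.ofReal C := by
  rw [← ofReal_norm]; exact ENNReal.ofReal_le_ofReal h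

theorem iSup_ofFamily_lt_top_iff {M ι : Type*} [AddCommGroup M] [Module ℂ M] (w : ι → ℝ)
    (hw : ∀ i, 0 ≤ w i) (L : ι → M →ₗ[ℂ] ℂ) (S : Set M) :
    (⨆ u ∈ S, ExtSeminorm.ofFamily (fun i => ENNReal.ofReal (w i)) L u) < ⊤ ↔
      ∃ C : ℝ, ∀ u ∈ S, ∀ i, w i * ‖L i u‖ ≤ C := by
  have key : ∀ u i, ENNReal.ofReal (w i) * ‖L i u‖ₑ = ENNReal.ofReal (w i * ‖L i u‖) :=
      fun u i => by
    rw [ENNReal.ofReal_mul (hw i), ofReal_norm]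
  constructor
  · intro h
    refine ⟨(⨆ u ∈ S, ExtSeminorm.ofFamily (fun i => ENNReal.ofReal (w i)) L u).toReal,
      fun u hu i => ?_⟩
    rw [← ENNReal.ofReal_le_iff_le_toReal h.ne, ← key]
    exact (le_iSup (fun i => ENNReal.ofReal (w i) * ‖L i u‖ₑ) i).trans
      (le_iSup₂ (f := fun u (_ : u ∈ S) => ExtSeminorm.ofFamily
        (fun i => ENNReal.ofReal (w i)) L u) u hu)
  · rintro ⟨C, hC⟩
    refine lt_of_le_of_lt (iSup₂_le fun u hu => iSup_le fun i => ?_)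
      (ENNReal.ofReal_lt_top (r := C))
    change ENNReal.ofReal (w i) * ‖L i u‖ₑ ≤ _
    rw [key]
    exact ENNReal.ofReal_le_ofReal (hC u hu i)

theorem iSup_strongSeminorm_lt_top_iff (B : Set 𝓓(Ω, ℂ)) (𝒰 : Set 𝓓'(Ω, ℂ)) :
    (⨆ u ∈ 𝒰, strongSeminorm B u) < ⊤ ↔ ∃ C : ℝ, ∀ u ∈ 𝒰, ∀ φ ∈ B, ‖pair φ u‖ ≤ C := by
  have := iSup_ofFamily_lt_top_iff (ι := B) (fun _ => (1 : ℝ)) (fun _ => zero_le_one)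
    (fun φ => pair φ.1) 𝒰
  simpa [strongSeminorm] using this

theorem iSup_fourierSeminorm_lt_top_iff (k : ℕ) (f : 𝓓(Ω, ℝ)) (V : Set (StrongDual ℝ E))
    (𝒰 : Set 𝓓'(Ω, ℂ)) : (⨆ u ∈ 𝒰, fourierSeminorm k f V u) < ⊤ ↔
      ∃ C : ℝ, ∀ u ∈ 𝒰, ∀ ξ ∈ V, (1 + ‖ξ‖) ^ k * ‖localFourier f ξ u‖ ≤ C := by
  have := iSup_ofFamily_lt_top_iff (ι := V) (fun ξ => (1 + ‖ξ.1‖) ^ k) (fun ξ => by positivity)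
    (fun ξ => localFourier f ξ.1) 𝒰
  simpa [fourierSeminorm] using this

theorem normallyBounded_iff (Γ : Set (E × StrongDual ℝ E)) (𝒰 : Set 𝓓'(Ω, ℂ)) :
    NormallyBounded Γ 𝒰 ↔ ∀ p ∈ normalSeminorms Ω Γ, (⨆ u ∈ 𝒰, p u) < ⊤ := by
  constructor
  · rintro ⟨h1, h2⟩ p (⟨B, hB, rfl⟩ | ⟨k, f, V, hV, hd, rfl⟩)
    · exact (iSup_strongSeminorm_lt_top_iff B 𝒰).2 (h1 B hB)
    · exact (iSup_fourierSeminorm_lt_top_iff k f V 𝒰).2 (h2 f V hV hd k)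
  · intro h
    exact ⟨fun B hB => (iSup_strongSeminorm_lt_top_iff B 𝒰).1 (h _ (Or.inl ⟨B, hB, rfl⟩)),
      fun f V hV hd k => (iSup_fourierSeminorm_lt_top_iff k f V 𝒰).1
        (h _ (Or.inr ⟨k, f, V, hV, hd, rfl⟩))⟩

theorem RapidOn.mono {𝒰 : Set 𝓓'(Ω, ℂ)} {f : 𝓓(Ω, ℝ)} {V W : Set (StrongDual ℝ E)}
    (h : RapidOn 𝒰 f V) (hW : W ⊆ V) : RapidOn 𝒰 f W := fun k => by
  obtain ⟨C, hC⟩ := h k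
  exact ⟨C, fun u hu ξ hξ => hC u hu ξ (hW hξ)⟩

theorem RapidOn.union {𝒰 : Set 𝓓'(Ω, ℂ)} {f : 𝓓(Ω, ℝ)} {V W : Set (StrongDual ℝ E)}
    (h : RapidOn 𝒰 f V) (h' : RapidOn 𝒰 f W) : RapidOn 𝒰 f (V ∪ W) := fun k => by
  obtain ⟨C, hC⟩ := h k
  obtain ⟨C', hC'⟩ := h' k
  exact ⟨max C C', fun u hu ξ hξ => hξ.elim (fun hξ => (hC u hu ξ hξ).trans (le_max_left _ _))
    fun hξ => (hC' u hu ξ hξ).trans (le_max_right _ _)⟩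

theorem wave_add (f g : 𝓓(Ω, ℝ)) (ξ : StrongDual ℝ E) : wave (f + g) ξ = wave f ξ + wave g ξ := by
  ext x; simp [wave_apply, add_mul]

theorem wave_zero (ξ : StrongDual ℝ E) : wave (0 : 𝓓(Ω, ℝ)) ξ = 0 := by
  ext x; simp [wave_apply]

theorem localFourier_add (f g : 𝓓(Ω, ℝ)) (ξ : StrongDual ℝ E) (u : 𝓓'(Ω, ℂ)) :
    localFourier (f + g) ξ u = localFourier f ξ u + localFourier g ξ u := by
  simp only [localFourier_eq_pair, wave_add, pair_add_left]

theorem localFourier_zero (ξ : StrongDual ℝ E) (u : 𝓓'(Ω, ℂ)) :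
    localFourier (0 : 𝓓(Ω, ℝ)) ξ u = 0 := by
  rw [localFourier_eq_pair, wave_zero]; exact map_zero (pairLin u)

theorem RapidOn.add {𝒰 : Set 𝓓'(Ω, ℂ)} {f g : 𝓓(Ω, ℝ)} {V : Set (StrongDual ℝ E)}
    (h : RapidOn 𝒰 f V) (h' : RapidOn 𝒰 g V) : RapidOn 𝒰 (f + g) V := fun k => by
  obtain ⟨C, hC⟩ := h k
  obtain ⟨C', hC'⟩ := h' k
  refine ⟨C + C', fun u hu ξ hξ => ?_⟩
  rw [localFourier_add]
  refine le_trans ?_ (add_le_add (hC u hu ξ hξ) (hC' u hu ξ hξ))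
  rw [← mul_add]
  gcongr
  exact norm_add_le _ _

theorem rapidOn_zero (𝒰 : Set 𝓓'(Ω, ℂ)) (V : Set (StrongDual ℝ E)) :
    RapidOn 𝒰 (0 : 𝓓(Ω, ℝ)) V := fun k => ⟨0, fun u _ ξ _ => by simp [localFourier_zero]⟩

/-- The wave front set of a set of distributions: its complement consists of the directions in
which the localizations decay rapidly, uniformly on the set. -/
def WFset (𝒰 : Set 𝓓'(Ω, ℂ)) : Set (E × StrongDual ℝ E) :=
  {z | z.1 ∈ Ω ∧ z.2 ≠ 0 ∧
    ¬ ∃ O ∈ 𝓝 z.1, ∃ V ∈ 𝓝 z.2, IsClosedCovectorCone V ∧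
      ∀ φ : 𝓓(Ω, ℝ), tsupport φ ⊆ O → RapidOn 𝒰 φ V}

theorem WFset_singleton (u : 𝓓'(Ω, ℂ)) : WFset {u} = WF u := by
  simp only [WFset, WF, RapidOn, mem_singleton_iff, forall_eq]

/-- For a singleton this says that `WF` is a closed cone, by `WFset_singleton`. -/
theorem isClosedCone_WFset (𝒰 : Set 𝓓'(Ω, ℂ)) : IsClosedCone Ω (WFset 𝒰) where
  subset z hz := ⟨hz.1, hz.2.1⟩
  smul_mem := by
    rintro z ⟨h1, h2, h3⟩ t ht
    refine ⟨h1, smul_ne_zero ht.ne' h2, fun ⟨O, hO, V, hV, hVc, H⟩ =>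
      h3 ⟨O, hO, V, ?_, hVc, H⟩⟩
    have := (continuous_const_smul t).continuousAt.preimage_mem_nhds (x := z.2) hV
    refine mem_of_superset this fun ξ hξ => ?_
    have := hVc.2 _ hξ t⁻¹ (inv_pos.2 ht)
    rwa [smul_smul, inv_mul_cancel₀ ht.ne', one_smul] at this
  closed := by
    rintro z hz h1 h2
    refine ⟨h1, h2, fun ⟨O, hO, V, hV, hVc, H⟩ => ?_⟩
    obtain ⟨y, hy, hyW⟩ := mem_closure_iff_nhds.1 hz _
      (prod_mem_nhds (interior_mem_nhds.2 hO) (interior_mem_nhds.2 hV))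
    exact hyW.2.2 ⟨O, mem_interior_iff_mem_nhds.1 hy.1, V, mem_interior_iff_mem_nhds.1 hy.2, hVc, H⟩

end Families

/-! ### Closed cones of covectors -/

section Cones

variable {E : Type*} [NormedAddCommGroup E] [NormedSpace ℝ E] [FiniteDimensional ℝ E]
  {Ω : Opens E}

/-- Two closed cones such that one does not meet the opposite of the other outside the origin are
separated uniformly. -/
theorem exists_cone_separation {V W : Set (StrongDual ℝ E)} (hV : IsClosedCovectorCone V)
    (hW : IsClosedCovectorCone W) (h : ∀ ξ ∈ V, -ξ ∈ W → ξ = 0) :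
    ∃ c : ℝ, 0 < c ∧ ∀ ξ ∈ V, ∀ η ∈ W, c * (‖ξ‖ + ‖η‖) ≤ ‖ξ + η‖ := by
  let S : Set (StrongDual ℝ E × StrongDual ℝ E) := {p | p.1 ∈ V ∧ p.2 ∈ W ∧ ‖p.1‖ + ‖p.2‖ = 1}
  have hS : IsCompact S := by
    have hb : S ⊆ Metric.closedBall 0 1 := fun p hp => by
      rw [mem_closedBall_zero_iff, Prod.norm_def]
      have := hp.2.2
      exact max_le (by linarith [norm_nonneg p.2]) (by linarith [norm_nonneg p.1])
    refine (isCompact_closedBall _ _).of_isClosed_subset ?_ hb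
    refine (hV.1.preimage continuous_fst).inter ((hW.1.preimage continuous_snd).inter ?_)
    exact isClosed_eq (by fun_prop) continuous_const
  obtain ⟨c, hc, H⟩ : ∃ c : ℝ, 0 < c ∧ ∀ p ∈ S, c ≤ ‖p.1 + p.2‖ := by
    rcases S.eq_empty_or_nonempty with hE | hne
    · exact ⟨1, one_pos, fun p hp => by simp [hE] at hp⟩
    · obtain ⟨p, hp, hmin⟩ := hS.exists_isMinOn hne
        (f := fun p => ‖p.1 + p.2‖) (by fun_prop)
      refine ⟨‖p.1 + p.2‖, norm_pos_iff.2 fun h0 => ?_, fun q hq => hmin hq⟩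
      have h1 : -p.1 = p.2 := by rw [eq_comm, ← add_eq_zero_iff_eq_neg, add_comm]; exact h0
      have h2 := h p.1 hp.1 (h1 ▸ hp.2.1)
      have h3 := hp.2.2
      rw [← h1, h2] at h3
      simp at h3
  refine ⟨c, hc, fun ξ hξ η hη => ?_⟩
  rcases eq_or_ne (‖ξ‖ + ‖η‖) 0 with h0 | h0
  · rw [h0, mul_zero]; exact norm_nonneg _
  · set r := ‖ξ‖ + ‖η‖ with hr
    have hrp : 0 < r := lt_of_le_of_ne (by positivity) h0.symm
    have h1 := H (r⁻¹ • ξ, r⁻¹ • η) ⟨hV.2 ξ hξ _ (inv_pos.2 hrp), hW.2 η hη _ (inv_pos.2 hrp), by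
      simp only [norm_smul, Real.norm_of_nonneg (inv_pos.2 hrp).le]
      rw [← mul_add, ← hr, inv_mul_cancel₀ h0]⟩
    rw [← smul_add, norm_smul, Real.norm_of_nonneg (inv_pos.2 hrp).le, inv_mul_eq_div,
      le_div_iff₀ hrp] at h1
    exact h1

/-- The closed conic neighborhoods of a covector: the condition compares the directions of `ξ` and
`ξ₀`, multiplied by both norms so that it is homogeneous and makes sense at the origin. -/
def coneNhd (ξ₀ : StrongDual ℝ E) (δ : ℝ) : Set (StrongDual ℝ E) :=
  {ξ | ‖‖ξ₀‖ • ξ - ‖ξ‖ • ξ₀‖ ≤ δ * ‖ξ‖}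

theorem isClosedCovectorCone_coneNhd (ξ₀ : StrongDual ℝ E) (δ : ℝ) :
    IsClosedCovectorCone (coneNhd ξ₀ δ) := by
  refine ⟨isClosed_le (by fun_prop) (by fun_prop), fun ξ hξ t ht => ?_⟩
  have h1 : ‖ξ₀‖ • t • ξ - ‖t • ξ‖ • ξ₀ = t • (‖ξ₀‖ • ξ - ‖ξ‖ • ξ₀) := by
    rw [norm_smul, Real.norm_of_nonneg ht.le, smul_sub, smul_smul, smul_smul, smul_smul,
      mul_comm ‖ξ₀‖ t]
  change ‖_‖ ≤ δ * ‖t • ξ‖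
  rw [h1, norm_smul, norm_smul, Real.norm_of_nonneg ht.le, mul_left_comm]
  exact mul_le_mul_of_nonneg_left hξ ht.le

theorem coneNhd_mem_nhds {ξ₀ : StrongDual ℝ E} (h0 : ξ₀ ≠ 0) {δ : ℝ} (hδ : 0 < δ) :
    coneNhd ξ₀ δ ∈ 𝓝 ξ₀ := by
  have : ∀ᶠ ξ in 𝓝 ξ₀, ‖‖ξ₀‖ • ξ - ‖ξ‖ • ξ₀‖ < δ * ‖ξ‖ := by
    refine ContinuousAt.eventually_lt (by fun_prop) (by fun_prop) ?_
    rw [sub_self, norm_zero]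
    have := norm_pos_iff.2 h0
    positivity
  exact this.mono fun ξ hξ => hξ.le

theorem coneNhd_mono {ξ₀ : StrongDual ℝ E} {δ δ' : ℝ} (h : δ ≤ δ') :
    coneNhd ξ₀ δ ⊆ coneNhd ξ₀ δ' := fun ξ hξ =>
  le_trans hξ (mul_le_mul_of_nonneg_right h (norm_nonneg ξ))

/-- The sets `coneNhd ξ₀ δ` without the origin form a basis of the conic neighborhoods of `ξ₀`. -/
theorem exists_coneNhd_subset {ξ₀ : StrongDual ℝ E} (h0 : ξ₀ ≠ 0) {O : Set (StrongDual ℝ E)}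
    (hO : O ∈ 𝓝 ξ₀) (hc : ∀ ξ ∈ O, ∀ t : ℝ, 0 < t → t • ξ ∈ O) :
    ∃ δ : ℝ, 0 < δ ∧ ∀ ξ ∈ coneNhd ξ₀ δ, ξ ≠ 0 → ξ ∈ O := by
  obtain ⟨r, hr, hrO⟩ := Metric.mem_nhds_iff.1 hO
  refine ⟨r / 2, by positivity, fun ξ hξ hξ0 => ?_⟩
  have hξp := norm_pos_iff.2 hξ0
  have h0p := norm_pos_iff.2 h0
  have h1 : (‖ξ₀‖ / ‖ξ‖) • ξ ∈ O := by
    apply hrO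
    rw [mem_ball_iff_norm]
    have h2 : (‖ξ₀‖ / ‖ξ‖) • ξ - ξ₀ = ‖ξ‖⁻¹ • (‖ξ₀‖ • ξ - ‖ξ‖ • ξ₀) := by
      rw [smul_sub, smul_smul, smul_smul, inv_mul_cancel₀ hξp.ne', one_smul, inv_mul_eq_div]
    rw [h2, norm_smul, norm_inv, norm_norm, inv_mul_lt_iff₀ hξp]
    have h3 : ‖‖ξ₀‖ • ξ - ‖ξ‖ • ξ₀‖ ≤ r / 2 * ‖ξ‖ := hξ
    nlinarith
  have h2 := hc _ h1 (‖ξ‖ / ‖ξ₀‖) (by positivity)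
  rwa [smul_smul, div_mul_div_cancel₀ h0p.ne', div_self hξp.ne', one_smul] at h2

/-- A closed cone which does not meet `{x} × V` does not meet `O × V` for a neighborhood `O`
of `x`. -/
theorem exists_tube {Γ : Set (E × StrongDual ℝ E)} (hΓ : IsClosedCone Ω Γ) {x : E} (hx : x ∈ Ω)
    {V : Set (StrongDual ℝ E)} (hV : IsClosedCovectorCone V) (h : ∀ ξ ∈ V, (x, ξ) ∉ Γ) :
    ∃ O ∈ 𝓝 x, Disjoint (O ×ˢ V) Γ := by
  have hc : IsCompact (V ∩ Metric.sphere 0 1) := (isCompact_sphere _ _).inter_left hV.1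
  have hsub : ({x} : Set E) ×ˢ (V ∩ Metric.sphere 0 1) ⊆ (closure Γ)ᶜ := by
    rintro ⟨y, ξ⟩ ⟨hy, hξ, hξ1⟩ hcl
    rw [mem_singleton_iff] at hy
    subst hy
    refine h ξ hξ (hΓ.closed _ hcl hx fun h0 => ?_)
    simp only at h0
    simp [h0] at hξ1
  obtain ⟨O, W, hO, -, hxO, hW, hOW⟩ := generalized_tube_lemma isCompact_singleton hc
    isClosed_closure.isOpen_compl hsub
  refine ⟨O, hO.mem_nhds (hxO rfl), disjoint_left.2 ?_⟩
  rintro ⟨y, ξ⟩ ⟨hy, hξ⟩ hΓ'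
  have h0 := (hΓ.subset _ hΓ').2
  simp only at h0 hy hξ
  have hp := inv_pos.2 (norm_pos_iff.2 h0)
  refine hOW (mk_mem_prod hy (hW ⟨hV.2 ξ hξ _ hp, ?_⟩))
    (subset_closure (hΓ.smul_mem _ hΓ' _ hp))
  rw [mem_sphere_zero_iff_norm, norm_smul, norm_inv, norm_norm, inv_mul_cancel₀ (inv_pos.1 hp).ne']

end Cones

/-! ### Uniform decay of bounded families -/

section Boundedness

variable {E : Type*} [NormedAddCommGroup E] [NormedSpace ℝ E] {Ω : Opens E}
  [MeasureSpace E] [FiniteDimensional ℝ E] [BorelSpace E] [(volume : Measure E).IsAddHaarMeasure]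

theorem tsupport_const_smul_subset (c : ℂ) (φ : 𝓓(Ω, ℂ)) :
    tsupport (c • φ : 𝓓(Ω, ℂ)) ⊆ tsupport φ := tsupport_smul_subset_right (fun _ : E => c) φ

theorem fourierBounded_singleton (φ : 𝓓(Ω, ℂ)) : FourierBounded {φ} := fun M => by
  obtain ⟨A, -, hA⟩ := ft_rapid_decay φ.contDiff φ.hasCompactSupport M
  exact ⟨A, fun ψ hψ => by rw [hψ]; exact hA⟩

/-- Multiples of modulations of the elements of a bounded set, with rapidly decreasing
coefficients, form a bounded set. -/
theorem isVonNBounded_smul_modulate {ι : Type*} (φ : ι → 𝓓(Ω, ℂ)) (ξ : ι → StrongDual ℝ E)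
    (c : ι → ℂ) {K : Set E} (hK : IsCompact K) (hKΩ : K ⊆ Ω) (hs : ∀ i, tsupport (φ i) ⊆ K)
    (hφ : FourierBounded (range φ)) (hc : ∀ M : ℕ, ∃ A : ℝ, ∀ i, ‖c i‖ * (1 + ‖ξ i‖) ^ M ≤ A) :
    Bornology.IsVonNBounded ℝ (range fun i => c i • modulate (φ i) (ξ i)) := by
  refine isVonNBounded_of_fourierBounded hK hKΩ ?_ fun M => ?_
  · rintro _ ⟨i, rfl⟩
    exact (tsupport_smul_subset_right (fun _ : E => c i) (modulate (φ i) (ξ i))).trans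
      ((tsupport_modulate_subset _ _).trans (hs i))
  · obtain ⟨A, hA⟩ := hφ M
    obtain ⟨A', hA'⟩ := hc M
    refine ⟨A' * A, ?_⟩
    rintro _ ⟨i, rfl⟩ η
    rw [ft_smul, ft_modulate, norm_mul]
    have h1 := peetre η (ξ i) M
    rw [add_comm η (ξ i)] at h1
    have h2 : 0 ≤ A' := le_trans (by positivity) (hA' i)
    calc _ ≤ (1 + ‖ξ i + η‖) ^ M * (1 + ‖ξ i‖) ^ M * (‖c i‖ * ‖ft (φ i) (ξ i + η)‖) := by gcongr
      _ = (‖c i‖ * (1 + ‖ξ i‖) ^ M) * ((1 + ‖ξ i + η‖) ^ M * ‖ft (φ i) (ξ i + η)‖) := by ring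
      _ ≤ A' * A := by
        gcongr
        · exact hA' i
        · exact hA _ ⟨i, rfl⟩ _

/-- To bound a function of polynomial growth uniformly, it is enough to bound its products with
the terms of all rapidly decreasing sequences. -/
theorem exists_growth {X : Type*} (F : X → StrongDual ℝ E → ℝ)
    (h : ∀ (x : ℕ → X) (ξ : ℕ → StrongDual ℝ E) (c : ℕ → ℝ), (∀ n, 0 ≤ c n) →
      (∀ M : ℕ, ∃ A : ℝ, ∀ n, c n * (1 + ‖ξ n‖) ^ M ≤ A) → ∃ C : ℝ, ∀ n, c n * F (x n) (ξ n) ≤ C) :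
    ∃ (M : ℕ) (C : ℝ), 0 ≤ C ∧ ∀ x ξ, F x ξ ≤ C * (1 + ‖ξ‖) ^ M := by
  by_contra! hcon
  have : ∀ n : ℕ, ∃ x ξ, (n : ℝ) * (1 + ‖ξ‖) ^ n < F x ξ := fun n => hcon n n (by positivity)
  choose x ξ hx using this
  obtain ⟨C, hC⟩ := h x ξ (fun n => ((1 + ‖ξ n‖) ^ n)⁻¹) (fun n => by positivity) fun M => by
    obtain ⟨A, hA⟩ := ((Set.finite_lt_nat M).image
      (fun n => ((1 + ‖ξ n‖) ^ n)⁻¹ * (1 + ‖ξ n‖) ^ M)).bddAbove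
    refine ⟨max A 1, fun n => ?_⟩
    rcases lt_or_ge n M with hn | hn
    · exact (hA (mem_image_of_mem _ hn)).trans (le_max_left _ _)
    · refine le_trans ?_ (le_max_right _ _)
      rw [inv_mul_le_iff₀ (by positivity), mul_one]
      exact pow_le_pow_right₀ (by linarith [norm_nonneg (ξ n)]) hn
  obtain ⟨n, hn⟩ := exists_nat_gt C
  have h1 := hC n
  have h2 : (n : ℝ) < ((1 + ‖ξ n‖) ^ n)⁻¹ * F (x n) (ξ n) := by
    rw [lt_inv_mul_iff₀ (by positivity), mul_comm]; exact hx n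
  linarith

/-- The localized Fourier transforms of a strongly bounded set have a common polynomial bound: by
`exists_growth` it is enough that waves with rapidly decreasing coefficients are bounded. -/
theorem StronglyBounded.growth {𝒰 : Set 𝓓'(Ω, ℂ)} (h : StronglyBounded 𝒰) (f : 𝓓(Ω, ℝ)) :
    ∃ (M : ℕ) (C : ℝ), 0 ≤ C ∧ ∀ u ∈ 𝒰, ∀ ξ, ‖localFourier f ξ u‖ ≤ C * (1 + ‖ξ‖) ^ M := by
  obtain ⟨M, C, hC, H⟩ := exists_growth (X := 𝒰) (fun u ξ => ‖localFourier f ξ u.1‖)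
    fun u ξ c hc0 hc => by
      obtain ⟨C, hC⟩ := h _ (isVonNBounded_smul_modulate (fun _ : ℕ => complexify f) ξ
        (fun n => (c n : ℂ)) f.hasCompactSupport.isCompact f.tsupport_subset
        (fun _ => tsupport_complexify_subset f)
        (by rw [range_const]; exact fourierBounded_singleton _)
        fun M => by
          obtain ⟨A, hA⟩ := hc M
          exact ⟨A, fun n => by rw [Complex.norm_of_nonneg (hc0 n)]; exact hA n⟩)
      refine ⟨C, fun n => ?_⟩
      have := hC (u n).1 (u n).2 _ ⟨n, rfl⟩
      rw [pair_smul_left, norm_mul, Complex.norm_of_nonneg (hc0 n)] at this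
      exact this
  exact ⟨M, C, hC, fun u hu ξ => H ⟨u, hu⟩ ξ⟩

theorem StronglyBounded.rapidOn_zero {𝒰 : Set 𝓓'(Ω, ℂ)} (h : StronglyBounded 𝒰) (f : 𝓓(Ω, ℝ)) :
    RapidOn 𝒰 f {0} := fun k => by
  obtain ⟨M, C, -, hC⟩ := h.growth f
  refine ⟨C, fun u hu ξ hξ => ?_⟩
  rw [mem_singleton_iff] at hξ
  have := hC u hu ξ
  simpa [hξ] using this

/-- Local rapid decay in all directions of a closed cone implies rapid decay on the cone. -/
theorem rapidOn_of_forall_ray {𝒰 : Set 𝓓'(Ω, ℂ)} (h : StronglyBounded 𝒰) {f : 𝓓(Ω, ℝ)}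
    {V : Set (StrongDual ℝ E)} (hV : IsClosedCovectorCone V)
    (H : ∀ x ∈ tsupport f, ∀ ξ ∈ V, ξ ≠ 0 → (x, ξ) ∉ WFset 𝒰) : RapidOn 𝒰 f V := by
  refine local_induction (P := fun f => RapidOn 𝒰 f V) (rapidOn_zero _ _)
    (fun f g hf hg => hf.add hg) f fun x hx => ?_
  have hc : IsCompact (V ∩ Metric.sphere 0 1) := (isCompact_sphere _ _).inter_left hV.1
  -- Rapid decay near a ray is preserved under finite unions, and the unit directions of `V` form a
  -- compact set.
  obtain ⟨O, hO, HO⟩ := hc.induction_on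
    (p := fun s => ∃ O ∈ 𝓝 x, ∀ g : 𝓓(Ω, ℝ), tsupport g ⊆ O →
      RapidOn 𝒰 g {ξ | ∃ t : ℝ, 0 < t ∧ t • ξ ∈ s})
    ⟨univ, univ_mem, fun g _ k => ⟨0, fun u _ ξ hξ => by simp at hξ⟩⟩
    (fun s t hst ⟨O, hO, HO⟩ => ⟨O, hO, fun g hg => (HO g hg).mono
      fun ξ ⟨r, hr, hξ⟩ => ⟨r, hr, hst hξ⟩⟩)
    (fun s t ⟨O, hO, HO⟩ ⟨O', hO', HO'⟩ => ⟨O ∩ O', inter_mem hO hO', fun g hg =>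
      ((HO g (hg.trans inter_subset_left)).union (HO' g (hg.trans inter_subset_right))).mono
        fun ξ ⟨r, hr, hξ⟩ => hξ.elim (fun h => Or.inl ⟨r, hr, h⟩) fun h => Or.inr ⟨r, hr, h⟩⟩)
    (fun ζ hζ => by
      have hζ0 : ζ ≠ 0 := fun h0 => by simp [h0] at hζ
      have h1 := H x hx ζ hζ.1 hζ0
      simp only [WFset, mem_ofPred_eq, not_and, not_not] at h1
      obtain ⟨O, hO, W, hW, hWc, HW⟩ := h1 (f.tsupport_subset hx) hζ0
      refine ⟨W, mem_nhdsWithin_of_mem_nhds hW, O, hO, fun g hg => (HW g hg).mono ?_⟩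
      rintro ξ ⟨r, hr, hξ⟩
      have := hWc.2 _ hξ r⁻¹ (inv_pos.2 hr)
      rwa [smul_smul, inv_mul_cancel₀ hr.ne', one_smul] at this)
  refine ⟨O, hO, fun g hg _ => ((HO g hg).union (h.rapidOn_zero g)).mono fun ξ hξ => ?_⟩
  rcases eq_or_ne ξ 0 with h0 | h0
  · exact Or.inr h0
  · have hp := norm_pos_iff.2 h0
    refine Or.inl ⟨‖ξ‖⁻¹, inv_pos.2 hp, hV.2 ξ hξ _ (inv_pos.2 hp), ?_⟩
    rw [mem_sphere_zero_iff_norm, norm_smul, norm_inv, norm_norm, inv_mul_cancel₀ hp.ne']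

/-- A strongly bounded set is bounded for the normal topology attached to its own wave front set.
This reduces normal boundedness to the location of `WFset`. -/
theorem StronglyBounded.normallyBounded {𝒰 : Set 𝓓'(Ω, ℂ)} (h : StronglyBounded 𝒰) :
    NormallyBounded (WFset 𝒰) 𝒰 :=
  ⟨h, fun _ _ hV hd => rapidOn_of_forall_ray h hV fun _ hx _ hξ _ hW =>
    disjoint_left.1 hd (mk_mem_prod hx hξ) hW⟩

theorem stronglyBounded_singleton (u : 𝓓'(Ω, ℂ)) : StronglyBounded {u} := fun B hB => by
  obtain ⟨C, hC⟩ := ((NormedSpace.isVonNBounded_iff ℝ).1 (hB.image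
    (⟨(pairLin u).restrictScalars ℝ, continuous_pair u⟩ : 𝓓(Ω, ℂ) →L[ℝ] ℂ))).exists_norm_le
  refine ⟨C, fun v hv φ hφ => ?_⟩
  rw [mem_singleton_iff.1 hv]
  exact hC _ (mem_image_of_mem _ hφ)

theorem normallyBounded_singleton (u : 𝓓'(Ω, ℂ)) : NormallyBounded (WF u) {u} :=
  WFset_singleton u ▸ (stronglyBounded_singleton u).normallyBounded

end Boundedness

/-! ### Bounded sets of test functions in spaces of distributions -/

section DualBounded

variable {E : Type*} [NormedAddCommGroup E] [NormedSpace ℝ E] {Ω : Opens E}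
  [MeasureSpace E] [FiniteDimensional ℝ E] [BorelSpace E] [(volume : Measure E).IsAddHaarMeasure]

/-- A common polynomial bound for the Fourier transforms of a set of test functions, supported in
a common compact set, which is bounded in the space of distributions. -/
theorem exists_ft_growth {K : Set E} (hK : IsCompact K) (hKΩ : K ⊆ Ω) {B : Set 𝓓(Ω, ℂ)}
    (hs : ∀ φ ∈ B, tsupport φ ⊆ K) (hB : StronglyBounded (toDistribution '' B)) :
    ∃ (M : ℕ) (C : ℝ), 0 ≤ C ∧ ∀ φ ∈ B, ∀ ξ, ‖ft φ ξ‖ ≤ C * (1 + ‖ξ‖) ^ M := by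
  obtain ⟨f, hf, -⟩ := exists_cutoff hK Ω.isOpen hKΩ subset_rfl
  obtain ⟨M, C, hC, H⟩ := hB.growth f
  refine ⟨M, C, hC, fun φ hφ ξ => ?_⟩
  have h1 := H _ (mem_image_of_mem _ hφ) ξ
  rw [localFourier_toDistribution] at h1
  rwa [cut_eq_self hf (hs φ hφ)] at h1

/-- Multiplication by a test function preserves bounds on Fourier transforms. -/
theorem exists_ft_cut_bound (f : 𝓓(Ω, ℝ)) (n : ℕ) : ∃ C : ℝ, 0 ≤ C ∧ ∀ (φ : 𝓓(Ω, ℂ)) (A : ℝ),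
    ((∀ ξ, (1 + ‖ξ‖) ^ n * ‖ft φ ξ‖ ≤ A) → ∀ ξ, (1 + ‖ξ‖) ^ n * ‖ft (cut f φ) ξ‖ ≤ C * A) ∧
    ((∀ ξ, ‖ft φ ξ‖ ≤ A * (1 + ‖ξ‖) ^ n) →
      ∀ ξ, ‖ft (cut f φ) ξ‖ ≤ C * A * (1 + ‖ξ‖) ^ n) := by
  obtain ⟨C, hC, H⟩ := exists_ft_mul_bound E n
  obtain ⟨B, hB0, hB⟩ := ft_rapid_decay (complexify f).contDiff (complexify f).hasCompactSupport
    (n + decayExp E)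
  exact ⟨C * B, by positivity, fun φ A => H (complexify f) φ (complexify f).contDiff
    (complexify f).hasCompactSupport φ.contDiff φ.hasCompactSupport B A hB⟩

theorem FourierBounded.mono {B B' : Set 𝓓(Ω, ℂ)} (h : FourierBounded B) (hB : B' ⊆ B) :
    FourierBounded B' := fun M => by
  obtain ⟨A, hA⟩ := h M
  exact ⟨A, fun φ hφ => hA φ (hB hφ)⟩

theorem FourierBounded.cut {B : Set 𝓓(Ω, ℂ)} (hB : FourierBounded B) (f : 𝓓(Ω, ℝ)) :
    FourierBounded (cut f '' B) := fun M => by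
  obtain ⟨A, hA⟩ := hB M
  obtain ⟨C, hC, H⟩ := exists_ft_cut_bound f M
  refine ⟨C * A, ?_⟩
  rintro _ ⟨φ, hφ, rfl⟩
  exact (H φ A).1 (hA φ hφ)

/-- A sufficient condition for the boundedness of a family of modulated test functions whose
amplitudes grow polynomially in the frequency. -/
theorem normallyBounded_modulate {ι : Type*} {Γ : Set (E × StrongDual ℝ E)} (φ : ι → 𝓓(Ω, ℂ))
    (ξ : ι → StrongDual ℝ E) (N : ℕ) (hφ : FourierBounded (range φ))
    (h : ∀ (f : 𝓓(Ω, ℝ)) (V : Set (StrongDual ℝ E)), IsClosedCovectorCone V →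
      Disjoint (tsupport f ×ˢ V) Γ → ∃ c : ℝ, 0 < c ∧
      {i | ¬ (cut f (φ i) = 0 ∨ ∀ η ∈ V, c * (‖ξ i‖ + ‖η‖) ≤ ‖ξ i + η‖)}.Finite) :
    NormallyBounded Γ (toDistribution ''
      range fun i => (((1 + ‖ξ i‖) ^ N : ℝ) : ℂ) • modulate (φ i) (ξ i)) := by
  have hn : ∀ i, ‖(((1 + ‖ξ i‖) ^ N : ℝ) : ℂ)‖ = (1 + ‖ξ i‖) ^ N := fun i =>
    Complex.norm_of_nonneg (by positivity)
  constructor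
  · intro B hB
    obtain ⟨A', hA'⟩ := fourierBounded_of_isVonNBounded hB (N + decayExp E)
    obtain ⟨A, hA⟩ := hφ N
    obtain ⟨C, hC, H⟩ := exists_ft_mul_bound E N
    refine ⟨C * A' * A, ?_⟩
    rintro _ ⟨_, ⟨i, rfl⟩, rfl⟩ θ hθ
    have h1 : pair θ (toDistribution ((((1 + ‖ξ i‖) ^ N : ℝ) : ℂ) • modulate (φ i) (ξ i))) =
        (((1 + ‖ξ i‖) ^ N : ℝ) : ℂ) * ft (fun x => θ x * φ i x) (ξ i) := by
      rw [pair_toDistribution, ft, ← integral_const_mul]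
      refine integral_congr_ae (.of_forall fun x => ?_)
      change θ x * (_ * (φ i x * character (ξ i) x)) = _
      ring
    rw [h1, norm_mul, hn]
    exact (H θ (φ i) θ.contDiff θ.hasCompactSupport (φ i).contDiff (φ i).hasCompactSupport
      A' A (hA' θ hθ)).1 (hA _ ⟨i, rfl⟩) (ξ i)
  · intro f V hV hd k
    obtain ⟨c, hc, hfin⟩ := h f V hV hd
    obtain ⟨A, hA⟩ := hφ.cut f k
    obtain ⟨A₂, hA₂⟩ := hφ.cut f (k + N)
    obtain ⟨D, hD⟩ := (hfin.image fun i => (1 + ‖ξ i‖) ^ N * ((1 + ‖ξ i‖) ^ k * A)).bddAbove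
    refine ⟨max (max D 0) ((1 + c⁻¹) ^ (k + N) * A₂), ?_⟩
    rintro _ ⟨_, ⟨i, rfl⟩, rfl⟩ η hη
    have h1 : cut f ((((1 + ‖ξ i‖) ^ N : ℝ) : ℂ) • modulate (φ i) (ξ i)) =
        (((1 + ‖ξ i‖) ^ N : ℝ) : ℂ) • modulate (cut f (φ i)) (ξ i) := by
      ext x
      change (f x : ℂ) * (_ * (φ i x * _)) = _ * ((f x : ℂ) * φ i x * _)
      ring
    rw [localFourier_toDistribution, h1, ft_smul, ft_modulate, norm_mul, hn]
    -- Away from a finite set of indices `‖ξ i + η‖` controls both frequencies, so that the decay of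
    -- `ft (φ i)` compensates the amplitude. A finite set of indices is harmless.
    by_cases hi : cut f (φ i) = 0 ∨ ∀ η ∈ V, c * (‖ξ i‖ + ‖η‖) ≤ ‖ξ i + η‖
    · rcases hi with hi | hi
      · have h2 : ft (cut f (φ i)) (ξ i + η) = 0 := by
          rw [hi, ft]; simp
        rw [h2]
        simp
      · refine le_trans ?_ (le_max_right _ _)
        have h3 := hi η hη
        have h4 : ‖ξ i‖ + ‖η‖ ≤ c⁻¹ * ‖ξ i + η‖ := by
          rwa [← div_eq_inv_mul, le_div_iff₀ hc, mul_comm]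
        have hc' := inv_pos.2 hc
        have h5 : 1 + ‖η‖ ≤ (1 + c⁻¹) * (1 + ‖ξ i + η‖) := by
          nlinarith [norm_nonneg (ξ i), norm_nonneg (ξ i + η)]
        have h6 : 1 + ‖ξ i‖ ≤ (1 + c⁻¹) * (1 + ‖ξ i + η‖) := by
          nlinarith [norm_nonneg η, norm_nonneg (ξ i + η)]
        calc _ ≤ ((1 + c⁻¹) * (1 + ‖ξ i + η‖)) ^ k * (((1 + c⁻¹) * (1 + ‖ξ i + η‖)) ^ N *
              ‖ft (cut f (φ i)) (ξ i + η)‖) := by gcongr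
          _ = (1 + c⁻¹) ^ (k + N) *
              ((1 + ‖ξ i + η‖) ^ (k + N) * ‖ft (cut f (φ i)) (ξ i + η)‖) := by
            rw [mul_pow, mul_pow, pow_add, pow_add]; ring
          _ ≤ _ := by
            gcongr
            exact hA₂ _ (mem_image_of_mem _ ⟨i, rfl⟩) _
    · refine le_trans ?_ ((hD (mem_image_of_mem _ hi)).trans
        ((le_max_left _ _).trans (le_max_left _ _)))
      have h3 := peetre η (ξ i) k
      rw [add_comm η (ξ i)] at h3
      calc _ ≤ (1 + ‖ξ i + η‖) ^ k * (1 + ‖ξ i‖) ^ k *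
            ((1 + ‖ξ i‖) ^ N * ‖ft (cut f (φ i)) (ξ i + η)‖) := by gcongr
        _ = (1 + ‖ξ i‖) ^ N * ((1 + ‖ξ i‖) ^ k *
            ((1 + ‖ξ i + η‖) ^ k * ‖ft (cut f (φ i)) (ξ i + η)‖)) := by ring
        _ ≤ _ := by
          gcongr
          exact hA _ (mem_image_of_mem _ ⟨i, rfl⟩) _

theorem isDualBounded_of_normallyBounded {γ Γ : Set (E × StrongDual ℝ E)} {B : Set 𝓓(Ω, ℂ)}
    {K : Set E} (hK : IsCompact K) (hKΩ : K ⊆ Ω) (hs : ∀ φ ∈ B, tsupport φ ⊆ K)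
    (hΓ : IsClosedCone Ω Γ) (hγ : ∀ z ∈ Γ, (z.1, -z.2) ∉ γ)
    (hB : NormallyBounded Γ (toDistribution '' B)) : IsDualBounded Ω γ B := by
  refine ⟨⟨K, hK, hKΩ, hs⟩, Γ, hΓ, hγ, fun p hp => ?_⟩
  have := (normallyBounded_iff Γ _).1 hB p hp
  rwa [iSup_image] at this

theorem IsDualBounded.normallyBounded {γ : Set (E × StrongDual ℝ E)} {B : Set 𝓓(Ω, ℂ)}
    (h : IsDualBounded Ω γ B) : (∃ K : Set E, IsCompact K ∧ K ⊆ Ω ∧ ∀ φ ∈ B, tsupport φ ⊆ K) ∧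
    ∃ Γ : Set (E × StrongDual ℝ E), IsClosedCone Ω Γ ∧ (∀ z ∈ Γ, (z.1, -z.2) ∉ γ) ∧
      NormallyBounded Γ (toDistribution '' B) := by
  obtain ⟨hK, Γ, hΓ, hγ, H⟩ := h
  refine ⟨hK, Γ, hΓ, hγ, (normallyBounded_iff Γ _).2 fun p hp => ?_⟩
  rw [iSup_image]
  exact H p hp

theorem isClosedCone_empty : IsClosedCone Ω (∅ : Set (E × StrongDual ℝ E)) where
  subset z hz := by simp at hz
  smul_mem z hz := by simp at hz
  closed z hz := by simp at hz

/-- Bounded sets of test functions belong to the topology `I_ppp` for all cones. -/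
theorem isDualBounded_of_fourierBounded (γ : Set (E × StrongDual ℝ E)) {B : Set 𝓓(Ω, ℂ)}
    {K : Set E} (hK : IsCompact K) (hKΩ : K ⊆ Ω) (hs : ∀ φ ∈ B, tsupport φ ⊆ K)
    (hB : FourierBounded B) : IsDualBounded Ω γ B := by
  refine isDualBounded_of_normallyBounded hK hKΩ hs isClosedCone_empty (by simp) ?_
  have h := normallyBounded_modulate (Γ := ∅) (fun φ : B => φ.1) (fun _ => 0) 0
    (by rwa [Subtype.range_coe]) fun f V _ _ => ⟨1, one_pos, by simp⟩
  have h2 : (range fun φ : B => (((1 + ‖(0 : StrongDual ℝ E)‖) ^ 0 : ℝ) : ℂ) •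
      modulate φ.1 0) = B := by
    have : ∀ φ : 𝓓(Ω, ℂ), (((1 + ‖(0 : StrongDual ℝ E)‖) ^ 0 : ℝ) : ℂ) • modulate φ 0 = φ := by
      intro φ
      ext x
      change (((1 + ‖(0 : StrongDual ℝ E)‖) ^ 0 : ℝ) : ℂ) * (φ x * character 0 x) = φ x
      simp [character]
    simp_rw [this]
    exact Subtype.range_coe
  rwa [h2] at h

end DualBounded

/-! ### Pairing with dual bounded sets -/

section Finiteness

variable {E : Type*} [NormedAddCommGroup E] [NormedSpace ℝ E] {Ω : Opens E}
  [FiniteDimensional ℝ E]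

theorem lintegral_sobolev_lt_top {n : ℕ} {h : StrongDual ℝ E → ℂ} {V : Set (StrongDual ℝ E)}
    (H : MemLp (fun ξ => (1 + ‖ξ‖ ^ 2) ^ ((n : ℝ) / 2) • h ξ) 2 ((dualHaar E).restrict V)) :
    ∫⁻ ξ in V, ENNReal.ofReal ((1 + ‖ξ‖ ^ 2) ^ n * ‖h ξ‖ ^ 2) ∂dualHaar E < ⊤ := by
  have h1 := (eLpNorm_lt_top_iff_lintegral_rpow_enorm_lt_top (by norm_num) (by norm_num)).1
    H.eLpNorm_lt_top
  refine lt_of_le_of_lt (lintegral_mono fun ξ => le_of_eq ?_) h1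
  simp only [ENNReal.toReal_ofNat]
  rw [← ofReal_norm, ENNReal.ofReal_rpow_of_nonneg (norm_nonneg _) (by norm_num)]
  congr 1
  rw [norm_smul, Real.norm_of_nonneg (by positivity), Real.rpow_ofNat, mul_pow,
    ← Real.rpow_natCast (_ ^ _) 2, ← Real.rpow_mul (by positivity)]
  norm_num

theorem smul_mem_interior_of_cone {V : Set (StrongDual ℝ E)}
    (hV : ∀ ξ ∈ V, ∀ t : ℝ, 0 < t → t • ξ ∈ V) {ξ : StrongDual ℝ E} (hξ : ξ ∈ interior V)
    {t : ℝ} (ht : 0 < t) : t • ξ ∈ interior V := by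
  rw [mem_interior_iff_mem_nhds] at hξ ⊢
  have h1 : V ∈ 𝓝 (t⁻¹ • t • ξ) := by rwa [smul_smul, inv_mul_cancel₀ ht.ne', one_smul]
  refine mem_of_superset ((continuous_const_smul t⁻¹).continuousAt.preimage_mem_nhds h1)
    fun η hη => ?_
  have := hV _ hη t ht
  rwa [smul_smul, mul_inv_cancel₀ ht.ne', one_smul] at this

theorem isCompact_fiber_sphere {Γ : Set (E × StrongDual ℝ E)} (hΓ : IsClosedCone Ω Γ) {x : E}
    (hx : x ∈ Ω) : IsCompact {ζ : StrongDual ℝ E | (x, ζ) ∈ Γ ∧ ‖ζ‖ = 1} := by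
  refine (isCompact_sphere (0 : StrongDual ℝ E) 1).of_isClosed_subset ?_
    fun ζ hζ => mem_sphere_zero_iff_norm.2 hζ.2
  have h1 : {ζ : StrongDual ℝ E | (x, ζ) ∈ Γ ∧ ‖ζ‖ = 1} =
      (Prod.mk x) ⁻¹' closure Γ ∩ {ζ | ‖ζ‖ = 1} := by
    ext ζ
    refine ⟨fun h => ⟨subset_closure h.1, h.2⟩, fun h => ⟨hΓ.closed _ h.1 hx fun h0 => ?_, h.2⟩⟩
    have h2 : ‖ζ‖ = 1 := h.2
    simp only at h0
    simp [h0] at h2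
  rw [h1]
  exact (isClosed_closure.preimage (Continuous.prodMk_right x)).inter
    (isClosed_eq continuous_norm continuous_const)

/-- Square integrability on a neighborhood of the opposite of a fiber of `Λ`. -/
theorem exists_sobolev_cone {Λ : Set (E × StrongDual ℝ E)} (hΛ : IsClosedCone Ω Λ)
    (v : 𝓓'(Ω, ℂ)) (hv : ∀ z ∈ Λ, (z.1, -z.2) ∉ DWF v) (n : ℕ) {x : E} (hx : x ∈ Ω) :
    ∃ O ∈ 𝓝 x, ∃ V : Set (StrongDual ℝ E), IsClosedCovectorCone V ∧
      (∀ ζ, (x, ζ) ∈ Λ → -ζ ∈ interior V) ∧ ∀ g : 𝓓(Ω, ℝ), tsupport g ⊆ O →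
        ∫⁻ ξ in V, ENNReal.ofReal ((1 + ‖ξ‖ ^ 2) ^ n * ‖localFourier g ξ v‖ ^ 2) ∂dualHaar E
          < ⊤ := by
  obtain ⟨O, hO, V, hV, hVs, H⟩ := (isCompact_fiber_sphere hΛ hx).induction_on
    (p := fun s => ∃ O ∈ 𝓝 x, ∃ V : Set (StrongDual ℝ E), IsClosedCovectorCone V ∧
      (∀ ζ ∈ s, -ζ ∈ interior V) ∧ ∀ g : 𝓓(Ω, ℝ), tsupport g ⊆ O →
        ∫⁻ ξ in V, ENNReal.ofReal ((1 + ‖ξ‖ ^ 2) ^ n * ‖localFourier g ξ v‖ ^ 2) ∂dualHaar E < ⊤)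
    ⟨univ, univ_mem, ∅, ⟨isClosed_empty, by simp⟩, by simp, by simp⟩
    (fun s t hst ⟨O, hO, V, hV, hVs, H⟩ => ⟨O, hO, V, hV, fun ζ hζ => hVs ζ (hst hζ), H⟩)
    (fun s t ⟨O, hO, V, hV, hVs, H⟩ ⟨O', hO', V', hV', hVs', H'⟩ =>
      ⟨O ∩ O', inter_mem hO hO', V ∪ V', ⟨hV.1.union hV'.1, fun ξ hξ t ht =>
        hξ.imp (fun h => hV.2 ξ h t ht) fun h => hV'.2 ξ h t ht⟩,
        fun ζ hζ => hζ.elim (fun h => interior_mono subset_union_left (hVs ζ h))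
          fun h => interior_mono subset_union_right (hVs' ζ h),
        fun g hg => lt_of_le_of_lt (lintegral_union_le _ _ _) (ENNReal.add_lt_top.2
          ⟨H g (hg.trans inter_subset_left), H' g (hg.trans inter_subset_right)⟩)⟩)
    (fun ζ hζ => by
      have h1 : (x, -ζ) ∉ WFSobolev (n : ℝ) v := fun h => hv _ hζ.1 (mem_iUnion.2 ⟨_, h⟩)
      simp only [WFSobolev, mem_ofPred_eq, not_and, not_not] at h1
      obtain ⟨O, hO, V, hV, hVc, H⟩ := h1 hx (neg_ne_zero.2 (hΛ.subset _ hζ.1).2)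
      refine ⟨Neg.neg ⁻¹' interior V, mem_nhdsWithin_of_mem_nhds
        (continuous_neg.continuousAt.preimage_mem_nhds (interior_mem_nhds.2 hV)), O, hO, V, hVc,
        fun ζ hζ => hζ, fun g hg => lintegral_sobolev_lt_top (H g hg)⟩)
  refine ⟨O, hO, V, hV, fun ζ hζ => ?_, H⟩
  have hp := norm_pos_iff.2 (hΛ.subset _ hζ).2
  simp only at hp
  have h1 := hVs (‖ζ‖⁻¹ • ζ) ⟨hΛ.smul_mem _ hζ _ (inv_pos.2 hp), by
    rw [norm_smul, norm_inv, norm_norm, inv_mul_cancel₀ hp.ne']⟩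
  have h2 := smul_mem_interior_of_cone hV.2 h1 hp
  rwa [smul_neg, smul_smul, mul_inv_cancel₀ hp.ne', one_smul] at h2

variable [MeasureSpace E] [BorelSpace E] [(volume : Measure E).IsAddHaarMeasure]

/-- The pairing of a distribution `v` with the elements of a bounded set of test functions is
bounded if the dual wave front set of `v` is compatible with the cone of the bounded set. -/
theorem exists_pair_bound_of_DWF {Λ : Set (E × StrongDual ℝ E)} (hΛ : IsClosedCone Ω Λ)
    {K : Set E} (hK : IsCompact K) (hKΩ : K ⊆ Ω) {B : Set 𝓓(Ω, ℂ)}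
    (hs : ∀ φ ∈ B, tsupport φ ⊆ K) (hB : NormallyBounded Λ (toDistribution '' B))
    (v : 𝓓'(Ω, ℂ)) (hv : ∀ z ∈ Λ, (z.1, -z.2) ∉ DWF v) : ∃ C : ℝ, ∀ φ ∈ B, ‖pair φ v‖ ≤ C := by
  obtain ⟨M, A, hA, HA⟩ := exists_ft_growth hK hKΩ hs hB.1
  suffices H : ∀ f : 𝓓(Ω, ℝ), ∃ C : ℝ, ∀ φ ∈ B, ‖pair (cut f φ) v‖ ≤ C by
    obtain ⟨f, hf, -⟩ := exists_cutoff hK Ω.isOpen hKΩ subset_rfl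
    obtain ⟨C, hC⟩ := H f
    refine ⟨C, fun φ hφ => ?_⟩
    have := hC φ hφ
    rwa [cut_eq_self hf (hs φ hφ)] at this
  intro f
  refine local_induction (P := fun f => ∃ C : ℝ, ∀ φ ∈ B, ‖pair (cut f φ) v‖ ≤ C)
    ⟨0, fun φ _ => by rw [cut_zero]; exact (norm_le_zero_iff.2 (map_zero (pairLin v)))⟩
    (fun f g ⟨C, hC⟩ ⟨C', hC'⟩ => ⟨C + C', fun φ hφ => by
      rw [cut_add, pair_add_left]
      exact (norm_add_le _ _).trans (add_le_add (hC φ hφ) (hC' φ hφ))⟩) f fun x hx => ?_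
  have hxΩ : x ∈ Ω := f.tsupport_subset hx
  set d := decayExp E
  -- Near `x` the frequencies split into `V`, where `v` has Sobolev regularity of high order and
  -- `ft φ` grows polynomially, and the complement, where `ft φ` decays rapidly and `v` grows
  -- polynomially. The sign comes from Parseval's formula `pair_cut`.
  obtain ⟨O₁, hO₁, V, hV, hVΛ, HV⟩ := exists_sobolev_cone hΛ v hv (M + d) hxΩ
  have hW : IsClosedCovectorCone (Neg.neg ⁻¹' (interior V)ᶜ : Set (StrongDual ℝ E)) := by
    refine ⟨isOpen_interior.isClosed_compl.preimage continuous_neg, fun ξ hξ t ht h => hξ ?_⟩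
    have h' : t • (-ξ) ∈ interior V := by
      rw [smul_neg]; exact h
    have := smul_mem_interior_of_cone hV.2 h' (inv_pos.2 ht)
    rwa [smul_smul, inv_mul_cancel₀ ht.ne', one_smul] at this
  obtain ⟨O₂, hO₂, hd⟩ := exists_tube hΛ hxΩ hW fun ξ hξ hξΛ => hξ (hVΛ ξ hξΛ)
  refine ⟨interior (O₁ ∩ O₂), interior_mem_nhds.2 (inter_mem hO₁ hO₂), fun g hg _ => ?_⟩
  obtain ⟨χ, hχ1, hχs⟩ := exists_cutoff (Ω := Ω) g.hasCompactSupport.isCompact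
    (isOpen_interior.inter Ω.isOpen) (subset_inter hg g.tsupport_subset) inter_subset_right
  have hχO := (hχs.trans inter_subset_left).trans interior_subset
  obtain ⟨M', C', hC', HC'⟩ := exists_localFourier_growth χ v
  obtain ⟨A₁, hA₁, HA₁⟩ := exists_ft_cut_bound g M
  obtain ⟨A₂, HA₂⟩ := hB.2 g _ hW (hd.mono_left
    (prod_mono_left (hg.trans (interior_subset.trans inter_subset_right)))) (M' + d)
  have hI := HV χ (hχO.trans inter_subset_left)
  set I := ∫⁻ ξ in V, ENNReal.ofReal ((1 + ‖ξ‖ ^ 2) ^ (M + d) * ‖localFourier χ ξ v‖ ^ 2)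
    ∂dualHaar E
  set D := 2 ^ (M + d) * (A₁ * A) ^ 2 + C' * |A₂|
  have hD : 0 ≤ D := by positivity
  set J := ∫⁻ ξ, ENNReal.ofReal (D * ((1 + ‖ξ‖) ^ d)⁻¹) ∂dualHaar E
  have hJ : J < ⊤ := ((integrable_decay (E := E)).const_mul D).lintegral_lt_top
  refine ⟨(‖invConst E‖ₑ * (I + J)).toReal, fun φ hφ => ?_⟩
  rw [← cut_eq_self hχ1 ((tsupport_cut_subset g φ).trans inter_subset_left), pair_cut]
  rw [← ENNReal.ofReal_le_iff_le_toReal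
    (ENNReal.mul_lt_top enorm_lt_top (ENNReal.add_lt_top.2 ⟨hI, hJ⟩)).ne, ofReal_norm, enorm_mul]
  gcongr
  refine (enorm_integral_le_lintegral_enorm _).trans ?_
  have hmeas : Measurable fun ξ : StrongDual ℝ E => ENNReal.ofReal (D * ((1 + ‖ξ‖) ^ d)⁻¹) := by
    fun_prop
  rw [show I = ∫⁻ ξ, V.indicator (fun ξ => ENNReal.ofReal
    ((1 + ‖ξ‖ ^ 2) ^ (M + d) * ‖localFourier χ ξ v‖ ^ 2)) ξ ∂dualHaar E from
    (lintegral_indicator hV.1.measurableSet _).symm, ← lintegral_add_right _ hmeas]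
  refine lintegral_mono fun ξ => ?_
  have hp : 0 < 1 + ‖ξ‖ := by positivity
  by_cases hξ : ξ ∈ V
  · simp only [indicator_of_mem hξ]
    rw [← ofReal_norm, ← ENNReal.ofReal_add (by positivity) (by positivity), norm_mul]
    refine ENNReal.ofReal_le_ofReal ?_
    have h1 := (HA₁ φ A).2 (HA φ hφ) (-ξ)
    rw [norm_neg] at h1
    set a := ‖localFourier χ ξ v‖
    set b := ‖ft (cut g φ) (-ξ)‖
    have hw : (1 + ‖ξ‖) ^ (2 * (M + d)) ≤ 2 ^ (M + d) * (1 + ‖ξ‖ ^ 2) ^ (M + d) := by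
      rw [pow_mul, ← mul_pow]
      gcongr
      nlinarith [sq_nonneg (1 - ‖ξ‖)]
    set w := (1 + ‖ξ‖ ^ 2) ^ (M + d)
    have hw0 : 0 < w := by positivity
    -- The weighted Cauchy–Schwarz inequality, applied pointwise.
    have h2 : a * b ≤ w * a ^ 2 + b ^ 2 / w := by
      have h3 : a * b = (w * a) * (b / w) := by field_simp
      have h4 : w * a ^ 2 + b ^ 2 / w = w * (a ^ 2 + (b / w) ^ 2) := by field_simp
      rw [h4, h3]
      nlinarith [two_mul_le_add_sq a (b / w), sq_nonneg a, sq_nonneg (b / w), sq_nonneg (a - b / w)]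
    refine h2.trans (add_le_add le_rfl ?_)
    rw [div_le_iff₀ hw0]
    have hq : 0 < (1 + ‖ξ‖) ^ d := by positivity
    calc b ^ 2 ≤ (A₁ * A * (1 + ‖ξ‖) ^ M) ^ 2 := by gcongr
      _ = (A₁ * A) ^ 2 * ((1 + ‖ξ‖) ^ (2 * (M + d)) * (((1 + ‖ξ‖) ^ d)⁻¹ * ((1 + ‖ξ‖) ^ d)⁻¹)) := by
        rw [mul_pow, mul_add, pow_add]
        field_simp
        ring
      _ ≤ (A₁ * A) ^ 2 * ((2 ^ (M + d) * w) * (((1 + ‖ξ‖) ^ d)⁻¹ * 1)) := by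
        gcongr
        exact inv_le_one_of_one_le₀ (one_le_pow₀ (by linarith [norm_nonneg ξ]))
      _ = 2 ^ (M + d) * (A₁ * A) ^ 2 * ((1 + ‖ξ‖) ^ d)⁻¹ * w := by ring
      _ ≤ D * ((1 + ‖ξ‖) ^ d)⁻¹ * w := by
        gcongr
        exact le_add_of_nonneg_right (by positivity)
  · simp only [indicator_of_notMem hξ, zero_add]
    rw [← ofReal_norm, norm_mul]
    refine ENNReal.ofReal_le_ofReal ?_
    have h1 := HA₂ _ (mem_image_of_mem _ hφ) (-ξ) (by
      change - -ξ ∉ interior V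
      rw [neg_neg]
      exact fun h => hξ (interior_subset h))
    rw [localFourier_toDistribution, norm_neg] at h1
    rw [← div_eq_mul_inv, le_div_iff₀ (by positivity)]
    calc _ ≤ C' * (1 + ‖ξ‖) ^ M' * ‖ft (cut g φ) (-ξ)‖ * (1 + ‖ξ‖) ^ d := by
          gcongr; exact HC' ξ
      _ = C' * ((1 + ‖ξ‖) ^ (M' + d) * ‖ft (cut g φ) (-ξ)‖) := by rw [pow_add]; ring
      _ ≤ C' * |A₂| := by
        gcongr
        exact h1.trans (le_abs_self _)
      _ ≤ D := le_add_of_nonneg_left (by positivity)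

end Finiteness

/-! ### Wave front sets from boundedness -/

section WaveFrontOfBounded

variable {E : Type*} [NormedAddCommGroup E] [NormedSpace ℝ E] {Ω : Opens E}
  [FiniteDimensional ℝ E]

/-- Decay of one sufficiently high order gives square integrability with the Sobolev weight. -/
theorem memLp_sobolev_of_decay {h : StrongDual ℝ E → ℂ} (hh : Continuous h) {s : ℝ} {m : ℕ}
    (hm : |s| ≤ m) {V : Set (StrongDual ℝ E)} (hV : IsClosed V) {C : ℝ}
    (H : ∀ ξ ∈ V, (1 + ‖ξ‖) ^ (m + decayExp E) * ‖h ξ‖ ≤ C) :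
    MemLp (fun ξ => (1 + ‖ξ‖ ^ 2) ^ (s / 2) • h ξ) 2 ((dualHaar E).restrict V) := by
  have hc : Continuous fun ξ : StrongDual ℝ E => (1 + ‖ξ‖ ^ 2) ^ (s / 2) • h ξ := by
    refine Continuous.smul (Continuous.rpow_const (by fun_prop) fun ξ => Or.inl ?_) hh
    positivity
  rw [memLp_two_iff_integrable_sq_norm hc.aestronglyMeasurable]
  refine ((integrable_decay (E := E)).const_mul (C ^ 2)).integrableOn.mono'
    (hc.norm.pow 2).aestronglyMeasurable
    ((ae_restrict_iff' hV.measurableSet).2 (.of_forall fun ξ hξ => ?_))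
  rw [Real.norm_of_nonneg (by positivity), ← div_eq_mul_inv, le_div_iff₀ (by positivity)]
  have h1 : (1 + ‖ξ‖ ^ 2) ^ (s / 2) ≤ (1 + ‖ξ‖) ^ m := by
    calc (1 + ‖ξ‖ ^ 2) ^ (s / 2) ≤ (1 + ‖ξ‖ ^ 2) ^ ((m : ℝ) / 2) := by
          refine Real.rpow_le_rpow_of_exponent_le (by linarith [sq_nonneg ‖ξ‖]) ?_
          linarith [le_abs_self s]
      _ ≤ ((1 + ‖ξ‖) ^ 2) ^ ((m : ℝ) / 2) := by
          refine Real.rpow_le_rpow (by positivity) ?_ (by positivity)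
          nlinarith [norm_nonneg ξ]
      _ = (1 + ‖ξ‖) ^ m := by
          rw [← Real.rpow_natCast _ 2, ← Real.rpow_mul (by positivity),
            ← Real.rpow_natCast _ m]
          congr 1
          push_cast
          ring
  have h2 : ‖(1 + ‖ξ‖ ^ 2) ^ (s / 2) • h ξ‖ ≤ (1 + ‖ξ‖) ^ m * ‖h ξ‖ := by
    rw [norm_smul, Real.norm_of_nonneg (by positivity)]
    gcongr
  calc _ ≤ ((1 + ‖ξ‖) ^ m * ‖h ξ‖) ^ 2 * ((1 + ‖ξ‖) ^ decayExp E) ^ 2 := by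
        gcongr
        exact le_self_pow₀ (one_le_pow₀ (by linarith [norm_nonneg ξ])) two_ne_zero
    _ = ((1 + ‖ξ‖) ^ (m + decayExp E) * ‖h ξ‖) ^ 2 := by rw [pow_add]; ring
    _ ≤ C ^ 2 := by gcongr; exact H ξ hξ

variable [MeasureSpace E] [BorelSpace E] [(volume : Measure E).IsAddHaarMeasure]

theorem cut_eq_zero_of_disjoint {f : 𝓓(Ω, ℝ)} {φ : 𝓓(Ω, ℂ)}
    (h : Disjoint (tsupport f) (tsupport φ)) : cut f φ = 0 := by
  ext x
  rw [cut_apply]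
  by_cases hx : x ∈ tsupport f
  · rw [image_eq_zero_of_notMem_tsupport (disjoint_left.1 h hx), mul_zero]; rfl
  · rw [image_eq_zero_of_notMem_tsupport hx]; simp

/-- A distribution which is bounded on the sets of test functions of the topology
`I_ppp` has its wave front set in the closure of the cone. -/
theorem WF_subset_closure_of_bounded {γ : Set (E × StrongDual ℝ E)} (hγ : IsCone Ω γ)
    (u : 𝓓'(Ω, ℂ)) (H : ∀ B, IsDualBounded Ω γ B → ∃ C : ℝ, ∀ φ ∈ B, ‖pair φ u‖ ≤ C) :
    WF u ⊆ closure γ := by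
  rintro ⟨x, ξ⟩ ⟨hx, hξ, hz⟩
  by_contra hcl
  obtain ⟨O, hO, W, hW, hOW⟩ := mem_nhds_prod_iff.1 (isClosed_closure.isOpen_compl.mem_nhds hcl)
  have hW' : {ζ | ∀ y ∈ O, (y, ζ) ∉ γ} ∈ 𝓝 ξ := by
    filter_upwards [hW] with ζ hζ y hy hyγ
    exact hOW (mk_mem_prod hy hζ) (subset_closure hyγ)
  obtain ⟨δ, hδ, hδW⟩ := exists_coneNhd_subset hξ hW' fun ζ hζ t ht y hy hyγ => by
    have := hγ.smul_mem _ hyγ t⁻¹ (inv_pos.2 ht)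
    exact hζ y hy (by simpa [smul_smul, inv_mul_cancel₀ ht.ne'] using this)
  have hVc := isClosedCovectorCone_coneNhd ξ δ
  set V := coneNhd ξ δ
  refine hz ⟨O, hO, V, coneNhd_mem_nhds hξ hδ, hVc, fun φ hφ N => ?_⟩
  -- The waves with frequencies in `V`, even multiplied by powers of the frequency, are bounded in
  -- the space of distributions with wave front set in `supp φ × -V`, which is disjoint from `-γ`.
  let Λ : Set (E × StrongDual ℝ E) := {z | z.1 ∈ tsupport φ ∧ z.2 ≠ 0 ∧ -z.2 ∈ V}
  have hΛ : IsClosedCone Ω Λ :=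
    { subset := fun z hz => ⟨φ.tsupport_subset hz.1, hz.2.1⟩
      smul_mem := fun z hz t ht => ⟨hz.1, smul_ne_zero ht.ne' hz.2.1, by
        have := hVc.2 _ hz.2.2 t ht
        rwa [smul_neg] at this⟩
      closed := fun z hz _ h2 => by
        have hc : IsClosed {z : E × StrongDual ℝ E | z.1 ∈ tsupport φ ∧ -z.2 ∈ V} :=
          ((isClosed_tsupport φ).preimage continuous_fst).inter
            (hVc.1.preimage continuous_snd.neg)
        have hsub : Λ ⊆ {z : E × StrongDual ℝ E | z.1 ∈ tsupport φ ∧ -z.2 ∈ V} :=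
          fun z hz => ⟨hz.1, hz.2.2⟩
        have h3 := closure_minimal hsub hc hz
        exact ⟨h3.1, h2, h3.2⟩ }
  have hB := normallyBounded_modulate (Γ := Λ) (fun _ : V => complexify φ) (fun ζ => ζ.1) N
    ((fourierBounded_singleton _).mono range_const_subset) fun f V' hV' hd => by
      by_cases hdis : Disjoint (tsupport f) (tsupport φ)
      · refine ⟨1, one_pos, ?_⟩
        have : cut f (complexify φ) = 0 :=
          cut_eq_zero_of_disjoint (hdis.mono_right (tsupport_complexify_subset φ))
        simp [this]
      · obtain ⟨y, hyf, hyφ⟩ := not_disjoint_iff.1 hdis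
        obtain ⟨c, hc, hsep⟩ := exists_cone_separation hVc hV' fun η hη hη' => by
          by_contra h0
          exact disjoint_left.1 hd (mk_mem_prod hyf hη')
            ⟨hyφ, neg_ne_zero.2 h0, by simpa using hη⟩
        refine ⟨c, hc, ?_⟩
        convert finite_empty
        refine eq_empty_of_forall_notMem fun ζ hζ => hζ (Or.inr fun η hη => hsep _ ζ.2 _ hη)
  obtain ⟨C, hC⟩ := H _ (isDualBounded_of_normallyBounded φ.hasCompactSupport.isCompact
    φ.tsupport_subset (by
      rintro _ ⟨ζ, rfl⟩
      exact (tsupport_const_smul_subset _ _).trans (tsupport_wave_subset φ ζ.1)) hΛ (fun z hz hzγ =>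
      hδW _ hz.2.2 (neg_ne_zero.2 hz.2.1) _ (hφ hz.1) hzγ) hB)
  refine ⟨C, fun ζ hζ => ?_⟩
  have := hC _ ⟨⟨ζ, hζ⟩, rfl⟩
  rwa [pair_smul_left, norm_mul, Complex.norm_of_nonneg (by positivity)] at this

/-- Each sequence of test functions becomes bounded after multiplication by small constants; this is
the metrizability of the space of test functions with support in a fixed compact set. -/
theorem exists_fourierBounded_smul (φ : ℕ → 𝓓(Ω, ℂ)) :
    ∃ c : ℕ → ℝ, (∀ n, 0 < c n) ∧ FourierBounded (range fun n => ((c n : ℝ) : ℂ) • φ n) := by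
  choose A hA0 hA using fun n M => ft_rapid_decay (φ n).contDiff (φ n).hasCompactSupport M
  have hS : ∀ n, 0 ≤ ∑ M ∈ Finset.range (n + 1), A n M :=
    fun n => Finset.sum_nonneg fun M _ => hA0 n M
  have hcp : ∀ n, 0 < (1 + ∑ M ∈ Finset.range (n + 1), A n M)⁻¹ :=
    fun n => inv_pos.2 (by linarith [hS n])
  refine ⟨fun n => (1 + ∑ M ∈ Finset.range (n + 1), A n M)⁻¹, hcp, fun M => ?_⟩
  obtain ⟨D, hD⟩ := ((Set.finite_lt_nat M).image
    fun n => (1 + ∑ M ∈ Finset.range (n + 1), A n M)⁻¹ * A n M).bddAbove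
  refine ⟨max D 1, ?_⟩
  rintro _ ⟨n, rfl⟩ ξ
  rw [ft_smul, norm_mul, Complex.norm_of_nonneg (hcp n).le, mul_left_comm]
  refine (mul_le_mul_of_nonneg_left (hA n M ξ) (hcp n).le).trans ?_
  rcases lt_or_ge n M with hn | hn
  · exact (hD (mem_image_of_mem _ hn)).trans (le_max_left _ _)
  · refine le_trans ?_ (le_max_right _ _)
    rw [inv_mul_le_iff₀ (by linarith [hS n]), mul_one]
    have := Finset.single_le_sum (fun M _ => hA0 n M)
      (Finset.mem_range.2 (Nat.lt_succ_of_le hn))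
    linarith

/-- A distribution which is bounded on the sets of test functions of the topology `I_ppp` has its
dual wave front set in the cone. -/
theorem DWF_subset_of_bounded {γ : Set (E × StrongDual ℝ E)} (hγ : IsCone Ω γ)
    (u : 𝓓'(Ω, ℂ)) (H : ∀ B, IsDualBounded Ω γ B → ∃ C : ℝ, ∀ φ ∈ B, ‖pair φ u‖ ≤ C) :
    DWF u ⊆ γ := by
  refine iUnion_subset fun s => ?_
  rintro ⟨x, ξ⟩ ⟨hx, hξ, hz⟩
  by_contra hzγ
  simp only at hx hξ hz
  obtain ⟨m, hm⟩ := exists_nat_ge |s|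
  obtain ⟨r, hr, hrΩ⟩ := Metric.nhds_basis_closedBall.mem_iff.1 (Ω.isOpen.mem_nhds hx)
  have hδp : ∀ n : ℕ, 0 < 1 / ((n : ℝ) + 1) := fun n => by positivity
  -- Otherwise there are test functions supported closer and closer to `x` whose products with `u`
  -- fail to decay along directions closer and closer to `ξ`.
  have hseq : ∀ n : ℕ, ∃ φ : 𝓓(Ω, ℝ), tsupport φ ⊆ Metric.closedBall x (r * (1 / ((n : ℝ) + 1))) ∧
      ∀ C : ℝ, ∃ ζ ∈ coneNhd ξ (1 / ((n : ℝ) + 1)),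
        C < (1 + ‖ζ‖) ^ (m + decayExp E) * ‖localFourier φ ζ u‖ := by
    intro n
    by_contra! hcon
    refine hz ⟨_, Metric.closedBall_mem_nhds x (mul_pos hr (hδp n)), _,
      coneNhd_mem_nhds hξ (hδp n), isClosedCovectorCone_coneNhd _ _, fun φ hφ => ?_⟩
    obtain ⟨C, hC⟩ := hcon φ hφ
    exact memLp_sobolev_of_decay (continuous_localFourier φ u) hm
      (isClosedCovectorCone_coneNhd _ _).1 hC
  choose φ hφs hφ using hseq
  obtain ⟨c, hc, hcB⟩ := exists_fourierBounded_smul fun n => complexify (φ n)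
  -- The bound `n / c n` makes up for the small constants `c n`.
  choose ζ hζV hζ using fun n => hφ n (n / c n)
  -- A sequence of waves concentrating at `(x, ξ)` is bounded in the space of distributions with
  -- wave front set in the opposite of this single ray. A ray is closed, while `γ` is arbitrary.
  let Λ : Set (E × StrongDual ℝ E) := {z | z.1 = x ∧ ∃ t : ℝ, 0 < t ∧ z.2 = -(t • ξ)}
  have hray : IsClosed {η : StrongDual ℝ E | ∃ t : ℝ, 0 ≤ t ∧ η = -(t • ξ)} := by
    have : IsClosedEmbedding fun t : ℝ => -(t • ξ) :=
      (Homeomorph.neg _).isClosedEmbedding.comp (isClosedEmbedding_smul_left hξ)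
    convert this.isClosedMap _ (isClosed_Ici (a := (0 : ℝ))) using 1
    ext η
    simp [eq_comm]
  have hΛ : IsClosedCone Ω Λ :=
    { subset := by
        rintro z ⟨hz1, t, ht, hz2⟩
        exact ⟨hz1 ▸ hx, hz2 ▸ neg_ne_zero.2 (smul_ne_zero ht.ne' hξ)⟩
      smul_mem := by
        rintro z ⟨hz1, t, ht, hz2⟩ s hs
        exact ⟨hz1, s * t, mul_pos hs ht, by rw [hz2]; simp [smul_smul]⟩
      closed := fun z hz _ h2 => by
        have hcl : IsClosed {z : E × StrongDual ℝ E | z.1 = x ∧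
            z.2 ∈ {η : StrongDual ℝ E | ∃ t : ℝ, 0 ≤ t ∧ η = -(t • ξ)}} :=
          (isClosed_eq continuous_fst continuous_const).inter (hray.preimage continuous_snd)
        have hsub : Λ ⊆ {z : E × StrongDual ℝ E | z.1 = x ∧
            z.2 ∈ {η : StrongDual ℝ E | ∃ t : ℝ, 0 ≤ t ∧ η = -(t • ξ)}} :=
          fun z hz => ⟨hz.1, hz.2.imp fun t h => ⟨h.1.le, h.2⟩⟩
        obtain ⟨h3, t, ht, h4⟩ := closure_minimal hsub hcl hz
        refine ⟨h3, t, lt_of_le_of_ne ht ?_, h4⟩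
        rintro rfl
        simp at h4
        exact h2 h4 }
  have hsupp : ∀ n, tsupport (((c n : ℝ) : ℂ) • complexify (φ n)) ⊆
      Metric.closedBall x (r * (1 / ((n : ℝ) + 1))) := fun n =>
    (tsupport_const_smul_subset _ _).trans
      ((tsupport_complexify_subset _).trans (hφs n))
  have hlim : Tendsto (fun n : ℕ => 1 / ((n : ℝ) + 1)) atTop (𝓝 0) :=
    tendsto_one_div_add_atTop_nhds_zero_nat
  have hB := normallyBounded_modulate (Γ := Λ) (fun n => ((c n : ℝ) : ℂ) • complexify (φ n)) ζ
    (m + decayExp E) hcB fun f V hV hd => by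
      by_cases hxf : x ∈ tsupport f
      · have hW : {η | -η ∉ V} ∈ 𝓝 ξ := (hV.1.isOpen_compl.preimage continuous_neg).mem_nhds
          fun hξV => disjoint_left.1 hd (mk_mem_prod hxf hξV) ⟨rfl, 1, one_pos, by simp⟩
        obtain ⟨δ, hδ, hδV⟩ := exists_coneNhd_subset hξ hW fun η hη t ht hη' => hη (by
          have h1 : t • (-η) ∈ V := by rw [smul_neg]; exact hη'
          have := hV.2 _ h1 t⁻¹ (inv_pos.2 ht)
          rwa [smul_smul, inv_mul_cancel₀ ht.ne', one_smul] at this)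
        obtain ⟨a, ha, hsep⟩ := exists_cone_separation (isClosedCovectorCone_coneNhd ξ δ) hV
          fun η hη hη' => by
            by_contra h0
            exact hδV η hη h0 hη'
        refine ⟨a, ha, ?_⟩
        obtain ⟨n₀, hn₀⟩ := eventually_atTop.1 (hlim.eventually_le_const hδ)
        refine (Set.finite_lt_nat n₀).subset fun n hn => ?_
        by_contra hnn
        exact hn (Or.inr fun η hη => hsep _ (coneNhd_mono (hn₀ n (not_lt.1 hnn)) (hζV n)) _ hη)
      · refine ⟨1, one_pos, ?_⟩
        obtain ⟨ρ, hρ, hρf⟩ :=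
          Metric.mem_nhds_iff.1 ((isClosed_tsupport f).isOpen_compl.mem_nhds hxf)
        have hl2 : Tendsto (fun n : ℕ => r * (1 / ((n : ℝ) + 1))) atTop (𝓝 0) := by
          simpa using hlim.const_mul r
        obtain ⟨n₀, hn₀⟩ := eventually_atTop.1 (hl2.eventually_lt_const hρ)
        refine (Set.finite_lt_nat n₀).subset fun n hn => ?_
        by_contra hnn
        refine hn (Or.inl (cut_eq_zero_of_disjoint (disjoint_left.2 fun y hy hy' => ?_)))
        exact hρf (lt_of_le_of_lt (hsupp n hy') (hn₀ n (not_lt.1 hnn))) hy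
  obtain ⟨C, hC⟩ := H _ (isDualBounded_of_normallyBounded (isCompact_closedBall x r) hrΩ (by
      rintro _ ⟨n, rfl⟩
      refine (tsupport_const_smul_subset _ _).trans
        ((tsupport_modulate_subset _ _).trans ((hsupp n).trans
          (Metric.closedBall_subset_closedBall ?_)))
      have : 1 / ((n : ℝ) + 1) ≤ 1 := by
        rw [div_le_one (by positivity)]; linarith [Nat.cast_nonneg (α := ℝ) n]
      nlinarith) hΛ (by
      rintro z ⟨hz1, t, ht, hz2⟩ hzγ'
      have := hγ.smul_mem _ hzγ' t⁻¹ (inv_pos.2 ht)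
      rw [hz1, hz2, neg_neg] at this
      simp only [smul_smul, inv_mul_cancel₀ ht.ne', one_smul] at this
      exact hzγ this) hB)
  obtain ⟨n, hn⟩ := exists_nat_gt C
  have h1 := hC _ ⟨n, rfl⟩
  have h2 : modulate (((c n : ℝ) : ℂ) • complexify (φ n)) (ζ n) =
      ((c n : ℝ) : ℂ) • wave (φ n) (ζ n) := by
    ext y
    change ((c n : ℝ) : ℂ) * complexify (φ n) y * character (ζ n) y =
      ((c n : ℝ) : ℂ) * (complexify (φ n) y * character (ζ n) y)
    rw [mul_assoc]
  rw [pair_smul_left, h2, pair_smul_left, norm_mul, norm_mul,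
    Complex.norm_of_nonneg (by positivity), Complex.norm_of_nonneg (hc n).le] at h1
  have h3 := hζ n
  rw [div_lt_iff₀ (hc n), localFourier_eq_pair] at h3
  nlinarith

end WaveFrontOfBounded

/-! ### Uniform structures of extended seminorms -/

namespace ExtSeminorm

variable {M : Type*} [AddCommGroup M] [Module ℂ M]

theorem uniformity_eq (P : Set (ExtSeminorm M)) :
    @uniformity M (uniformSpace P) =
      ⨅ p ∈ P, ⨅ ε > (0 : ℝ≥0∞), 𝓟 {x : M × M | p (x.1 - x.2) < ε} := by
  simp only [iInf_uniformity]
  rfl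

/-- A criterion for the completeness of a set of vectors with the uniform structure of a family of
seminorms. -/
theorem completeSpace_comap (P : Set (ExtSeminorm M)) (S : Set M)
    (h : ∀ ℱ : Filter M, ℱ.NeBot → S ∈ ℱ →
      (∀ p ∈ P, ∀ ε > (0 : ℝ≥0∞), ∃ A ∈ ℱ, ∀ v ∈ A, ∀ w ∈ A, p (v - w) < ε) →
      ∃ u ∈ S, ∀ p ∈ P, ∀ ε > (0 : ℝ≥0∞), ∃ A ∈ ℱ, ∀ v ∈ A, p (u - v) < ε) :
    @CompleteSpace S ((uniformSpace P).comap Subtype.val) := by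
  let _ := uniformSpace P
  let _ : UniformSpace S := (uniformSpace P).comap Subtype.val
  refine ⟨fun {f} hf => ?_⟩
  have hne := hf.1
  obtain ⟨u, hu, H⟩ := h (map Subtype.val f) inferInstance
    (mem_map.2 (univ_mem' fun x => x.2)) fun p hp ε hε => by
      have h1 : {x : M × M | p (x.1 - x.2) < ε} ∈ uniformity M := by
        rw [uniformity_eq]
        exact mem_iInf_of_mem p (mem_iInf_of_mem hp (mem_iInf_of_mem ε
          (mem_iInf_of_mem hε (mem_principal_self _))))
      have h2 : {x : S × S | p (x.1.1 - x.2.1) < ε} ∈ uniformity S := ⟨_, h1, fun x hx => hx⟩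
      obtain ⟨A, hA, hAA⟩ := mem_prod_same_iff.1 (hf.2 h2)
      refine ⟨Subtype.val '' A, image_mem_map hA, ?_⟩
      rintro _ ⟨v, hv, rfl⟩ _ ⟨w, hw, rfl⟩
      exact hAA (mk_mem_prod hv hw)
  refine ⟨⟨u, hu⟩, ?_⟩
  rw [nhds_eq_comap_uniformity, uniformity_comap, comap_comap, uniformity_eq]
  simp only [comap_iInf, comap_principal, le_iInf_iff, le_principal_iff]
  intro p hp ε hε
  obtain ⟨A, hA, HA⟩ := H p hp ε hε
  exact mem_of_superset hA fun v hv => HA _ hv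

theorem le_sub_add (p : ExtSeminorm M) (u v : M) : p u ≤ p (u - v) + p v := by
  simpa using p.add_le (u - v) v

end ExtSeminorm

/-! ### Limits of Cauchy filters of distributions -/

section Completeness

variable {E : Type*} [NormedAddCommGroup E] [NormedSpace ℝ E] {Ω : Opens E}
  [MeasureSpace E] [FiniteDimensional ℝ E] [BorelSpace E] [(volume : Measure E).IsAddHaarMeasure]

/-- A linear form which is bounded on bounded sequences of test functions is a distribution. Were it
not bounded by the Fourier norm of any order `n`, suitable multiples of counterexamples would form a
bounded sequence on which it is unbounded. -/
theorem continuous_of_bounded_on_fourierBounded (ℓ : 𝓓(Ω, ℝ) →ₗ[ℝ] ℂ)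
    (h : ∀ (K : Set E), IsCompact K → K ⊆ Ω → ∀ g : ℕ → 𝓓(Ω, ℝ), (∀ n, tsupport (g n) ⊆ K) →
      FourierBounded (range fun n => complexify (g n)) → ∃ C : ℝ, ∀ n, ‖ℓ (g n)‖ ≤ C) :
    Continuous ℓ := by
  refine continuous_of_fourier_bound ℓ fun K hK hKΩ => ?_
  by_contra! hcon
  choose f hfK A hA hf using fun n : ℕ => hcon n (n : ℝ)
  have hA0 : ∀ n, 0 ≤ A n := fun n => le_trans (by positivity) (hA n 0)
  have hp : ∀ n, 0 < ‖ℓ (f n)‖ := fun n =>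
    lt_of_le_of_lt (mul_nonneg (Nat.cast_nonneg n) (hA0 n)) (hf n)
  have hft : ∀ (n : ℕ) ξ, ft (complexify (((n : ℝ) / ‖ℓ (f n)‖) • f n)) ξ =
      ((n / ‖ℓ (f n)‖ : ℝ) : ℂ) * ft (complexify (f n)) ξ := fun n ξ => by
    rw [← ft_smul]
    congr 1
    ext x
    simp [complexify_apply]
  obtain ⟨C, hC⟩ := h K hK hKΩ (fun n => ((n : ℝ) / ‖ℓ (f n)‖) • f n)
    (fun n => (tsupport_smul_subset_right (fun _ : E => (n : ℝ) / ‖ℓ (f n)‖) (f n)).trans (hfK n))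
    fun M => by
      choose D _ hD using fun n : ℕ =>
        ft_rapid_decay (complexify (((n : ℝ) / ‖ℓ (f n)‖) • f n)).contDiff
          (complexify (((n : ℝ) / ‖ℓ (f n)‖) • f n)).hasCompactSupport M
      obtain ⟨B, hB⟩ := ((Set.finite_lt_nat M).image D).bddAbove
      refine ⟨max B 1, ?_⟩
      rintro _ ⟨n, rfl⟩ ξ
      rcases lt_or_ge n M with hn | hn
      · exact ((hD n ξ).trans (hB (mem_image_of_mem _ hn))).trans (le_max_left _ _)
      · refine le_trans ?_ (le_max_right _ _)
        simp only
        rw [hft, norm_mul, Complex.norm_of_nonneg (by positivity)]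
        calc _ ≤ (1 + ‖ξ‖) ^ n * (n / ‖ℓ (f n)‖ * ‖ft (complexify (f n)) ξ‖) := by
              gcongr
              linarith [norm_nonneg ξ]
          _ = n / ‖ℓ (f n)‖ * ((1 + ‖ξ‖) ^ n * ‖ft (complexify (f n)) ξ‖) := by ring
          _ ≤ n / ‖ℓ (f n)‖ * A n := by gcongr; exact hA n ξ
          _ ≤ 1 := by
            rw [div_mul_eq_mul_div, div_le_one (hp n)]
            exact (hf n).le
  obtain ⟨n, hn⟩ := exists_nat_gt C
  have := hC n
  rw [map_smul, norm_smul, Real.norm_of_nonneg (by positivity),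
    div_mul_cancel₀ _ (hp n).ne'] at this
  linarith

theorem enorm_pair_le_strongSeminorm {B : Set 𝓓(Ω, ℂ)} {φ : 𝓓(Ω, ℂ)} (hφ : φ ∈ B)
    (u : 𝓓'(Ω, ℂ)) : ‖pair φ u‖ₑ ≤ strongSeminorm B u := by
  refine le_trans (le_of_eq ?_) (le_iSup (fun i : B => (1 : ℝ≥0∞) * ‖pair i.1 u‖ₑ) ⟨φ, hφ⟩)
  rw [one_mul]

/-- The seminorms which are suprema of pairings are lower semicontinuous for weak limits. -/
theorem ofFamily_sub_le_of_tendsto {ι : Type*} (w : ι → ℝ≥0∞) (hw : ∀ i, w i ≠ ⊤)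
    (θ : ι → 𝓓(Ω, ℂ)) {ℱ : Filter 𝓓'(Ω, ℂ)} [ℱ.NeBot] {u v : 𝓓'(Ω, ℂ)}
    (hu : ∀ φ, Tendsto (fun v => pair φ v) ℱ (𝓝 (pair φ u))) {ε : ℝ≥0∞}
    (h : ∀ᶠ v' in ℱ, ExtSeminorm.ofFamily w (fun i => pair (θ i)) (v' - v) ≤ ε) :
    ExtSeminorm.ofFamily w (fun i => pair (θ i)) (u - v) ≤ ε := by
  refine iSup_le fun i => ?_
  have h1 : Tendsto (fun v' => w i * ‖pair (θ i) (v' - v)‖ₑ) ℱ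
      (𝓝 (w i * ‖pair (θ i) (u - v)‖ₑ)) := by
    refine ENNReal.Tendsto.const_mul (Tendsto.enorm ?_) (Or.inr (hw i))
    have h2 := (hu (θ i)).sub_const (pair (θ i) v)
    simpa only [map_sub] using h2
  refine le_of_tendsto h1 (h.mono fun v' hv' => le_trans ?_ hv')
  exact le_iSup (fun i => w i * ‖pair (θ i) (v' - v)‖ₑ) i

/-- A family of distributions which is Cauchy for the topology `I_ppp` has a limit. -/
theorem exists_limit_of_cauchy {γ : Set (E × StrongDual ℝ E)} (hγ : IsCone Ω γ)
    {ℱ : Filter 𝓓'(Ω, ℂ)} [ℱ.NeBot] (hS : (wfSpace Ω γ (closure γ) : Set 𝓓'(Ω, ℂ)) ∈ ℱ)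
    (hc : ∀ p ∈ pppSeminorms Ω γ, ∀ ε > (0 : ℝ≥0∞), ∃ A ∈ ℱ, ∀ v ∈ A, ∀ w ∈ A, p (v - w) < ε) :
    ∃ u ∈ wfSpace Ω γ (closure γ), ∀ φ, Tendsto (fun v => pair φ v) ℱ (𝓝 (pair φ u)) := by
  -- The Cauchy property bounds the members of the filter up to one of them, which is bounded on
  -- dual bounded sets because of its dual wave front set.
  have hfin : ∀ B : Set 𝓓(Ω, ℂ), IsDualBounded Ω γ B → ∃ C : ℝ, ∀ᶠ v in ℱ, ∀ φ ∈ B,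
      ‖pair φ v‖ ≤ C := by
    intro B hB
    obtain ⟨A, hA, H⟩ := hc _ ⟨B, hB, rfl⟩ 1 one_pos
    obtain ⟨v₀, hv₀A, hv₀⟩ := Filter.nonempty_of_mem (inter_mem hA hS)
    obtain ⟨⟨K, hK, hKΩ, hs⟩, Γ, hΓ, hΓγ, hBΓ⟩ := hB.normallyBounded
    obtain ⟨C, hC⟩ := exists_pair_bound_of_DWF hΓ hK hKΩ hs hBΓ v₀
      fun z hz hzD => hΓγ z hz (hv₀.1 hzD)
    refine ⟨1 + C, mem_of_superset hA fun v hv φ hφ => ?_⟩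
    have h1 : ‖pair φ (v - v₀)‖ₑ ≤ 1 := by
      exact (enorm_pair_le_strongSeminorm hφ _).trans (H v hv v₀ hv₀A).le
    have h2 : ‖pair φ (v - v₀)‖ ≤ 1 := by
      rw [← ofReal_norm] at h1
      exact ENNReal.ofReal_le_one.1 h1
    calc ‖pair φ v‖ = ‖pair φ (v - v₀) + pair φ v₀‖ := by rw [map_sub, sub_add_cancel]
      _ ≤ _ := (norm_add_le _ _).trans (add_le_add h2 (hC φ hφ))
  have hlim : ∀ f : 𝓓(Ω, ℝ), ∃ a : ℂ, Tendsto (fun v : 𝓓'(Ω, ℂ) => v f) ℱ (𝓝 a) := by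
    intro f
    refine cauchy_iff_exists_le_nhds.1 (Metric.cauchy_iff.2 ⟨inferInstance, fun ε hε => ?_⟩)
    obtain ⟨A, hA, H⟩ := hc _ ⟨{complexify f}, isDualBounded_of_fourierBounded γ
      f.hasCompactSupport.isCompact f.tsupport_subset
      (by simpa using tsupport_complexify_subset f) (fourierBounded_singleton _), rfl⟩
      (ENNReal.ofReal ε) (by simpa using hε)
    refine ⟨_, image_mem_map hA, ?_⟩
    rintro _ ⟨v, hv, rfl⟩ _ ⟨w, hw, rfl⟩
    have h1 : ‖pair (complexify f) (v - w)‖ₑ < ENNReal.ofReal ε :=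
      (enorm_pair_le_strongSeminorm (mem_singleton _) _).trans_lt (H v hv w hw)
    rw [← ofReal_norm, ENNReal.ofReal_lt_ofReal_iff hε, map_sub, pair_complexify,
      pair_complexify] at h1
    rwa [dist_eq_norm]
  choose ℓ hℓ using hlim
  let L : 𝓓(Ω, ℝ) →ₗ[ℝ] ℂ :=
    { toFun := ℓ
      map_add' := fun f g => tendsto_nhds_unique (hℓ (f + g)) (by
        simpa only [map_add] using (hℓ f).add (hℓ g))
      map_smul' := fun c f => tendsto_nhds_unique (hℓ (c • f)) (by
        simpa only [map_smul, RingHom.id_apply] using (hℓ f).const_smul c) }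
  have hL : Continuous L := by
    refine continuous_of_bounded_on_fourierBounded L fun K hK hKΩ g hg hB => ?_
    obtain ⟨C, hC⟩ := hfin _ (isDualBounded_of_fourierBounded γ hK hKΩ (by
      rintro _ ⟨n, rfl⟩
      exact (tsupport_complexify_subset _).trans (hg n)) hB)
    refine ⟨C, fun n => le_of_tendsto (hℓ (g n)).norm (hC.mono fun v hv => ?_)⟩
    rw [← pair_complexify]
    exact hv _ ⟨n, rfl⟩
  let u : 𝓓'(Ω, ℂ) := (⟨L, hL⟩ : 𝓓(Ω, ℝ) →L[ℝ] ℂ)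
  have hu : ∀ φ, Tendsto (fun v => pair φ v) ℱ (𝓝 (pair φ u)) := fun φ => by
    simp only [pair_apply]
    exact (hℓ _).add ((hℓ _).const_mul _)
  -- The limit inherits the bounds on dual bounded sets, and these locate its wave front sets.
  have hub : ∀ B, IsDualBounded Ω γ B → ∃ C : ℝ, ∀ φ ∈ B, ‖pair φ u‖ ≤ C := fun B hB => by
    obtain ⟨C, hC⟩ := hfin B hB
    exact ⟨C, fun φ hφ => le_of_tendsto (hu φ).norm (hC.mono fun v hv => hv φ hφ)⟩
  exact ⟨u, ⟨DWF_subset_of_bounded hγ u hub, WF_subset_closure_of_bounded hγ u hub⟩, hu⟩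

/-- A weak limit of a filter which is Cauchy for a seminorm is also a limit for the seminorm. -/
theorem tendsto_seminorm_of_cauchy {ι : Type*} (w : ι → ℝ≥0∞) (hw : ∀ i, w i ≠ ⊤)
    (θ : ι → 𝓓(Ω, ℂ)) {ℱ : Filter 𝓓'(Ω, ℂ)} [ℱ.NeBot] {u : 𝓓'(Ω, ℂ)}
    (hu : ∀ φ, Tendsto (fun v => pair φ v) ℱ (𝓝 (pair φ u)))
    (hc : ∀ ε > (0 : ℝ≥0∞), ∃ A ∈ ℱ, ∀ v ∈ A, ∀ v' ∈ A,
      ExtSeminorm.ofFamily w (fun i => pair (θ i)) (v - v') < ε) (ε : ℝ≥0∞) (hε : 0 < ε) :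
    ∃ A ∈ ℱ, ∀ v ∈ A, ExtSeminorm.ofFamily w (fun i => pair (θ i)) (u - v) < ε := by
  obtain ⟨δ, hδ, hδε⟩ := exists_between hε
  obtain ⟨A, hA, H⟩ := hc δ hδ
  exact ⟨A, hA, fun v hv => lt_of_le_of_lt (ofFamily_sub_le_of_tendsto w hw θ hu
    (mem_of_superset hA fun v' hv' => (H v' hv' v hv).le)) hδε⟩

end Completeness

/-! ### Covectors of a product -/

section Covectors

variable {E₁ : Type*} [NormedAddCommGroup E₁] [NormedSpace ℝ E₁]
  {E₂ : Type*} [NormedAddCommGroup E₂] [NormedSpace ℝ E₂]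
  {U₁ : Opens E₁} {U₂ : Opens E₂} {γ₁ : Set (E₁ × StrongDual ℝ E₁)}
  {γ₂ : Set (E₂ × StrongDual ℝ E₂)}

theorem coprod_eq_zero_iff {ξ : StrongDual ℝ E₁} {η : StrongDual ℝ E₂} :
    ξ.coprod η = 0 ↔ ξ = 0 ∧ η = 0 := by
  refine ⟨fun h => ⟨?_, ?_⟩, ?_⟩
  · ext x
    have := congrArg (fun ζ : StrongDual ℝ (E₁ × E₂) => ζ (x, 0)) h
    simpa using this
  · ext y
    have := congrArg (fun ζ : StrongDual ℝ (E₁ × E₂) => ζ (0, y)) h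
    simpa using this
  · rintro ⟨rfl, rfl⟩
    ext z <;> simp

theorem smul_coprod (t : ℝ) (ξ : StrongDual ℝ E₁) (η : StrongDual ℝ E₂) :
    t • ξ.coprod η = (t • ξ).coprod (t • η) := by
  ext z <;> simp

theorem neg_coprod (ξ : StrongDual ℝ E₁) (η : StrongDual ℝ E₂) :
    -(ξ.coprod η) = (-ξ).coprod (-η) := by
  ext z <;> simp

theorem isCone_dotProd (hγ₁ : IsCone U₁ γ₁) (hγ₂ : IsCone U₂ γ₂) :
    IsCone (prodOpens U₁ U₂) (dotProd U₁ U₂ γ₁ γ₂) where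
  subset := by
    rintro _ ⟨x, ξ, y, η, rfl, ⟨h1, h2⟩ | ⟨h1, hy, rfl⟩ | ⟨hx, rfl, h2⟩⟩
    · exact ⟨⟨(hγ₁.subset _ h1).1, (hγ₂.subset _ h2).1⟩,
        fun h => (hγ₁.subset _ h1).2 (coprod_eq_zero_iff.1 h).1⟩
    · exact ⟨⟨(hγ₁.subset _ h1).1, hy⟩, fun h => (hγ₁.subset _ h1).2 (coprod_eq_zero_iff.1 h).1⟩
    · exact ⟨⟨hx, (hγ₂.subset _ h2).1⟩, fun h => (hγ₂.subset _ h2).2 (coprod_eq_zero_iff.1 h).2⟩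
  smul_mem := by
    rintro _ ⟨x, ξ, y, η, rfl, h⟩ t ht
    refine ⟨x, t • ξ, y, t • η, by rw [smul_coprod], ?_⟩
    rcases h with ⟨h1, h2⟩ | ⟨h1, hy, rfl⟩ | ⟨hx, rfl, h2⟩
    · exact Or.inl ⟨hγ₁.smul_mem _ h1 t ht, hγ₂.smul_mem _ h2 t ht⟩
    · exact Or.inr (Or.inl ⟨hγ₁.smul_mem _ h1 t ht, hy, smul_zero t⟩)
    · exact Or.inr (Or.inr ⟨hx, smul_zero t, hγ₂.smul_mem _ h2 t ht⟩)

end Covectors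

/-! ### Completeness for `I_β` -/

section CompletenessBeta

variable {E₁ : Type*} [NormedAddCommGroup E₁] [NormedSpace ℝ E₁]
  {E₂ : Type*} [NormedAddCommGroup E₂] [NormedSpace ℝ E₂]
  [FiniteDimensional ℝ E₁] [MeasureSpace E₁] [BorelSpace E₁]
  [(volume : Measure E₁).IsAddHaarMeasure]
  [FiniteDimensional ℝ E₂] [MeasureSpace E₂] [BorelSpace E₂]
  [(volume : Measure E₂).IsAddHaarMeasure]
  {U₁ : Opens E₁} {U₂ : Opens E₂} {γ₁ : Set (E₁ × StrongDual ℝ E₁)}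
  {γ₂ : Set (E₂ × StrongDual ℝ E₂)}

instance isAddHaarMeasure_volume_prod : (volume : Measure (E₁ × E₂)).IsAddHaarMeasure :=
  inferInstanceAs ((volume : Measure E₁).prod (volume : Measure E₂)).IsAddHaarMeasure

/-- All the seminorms of `I_β` are weighted suprema of pairings with test functions. -/
theorem betaSeminorms_eq_ofFamily {p : ExtSeminorm 𝓓'(prodOpens U₁ U₂, ℂ)}
    (hp : p ∈ betaSeminorms U₁ U₂ γ₁ γ₂) :
    (∃ (B : Set 𝓓(prodOpens U₁ U₂, ℂ)), p = ExtSeminorm.ofFamily (fun _ : B => 1)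
      fun i => pair i.1) ∨
    ∃ (A : Set (StrongDual ℝ E₁ × StrongDual ℝ E₂)) (w : A → ℝ)
      (θ : A → 𝓓(prodOpens U₁ U₂, ℂ)),
      p = ExtSeminorm.ofFamily (fun i => ENNReal.ofReal (w i)) fun i => pair (θ i) := by
  rcases hp with ⟨B, -, rfl⟩ | ⟨φ₁, φ₂, V₁, V₂, D, k, l, -, -, -, -, -, -, rfl | rfl⟩
  · exact Or.inl ⟨B, rfl⟩
  · exact Or.inr ⟨region₁ D k ∩ univ ×ˢ V₂, _,
      fun ζ => wave (tensor φ₁ φ₂) (ζ.1.1.coprod ζ.1.2), rfl⟩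
  · exact Or.inr ⟨region₂ D k ∩ V₁ ×ˢ univ, _,
      fun ζ => wave (tensor φ₁ φ₂) (ζ.1.1.coprod ζ.1.2), rfl⟩

theorem exists_limit_betaSeminorms (hγ₁ : IsCone U₁ γ₁) (hγ₂ : IsCone U₂ γ₂)
    {ℱ : Filter 𝓓'(prodOpens U₁ U₂, ℂ)} [ℱ.NeBot]
    (hS : (fullSpace U₁ U₂ γ₁ γ₂ : Set 𝓓'(prodOpens U₁ U₂, ℂ)) ∈ ℱ)
    (hc : ∀ p ∈ betaSeminorms U₁ U₂ γ₁ γ₂, ∀ ε > (0 : ℝ≥0∞),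
      ∃ A ∈ ℱ, ∀ v ∈ A, ∀ w ∈ A, p (v - w) < ε) :
    ∃ u ∈ fullSpace U₁ U₂ γ₁ γ₂, ∀ p ∈ betaSeminorms U₁ U₂ γ₁ γ₂, ∀ ε > (0 : ℝ≥0∞),
      ∃ A ∈ ℱ, ∀ v ∈ A, p (u - v) < ε := by
  obtain ⟨u, hu, hlim⟩ := exists_limit_of_cauchy (isCone_dotProd hγ₁ hγ₂) hS
    fun p hp => hc p (Or.inl hp)
  refine ⟨u, hu, fun p hp ε hε => ?_⟩
  have hcp := hc p hp
  rcases betaSeminorms_eq_ofFamily hp with ⟨B, rfl⟩ | ⟨A, w, θ, rfl⟩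
  · exact tendsto_seminorm_of_cauchy _ (fun _ => ENNReal.one_ne_top) _ hlim hcp ε hε
  · exact tendsto_seminorm_of_cauchy _ (fun _ => ENNReal.ofReal_ne_top) _ hlim hcp ε hε

theorem completeSpace_fullBeta (hγ₁ : IsCone U₁ γ₁) (hγ₂ : IsCone U₂ γ₂) :
    CompleteSpace (FullBeta U₁ U₂ γ₁ γ₂) :=
  ExtSeminorm.completeSpace_comap (betaSeminorms U₁ U₂ γ₁ γ₂)
    (fullSpace U₁ U₂ γ₁ γ₂ : Set 𝓓'(prodOpens U₁ U₂, ℂ))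
    fun _ _ hS hc => exists_limit_betaSeminorms hγ₁ hγ₂ hS hc

theorem completeSpace_beta (hγ₁ : IsCone U₁ γ₁) (hγ₂ : IsCone U₂ γ₂) :
    CompleteSpace (Beta U₁ U₂ γ₁ γ₂) := by
  refine ExtSeminorm.completeSpace_comap (betaSeminorms U₁ U₂ γ₁ γ₂)
    ((fullSpace U₁ U₂ γ₁ γ₂ ⊓ ExtSeminorm.finitePart (extraSeminorms U₁ U₂ γ₁ γ₂) :
      Submodule ℂ 𝓓'(prodOpens U₁ U₂, ℂ)) : Set 𝓓'(prodOpens U₁ U₂, ℂ))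
    fun ℱ _ hS hc => ?_
  obtain ⟨u, hu, H⟩ := exists_limit_betaSeminorms hγ₁ hγ₂
    (mem_of_superset hS fun v hv => hv.1) hc
  refine ⟨u, ⟨hu, fun p hp => ?_⟩, H⟩
  obtain ⟨A, hA, HA⟩ := H p (Or.inr hp) 1 one_pos
  obtain ⟨v, hv, hvS⟩ := Filter.nonempty_of_mem (inter_mem hA hS)
  exact (p.le_sub_add u v).trans_lt (ENNReal.add_lt_top.2
    ⟨(HA v hv).trans ENNReal.one_lt_top, hvS.2 p hp⟩)

end CompletenessBeta

/-! ### The tensor product of localized distributions -/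

section TensorProduct

variable {E₁ : Type*} [NormedAddCommGroup E₁] [NormedSpace ℝ E₁]
  {E₂ : Type*} [NormedAddCommGroup E₂] [NormedSpace ℝ E₂]
  {U₁ : Opens E₁} {U₂ : Opens E₂}

theorem character_coprod (ξ : StrongDual ℝ E₁) (η : StrongDual ℝ E₂) (z : E₁ × E₂) :
    character (ξ.coprod η) z = character ξ z.1 * character η z.2 := by
  rw [character, character, character, ← Complex.exp_add]
  congr 1
  simp only [ContinuousLinearMap.coprod_apply, Complex.ofReal_add]
  ring

theorem norm_fst_le_norm_coprod (ξ : StrongDual ℝ E₁) (η : StrongDual ℝ E₂) :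
    ‖ξ‖ ≤ ‖ξ.coprod η‖ := by
  refine ξ.opNorm_le_bound (norm_nonneg _) fun x => ?_
  have := (ξ.coprod η).le_opNorm (x, 0)
  simpa [Prod.norm_def] using this

theorem norm_snd_le_norm_coprod (ξ : StrongDual ℝ E₁) (η : StrongDual ℝ E₂) :
    ‖η‖ ≤ ‖ξ.coprod η‖ := by
  refine η.opNorm_le_bound (norm_nonneg _) fun x => ?_
  have := (ξ.coprod η).le_opNorm (0, x)
  simpa [Prod.norm_def] using this

theorem norm_coprod_le (ξ : StrongDual ℝ E₁) (η : StrongDual ℝ E₂) :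
    ‖ξ.coprod η‖ ≤ ‖ξ‖ + ‖η‖ := by
  refine (ξ.coprod η).opNorm_le_bound (by positivity) fun z => ?_
  rw [ContinuousLinearMap.coprod_apply, add_mul]
  refine (norm_add_le _ _).trans (add_le_add ?_ ?_)
  · exact (ξ.le_opNorm _).trans (by gcongr; exact norm_fst_le z)
  · exact (η.le_opNorm _).trans (by gcongr; exact norm_snd_le z)

theorem continuous_coprod :
    Continuous fun p : StrongDual ℝ E₁ × StrongDual ℝ E₂ => p.1.coprod p.2 := by
  have h : ∀ p : StrongDual ℝ E₁ × StrongDual ℝ E₂, p.1.coprod p.2 =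
      p.1.comp (ContinuousLinearMap.fst ℝ E₁ E₂) + p.2.comp (ContinuousLinearMap.snd ℝ E₁ E₂) := by
    intro p
    ext z <;> simp
  simp_rw [h]
  exact (continuous_fst.clm_comp continuous_const).add (continuous_snd.clm_comp continuous_const)

/-- The exchange of the two variables of a test function. -/
def swapTest (φ : 𝓓(prodOpens U₁ U₂, ℂ)) : 𝓓(prodOpens U₂ U₁, ℂ) where
  toFun z := φ z.swap
  contDiff' := φ.contDiff.comp (contDiff_snd.prodMk contDiff_fst)
  hasCompactSupport' := φ.hasCompactSupport.comp_homeomorph (Homeomorph.prodComm E₂ E₁)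
  tsupport_subset' := by
    have h := tsupport_comp_subset_preimage (φ : E₁ × E₂ → ℂ) (continuous_swap (X := E₂) (Y := E₁))
    exact fun z hz => (φ.tsupport_subset (h hz)).symm

theorem swapTest_apply (φ : 𝓓(prodOpens U₁ U₂, ℂ)) (z : E₂ × E₁) :
    swapTest φ z = φ z.swap := rfl

variable [FiniteDimensional ℝ E₁] [MeasureSpace E₁] [BorelSpace E₁]
  [(volume : Measure E₁).IsAddHaarMeasure]
  [FiniteDimensional ℝ E₂] [MeasureSpace E₂] [BorelSpace E₂]
  [(volume : Measure E₂).IsAddHaarMeasure]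

/-- The partial Fourier transform of a test function in the second variable, as a test function of
the first one. -/
def sliceFst (φ : 𝓓(prodOpens U₁ U₂, ℂ)) (η : StrongDual ℝ E₂) : 𝓓(U₁, ℂ) where
  toFun x := ∫ y, φ (x, y) * character η y
  contDiff' := by
    -- The integral is the value at `0` of a convolution with the constant function `1`.
    have h := contDiffOn_convolution_right_with_param_comp (𝕜 := ℝ) (n := ⊤) (μ := volume)
      (ContinuousLinearMap.mul ℝ ℂ) (s := univ) (v := fun _ : E₁ => (0 : E₂))
      (f := fun _ : E₂ => (1 : ℂ)) (g := fun x y => φ (x, -y) * character η (-y))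
      (k := Neg.neg ⁻¹' (Prod.snd '' tsupport φ)) contDiffOn_const isOpen_univ
      ((Homeomorph.neg E₂).isCompact_preimage.2
        (φ.hasCompactSupport.isCompact.image continuous_snd)) (fun x y _ hy => by
          rw [image_eq_zero_of_notMem_tsupport (x := (x, -y)) fun h => hy ⟨_, h, rfl⟩, zero_mul])
      (locallyIntegrable_const _) (by
        refine ContDiff.contDiffOn (ContDiff.mul ?_ ?_)
        · exact φ.contDiff.comp (contDiff_fst.prodMk contDiff_snd.neg)
        · exact (contDiff_character η).comp contDiff_snd.neg)
    rw [contDiffOn_univ] at h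
    convert h using 2 with x
    simp [convolution]
  hasCompactSupport' := by
    refine HasCompactSupport.intro (φ.hasCompactSupport.isCompact.image continuous_fst)
      fun x hx => ?_
    simp_rw [image_eq_zero_of_notMem_tsupport (x := (x, _)) fun h => hx ⟨_, h, rfl⟩, zero_mul,
      integral_zero]
  tsupport_subset' := by
    have hK := (φ.hasCompactSupport.isCompact.image continuous_fst).isClosed
    refine (closure_minimal (fun x hx => ?_) hK).trans ?_
    · by_contra hx'
      refine hx ?_
      simp_rw [image_eq_zero_of_notMem_tsupport (x := (x, _)) fun h => hx' ⟨_, h, rfl⟩, zero_mul,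
        integral_zero]
    · rintro _ ⟨z, hz, rfl⟩
      exact (φ.tsupport_subset hz).1

theorem sliceFst_apply (φ : 𝓓(prodOpens U₁ U₂, ℂ)) (η : StrongDual ℝ E₂) (x : E₁) :
    sliceFst φ η x = ∫ y, φ (x, y) * character η y := rfl

theorem tsupport_sliceFst_subset (φ : 𝓓(prodOpens U₁ U₂, ℂ)) (η : StrongDual ℝ E₂) :
    tsupport (sliceFst φ η) ⊆ Prod.fst '' tsupport φ := by
  refine closure_minimal (fun x hx => ?_)
    (φ.hasCompactSupport.isCompact.image continuous_fst).isClosed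
  by_contra hx'
  refine hx ?_
  rw [sliceFst_apply]
  simp_rw [image_eq_zero_of_notMem_tsupport (x := (x, _)) fun h => hx' ⟨_, h, rfl⟩, zero_mul,
    integral_zero]

theorem ft_coprod (φ : 𝓓(prodOpens U₁ U₂, ℂ)) (ξ : StrongDual ℝ E₁) (η : StrongDual ℝ E₂) :
    ft φ (ξ.coprod η) = ∫ x, ∫ y, φ (x, y) * (character ξ x * character η y) := by
  have h := TestFunction_integrable (modulate φ (ξ.coprod η))
  rw [ft]
  rw [Measure.volume_eq_prod] at h ⊢
  have h' : Integrable (fun z => φ z * character (ξ.coprod η) z)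
    ((volume : Measure E₁).prod (volume : Measure E₂)) := h
  rw [integral_prod _ h']
  simp_rw [character_coprod]

theorem ft_sliceFst (φ : 𝓓(prodOpens U₁ U₂, ℂ)) (ξ : StrongDual ℝ E₁) (η : StrongDual ℝ E₂) :
    ft (sliceFst φ η) ξ = ft φ (ξ.coprod η) := by
  rw [ft_coprod, ft]
  refine integral_congr_ae (.of_forall fun x => ?_)
  simp only [sliceFst_apply]
  rw [← integral_mul_const]
  refine integral_congr_ae (.of_forall fun y => ?_)
  simp only
  ring

theorem ft_swapTest (φ : 𝓓(prodOpens U₁ U₂, ℂ)) (ξ : StrongDual ℝ E₁) (η : StrongDual ℝ E₂) :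
    ft (swapTest φ) (η.coprod ξ) = ft φ (ξ.coprod η) := by
  rw [ft, ft, Measure.volume_eq_prod, Measure.volume_eq_prod,
    ← integral_prod_swap (μ := (volume : Measure E₁)) (ν := (volume : Measure E₂))]
  refine integral_congr_ae (.of_forall fun z => ?_)
  simp only [swapTest_apply, character_coprod, Prod.fst_swap, Prod.snd_swap]
  ring

theorem weighted_ft_coprod_le {φ : 𝓓(prodOpens U₁ U₂, ℂ)} {n : ℕ} {A : ℝ}
    (hA : ∀ ζ, (1 + ‖ζ‖) ^ (n + n) * ‖ft φ ζ‖ ≤ A) (ξ : StrongDual ℝ E₁) (η : StrongDual ℝ E₂) :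
    (1 + ‖ξ‖) ^ n * (1 + ‖η‖) ^ n * ‖ft φ (-(ξ.coprod η))‖ ≤ A := by
  refine le_trans ?_ (hA (-(ξ.coprod η)))
  rw [norm_neg, pow_add]
  gcongr
  · exact norm_fst_le_norm_coprod ξ η
  · exact norm_snd_le_norm_coprod ξ η

theorem integrable_prod_decay : Integrable (fun p : StrongDual ℝ E₁ × StrongDual ℝ E₂ =>
    ((1 + ‖p.1‖) ^ decayExp E₁)⁻¹ * ((1 + ‖p.2‖) ^ decayExp E₂)⁻¹)
      ((dualHaar E₁).prod (dualHaar E₂)) :=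
  integrable_decay.mul_prod integrable_decay

theorem norm_mul_mul_ft_le {h₁ : StrongDual ℝ E₁ → ℂ} {h₂ : StrongDual ℝ E₂ → ℂ} {C₁ C₂ A : ℝ}
    {m₁ m₂ : ℕ} (hC₁ : ∀ ξ, ‖h₁ ξ‖ ≤ C₁ * (1 + ‖ξ‖) ^ m₁) (hC₂ : ∀ η, ‖h₂ η‖ ≤ C₂ * (1 + ‖η‖) ^ m₂)
    {φ : 𝓓(prodOpens U₁ U₂, ℂ)} {n : ℕ} (hn₁ : m₁ + decayExp E₁ ≤ n) (hn₂ : m₂ + decayExp E₂ ≤ n)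
    (hA : ∀ ζ, (1 + ‖ζ‖) ^ (n + n) * ‖ft φ ζ‖ ≤ A)
    (p : StrongDual ℝ E₁ × StrongDual ℝ E₂) :
    ‖h₁ p.1 * h₂ p.2 * ft φ (-(p.1.coprod p.2))‖ ≤
      C₁ * C₂ * A * (((1 + ‖p.1‖) ^ decayExp E₁)⁻¹ * ((1 + ‖p.2‖) ^ decayExp E₂)⁻¹) := by
  have h0₁ : 0 ≤ C₁ := by simpa using (norm_nonneg _).trans (hC₁ 0)
  have h0₂ : 0 ≤ C₂ := by simpa using (norm_nonneg _).trans (hC₂ 0)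
  rw [← mul_inv, ← div_eq_mul_inv, le_div_iff₀ (by positivity), norm_mul, norm_mul]
  have hx : 1 ≤ 1 + ‖p.1‖ := by linarith [norm_nonneg p.1]
  have hy : 1 ≤ 1 + ‖p.2‖ := by linarith [norm_nonneg p.2]
  calc _ ≤ C₁ * (1 + ‖p.1‖) ^ m₁ * (C₂ * (1 + ‖p.2‖) ^ m₂) * ‖ft φ (-(p.1.coprod p.2))‖ *
        ((1 + ‖p.1‖) ^ decayExp E₁ * (1 + ‖p.2‖) ^ decayExp E₂) := by
        gcongr
        · exact hC₁ _
        · exact hC₂ _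
    _ = C₁ * C₂ * ((1 + ‖p.1‖) ^ (m₁ + decayExp E₁) * (1 + ‖p.2‖) ^ (m₂ + decayExp E₂) *
        ‖ft φ (-(p.1.coprod p.2))‖) := by rw [pow_add, pow_add]; ring
    _ ≤ C₁ * C₂ * ((1 + ‖p.1‖) ^ n * (1 + ‖p.2‖) ^ n * ‖ft φ (-(p.1.coprod p.2))‖) := by
        gcongr
    _ ≤ _ := by
        gcongr
        exact weighted_ft_coprod_le hA p.1 p.2

theorem integrable_tensor_integrand (χ₁ : 𝓓(U₁, ℝ)) (χ₂ : 𝓓(U₂, ℝ)) (u₁ : 𝓓'(U₁, ℂ))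
    (u₂ : 𝓓'(U₂, ℂ)) (φ : 𝓓(prodOpens U₁ U₂, ℂ)) :
    Integrable (fun p : StrongDual ℝ E₁ × StrongDual ℝ E₂ =>
      localFourier χ₁ p.1 u₁ * localFourier χ₂ p.2 u₂ * ft φ (-(p.1.coprod p.2)))
      ((dualHaar E₁).prod (dualHaar E₂)) := by
  obtain ⟨m₁, C₁, -, hC₁⟩ := exists_localFourier_growth χ₁ u₁
  obtain ⟨m₂, C₂, -, hC₂⟩ := exists_localFourier_growth χ₂ u₂
  set n := m₁ + decayExp E₁ + (m₂ + decayExp E₂)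
  obtain ⟨A, -, hA⟩ := ft_rapid_decay φ.contDiff φ.hasCompactSupport (n + n)
  refine (integrable_prod_decay.const_mul (C₁ * C₂ * A)).mono' ?_ (.of_forall
    (norm_mul_mul_ft_le hC₁ hC₂ (Nat.le_add_right _ _) (Nat.le_add_left _ _) hA))
  refine Continuous.aestronglyMeasurable ?_
  exact (((continuous_localFourier χ₁ u₁).comp continuous_fst).mul
    ((continuous_localFourier χ₂ u₂).comp continuous_snd)).mul
    ((continuous_ft (TestFunction_integrable φ)).comp continuous_coprod.neg)

/-- The value of `χ₁ u₁ ⊗ χ₂ u₂` on a test function, defined on the Fourier side: it is the integral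
of the product of the two Fourier transforms against that of the test function. -/
def tensorForm (χ₁ : 𝓓(U₁, ℝ)) (χ₂ : 𝓓(U₂, ℝ)) (u₁ : 𝓓'(U₁, ℂ)) (u₂ : 𝓓'(U₂, ℂ))
    (φ : 𝓓(prodOpens U₁ U₂, ℂ)) : ℂ :=
  invConst E₁ * invConst E₂ * ∫ p : StrongDual ℝ E₁ × StrongDual ℝ E₂,
    localFourier χ₁ p.1 u₁ * localFourier χ₂ p.2 u₂ * ft φ (-(p.1.coprod p.2))
      ∂(dualHaar E₁).prod (dualHaar E₂)

/-- Fubini's theorem: `χ₁ u₁` acts first, on the partial Fourier transforms of the test function. -/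
theorem tensorForm_eq (χ₁ : 𝓓(U₁, ℝ)) (χ₂ : 𝓓(U₂, ℝ)) (u₁ : 𝓓'(U₁, ℂ)) (u₂ : 𝓓'(U₂, ℂ))
    (φ : 𝓓(prodOpens U₁ U₂, ℂ)) : tensorForm χ₁ χ₂ u₁ u₂ φ =
      invConst E₂ * ∫ η, localFourier χ₂ η u₂ * pair (cut χ₁ (sliceFst φ (-η))) u₁
        ∂dualHaar E₂ := by
  rw [tensorForm, integral_prod_symm _ (integrable_tensor_integrand χ₁ χ₂ u₁ u₂ φ), mul_comm
    (invConst E₁), mul_assoc, ← integral_const_mul]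
  congr 1
  refine integral_congr_ae (.of_forall fun η => ?_)
  simp only
  rw [pair_cut, mul_left_comm, ← integral_const_mul (localFourier χ₂ η u₂)]
  congr 1
  refine integral_congr_ae (.of_forall fun ξ => ?_)
  simp only
  rw [ft_sliceFst, neg_coprod]
  ring

theorem tensorForm_swap (χ₁ : 𝓓(U₁, ℝ)) (χ₂ : 𝓓(U₂, ℝ)) (u₁ : 𝓓'(U₁, ℂ)) (u₂ : 𝓓'(U₂, ℂ))
    (φ : 𝓓(prodOpens U₁ U₂, ℂ)) :
    tensorForm χ₂ χ₁ u₂ u₁ (swapTest φ) = tensorForm χ₁ χ₂ u₁ u₂ φ := by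
  rw [tensorForm, tensorForm, ← integral_prod_swap (μ := dualHaar E₁) (ν := dualHaar E₂),
    mul_comm (invConst E₂)]
  congr 1
  refine integral_congr_ae (.of_forall fun p => ?_)
  simp only [Prod.fst_swap, Prod.snd_swap, neg_coprod]
  rw [ft_swapTest]
  ring

theorem tensorForm_congr_left {χ₁ χ₁' : 𝓓(U₁, ℝ)} {χ₂ : 𝓓(U₂, ℝ)} {u₁ : 𝓓'(U₁, ℂ)}
    {u₂ : 𝓓'(U₂, ℂ)} {φ : 𝓓(prodOpens U₁ U₂, ℂ)} {K : Set E₁} (hφ : Prod.fst '' tsupport φ ⊆ K)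
    (h : ∀ x ∈ K, χ₁ x = 1) (h' : ∀ x ∈ K, χ₁' x = 1) :
    tensorForm χ₁ χ₂ u₁ u₂ φ = tensorForm χ₁' χ₂ u₁ u₂ φ := by
  rw [tensorForm_eq, tensorForm_eq]
  congr 1
  refine integral_congr_ae (.of_forall fun η => ?_)
  simp only
  rw [cut_eq_self h ((tsupport_sliceFst_subset _ _).trans hφ),
    cut_eq_self h' ((tsupport_sliceFst_subset _ _).trans hφ)]

theorem tsupport_swapTest_subset (φ : 𝓓(prodOpens U₁ U₂, ℂ)) :
    Prod.fst '' tsupport (swapTest φ) ⊆ Prod.snd '' tsupport φ := by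
  rintro _ ⟨z, hz, rfl⟩
  exact ⟨z.swap, tsupport_comp_subset_preimage (φ : E₁ × E₂ → ℂ)
    (continuous_swap (X := E₂) (Y := E₁)) hz, rfl⟩

/-- The value of `χ₁ u₁ ⊗ χ₂ u₂` on `φ` does not depend on the functions `χ₁` and `χ₂`, as long as
they are equal to `1` on the projections of the support of `φ`. -/
theorem tensorForm_congr {χ₁ χ₁' : 𝓓(U₁, ℝ)} {χ₂ χ₂' : 𝓓(U₂, ℝ)} {u₁ : 𝓓'(U₁, ℂ)}
    {u₂ : 𝓓'(U₂, ℂ)} {φ : 𝓓(prodOpens U₁ U₂, ℂ)} (h₁ : ∀ z ∈ tsupport φ, χ₁ z.1 = 1)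
    (h₁' : ∀ z ∈ tsupport φ, χ₁' z.1 = 1) (h₂ : ∀ z ∈ tsupport φ, χ₂ z.2 = 1)
    (h₂' : ∀ z ∈ tsupport φ, χ₂' z.2 = 1) :
    tensorForm χ₁ χ₂ u₁ u₂ φ = tensorForm χ₁' χ₂' u₁ u₂ φ := by
  rw [tensorForm_congr_left (K := Prod.fst '' tsupport φ) subset_rfl (by simpa using h₁)
    (by simpa using h₁'), ← tensorForm_swap, ← tensorForm_swap χ₁']
  refine tensorForm_congr_left (K := Prod.snd '' tsupport φ) (tsupport_swapTest_subset φ) ?_ ?_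
  · rintro _ ⟨z, hz, rfl⟩
    exact h₂ z hz
  · rintro _ ⟨z, hz, rfl⟩
    exact h₂' z hz

end TensorProduct

/-! ### The tensor product of distributions -/

section TensorDistribution

variable {E₁ : Type*} [NormedAddCommGroup E₁] [NormedSpace ℝ E₁]
  {E₂ : Type*} [NormedAddCommGroup E₂] [NormedSpace ℝ E₂]
  {U₁ : Opens E₁} {U₂ : Opens E₂}
  [FiniteDimensional ℝ E₁] [MeasureSpace E₁] [BorelSpace E₁]
  [(volume : Measure E₁).IsAddHaarMeasure]
  [FiniteDimensional ℝ E₂] [MeasureSpace E₂] [BorelSpace E₂]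
  [(volume : Measure E₂).IsAddHaarMeasure]

theorem exists_cutoff_prod {K : Set (E₁ × E₂)} (hK : IsCompact K)
    (hKU : K ⊆ prodOpens U₁ U₂) : ∃ (χ₁ : 𝓓(U₁, ℝ)) (χ₂ : 𝓓(U₂, ℝ)),
      (∀ z ∈ K, χ₁ z.1 = 1) ∧ ∀ z ∈ K, χ₂ z.2 = 1 := by
  obtain ⟨χ₁, h₁, -⟩ := exists_cutoff (hK.image continuous_fst) U₁.isOpen (by
    rintro _ ⟨z, hz, rfl⟩
    exact (hKU hz).1) subset_rfl
  obtain ⟨χ₂, h₂, -⟩ := exists_cutoff (hK.image continuous_snd) U₂.isOpen (by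
    rintro _ ⟨z, hz, rfl⟩
    exact (hKU hz).2) subset_rfl
  exact ⟨χ₁, χ₂, fun z hz => h₁ _ ⟨z, hz, rfl⟩, fun z hz => h₂ _ ⟨z, hz, rfl⟩⟩

/-- The value of the tensor product of two distributions on a test function. It is computed with
arbitrary cutoffs, equal to `1` on the projections of the support; see `tensorPair_eq`. -/
def tensorPair (u₁ : 𝓓'(U₁, ℂ)) (u₂ : 𝓓'(U₂, ℂ)) (φ : 𝓓(prodOpens U₁ U₂, ℂ)) : ℂ :=
  tensorForm
    (exists_cutoff_prod φ.hasCompactSupport.isCompact φ.tsupport_subset).choose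
    (exists_cutoff_prod φ.hasCompactSupport.isCompact φ.tsupport_subset).choose_spec.choose u₁ u₂ φ

theorem tensorPair_eq {χ₁ : 𝓓(U₁, ℝ)} {χ₂ : 𝓓(U₂, ℝ)} (u₁ : 𝓓'(U₁, ℂ)) (u₂ : 𝓓'(U₂, ℂ))
    {φ : 𝓓(prodOpens U₁ U₂, ℂ)} (h₁ : ∀ z ∈ tsupport φ, χ₁ z.1 = 1)
    (h₂ : ∀ z ∈ tsupport φ, χ₂ z.2 = 1) : tensorPair u₁ u₂ φ = tensorForm χ₁ χ₂ u₁ u₂ φ := by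
  have h := (exists_cutoff_prod φ.hasCompactSupport.isCompact
    φ.tsupport_subset).choose_spec.choose_spec
  exact tensorForm_congr h.1 h₁ h.2 h₂

theorem tensorForm_add (χ₁ : 𝓓(U₁, ℝ)) (χ₂ : 𝓓(U₂, ℝ)) (u₁ : 𝓓'(U₁, ℂ)) (u₂ : 𝓓'(U₂, ℂ))
    (φ ψ : 𝓓(prodOpens U₁ U₂, ℂ)) : tensorForm χ₁ χ₂ u₁ u₂ (φ + ψ) =
      tensorForm χ₁ χ₂ u₁ u₂ φ + tensorForm χ₁ χ₂ u₁ u₂ ψ := by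
  simp only [tensorForm, ft_add]
  rw [← mul_add, ← integral_add (integrable_tensor_integrand _ _ _ _ _)
    (integrable_tensor_integrand _ _ _ _ _)]
  simp only [mul_add]

theorem tensorForm_smul (χ₁ : 𝓓(U₁, ℝ)) (χ₂ : 𝓓(U₂, ℝ)) (u₁ : 𝓓'(U₁, ℂ)) (u₂ : 𝓓'(U₂, ℂ))
    (c : ℂ) (φ : 𝓓(prodOpens U₁ U₂, ℂ)) : tensorForm χ₁ χ₂ u₁ u₂ (c • φ) =
      c * tensorForm χ₁ χ₂ u₁ u₂ φ := by
  simp only [tensorForm, ft_smul]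
  rw [mul_left_comm c, ← integral_const_mul c]
  congr 2
  ext p
  ring

theorem tensorForm_add_left (χ₁ : 𝓓(U₁, ℝ)) (χ₂ : 𝓓(U₂, ℝ)) (u₁ v₁ : 𝓓'(U₁, ℂ)) (u₂ : 𝓓'(U₂, ℂ))
    (φ : 𝓓(prodOpens U₁ U₂, ℂ)) : tensorForm χ₁ χ₂ (u₁ + v₁) u₂ φ =
      tensorForm χ₁ χ₂ u₁ u₂ φ + tensorForm χ₁ χ₂ v₁ u₂ φ := by
  simp only [tensorForm]
  rw [← mul_add, ← integral_add (integrable_tensor_integrand _ _ _ _ _)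
    (integrable_tensor_integrand _ _ _ _ _)]
  simp only [map_add, add_mul]

theorem tensorForm_smul_left (χ₁ : 𝓓(U₁, ℝ)) (χ₂ : 𝓓(U₂, ℝ)) (c : ℂ) (u₁ : 𝓓'(U₁, ℂ))
    (u₂ : 𝓓'(U₂, ℂ)) (φ : 𝓓(prodOpens U₁ U₂, ℂ)) : tensorForm χ₁ χ₂ (c • u₁) u₂ φ =
      c * tensorForm χ₁ χ₂ u₁ u₂ φ := by
  simp only [tensorForm, map_smul, smul_eq_mul]
  rw [mul_left_comm c, ← integral_const_mul c]
  congr 2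
  ext p
  ring

theorem tensorForm_add_right (χ₁ : 𝓓(U₁, ℝ)) (χ₂ : 𝓓(U₂, ℝ)) (u₁ : 𝓓'(U₁, ℂ))
    (u₂ v₂ : 𝓓'(U₂, ℂ)) (φ : 𝓓(prodOpens U₁ U₂, ℂ)) : tensorForm χ₁ χ₂ u₁ (u₂ + v₂) φ =
      tensorForm χ₁ χ₂ u₁ u₂ φ + tensorForm χ₁ χ₂ u₁ v₂ φ := by
  simp only [← tensorForm_swap χ₁, tensorForm_add_left]

theorem tensorForm_smul_right (χ₁ : 𝓓(U₁, ℝ)) (χ₂ : 𝓓(U₂, ℝ)) (c : ℂ) (u₁ : 𝓓'(U₁, ℂ))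
    (u₂ : 𝓓'(U₂, ℂ)) (φ : 𝓓(prodOpens U₁ U₂, ℂ)) : tensorForm χ₁ χ₂ u₁ (c • u₂) φ =
      c * tensorForm χ₁ χ₂ u₁ u₂ φ := by
  simp only [← tensorForm_swap χ₁, tensorForm_smul_left]

/-- The tensor product as a linear form in the complex test function. -/
def tensorPairLin (u₁ : 𝓓'(U₁, ℂ)) (u₂ : 𝓓'(U₂, ℂ)) : 𝓓(prodOpens U₁ U₂, ℂ) →ₗ[ℂ] ℂ where
  toFun := tensorPair u₁ u₂
  map_add' φ ψ := by
    obtain ⟨χ₁, χ₂, h₁, h₂⟩ := exists_cutoff_prod (U₁ := U₁) (U₂ := U₂)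
      (φ.hasCompactSupport.isCompact.union ψ.hasCompactSupport.isCompact)
      (union_subset φ.tsupport_subset ψ.tsupport_subset)
    have hs : tsupport (φ + ψ : 𝓓(prodOpens U₁ U₂, ℂ)) ⊆ tsupport φ ∪ tsupport ψ :=
      tsupport_add (φ : E₁ × E₂ → ℂ) ψ
    rw [tensorPair_eq (χ₁ := χ₁) (χ₂ := χ₂) u₁ u₂ (fun z hz => h₁ z (hs hz))
        fun z hz => h₂ z (hs hz),
      tensorPair_eq (χ₁ := χ₁) (χ₂ := χ₂) u₁ u₂ (fun z hz => h₁ z (Or.inl hz))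
        fun z hz => h₂ z (Or.inl hz),
      tensorPair_eq (χ₁ := χ₁) (χ₂ := χ₂) u₁ u₂ (fun z hz => h₁ z (Or.inr hz))
        fun z hz => h₂ z (Or.inr hz), tensorForm_add]
  map_smul' c φ := by
    obtain ⟨χ₁, χ₂, h₁, h₂⟩ := exists_cutoff_prod φ.hasCompactSupport.isCompact φ.tsupport_subset
    have hs := tsupport_const_smul_subset c φ
    rw [tensorPair_eq (χ₁ := χ₁) (χ₂ := χ₂) u₁ u₂ (fun z hz => h₁ z (hs hz))
        fun z hz => h₂ z (hs hz), tensorPair_eq u₁ u₂ h₁ h₂, tensorForm_smul]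
    rfl

theorem norm_tensorForm_le (χ₁ : 𝓓(U₁, ℝ)) (χ₂ : 𝓓(U₂, ℝ)) (u₁ : 𝓓'(U₁, ℂ)) (u₂ : 𝓓'(U₂, ℂ)) :
    ∃ (M : ℕ) (C : ℝ), ∀ (φ : 𝓓(prodOpens U₁ U₂, ℂ)) (A : ℝ),
      (∀ ζ, (1 + ‖ζ‖) ^ M * ‖ft φ ζ‖ ≤ A) → ‖tensorForm χ₁ χ₂ u₁ u₂ φ‖ ≤ C * A := by
  obtain ⟨m₁, C₁, -, hC₁⟩ := exists_localFourier_growth χ₁ u₁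
  obtain ⟨m₂, C₂, -, hC₂⟩ := exists_localFourier_growth χ₂ u₂
  set n := m₁ + decayExp E₁ + (m₂ + decayExp E₂)
  refine ⟨n + n, ‖invConst E₁ * invConst E₂‖ * (C₁ * C₂ *
    ∫ p : StrongDual ℝ E₁ × StrongDual ℝ E₂, ((1 + ‖p.1‖) ^ decayExp E₁)⁻¹ *
      ((1 + ‖p.2‖) ^ decayExp E₂)⁻¹ ∂(dualHaar E₁).prod (dualHaar E₂)), fun φ A hA => ?_⟩
  rw [tensorForm, norm_mul, mul_assoc]
  gcongr
  refine (norm_integral_le_of_norm_le (integrable_prod_decay.const_mul (C₁ * C₂ * A)) (.of_forall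
    (norm_mul_mul_ft_le hC₁ hC₂ (Nat.le_add_right _ _) (Nat.le_add_left _ _) hA))).trans
    (le_of_eq ?_)
  rw [integral_const_mul]
  ring

theorem complexify_add {E : Type*} [NormedAddCommGroup E] [NormedSpace ℝ E] {Ω : Opens E}
    (f g : 𝓓(Ω, ℝ)) : complexify (f + g) = complexify f + complexify g := map_add _ f g

theorem complexify_smul {E : Type*} [NormedAddCommGroup E] [NormedSpace ℝ E] {Ω : Opens E}
    (c : ℝ) (f : 𝓓(Ω, ℝ)) : complexify (c • f) = (c : ℂ) • complexify f := by
  ext x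
  simp [complexify_apply]

/-- The restriction of the tensor product to real test functions. -/
def tensorRealLin (u₁ : 𝓓'(U₁, ℂ)) (u₂ : 𝓓'(U₂, ℂ)) : 𝓓(prodOpens U₁ U₂, ℝ) →ₗ[ℝ] ℂ where
  toFun f := tensorPairLin u₁ u₂ (complexify f)
  map_add' f g := by rw [complexify_add, map_add]
  map_smul' c f := by rw [complexify_smul, map_smul]; rfl

theorem continuous_tensorRealLin (u₁ : 𝓓'(U₁, ℂ)) (u₂ : 𝓓'(U₂, ℂ)) :
    Continuous (tensorRealLin u₁ u₂) := by
  refine continuous_of_fourier_bound _ fun K hK hKU => ?_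
  obtain ⟨χ₁, χ₂, h₁, h₂⟩ := exists_cutoff_prod hK hKU
  obtain ⟨M, C, H⟩ := norm_tensorForm_le χ₁ χ₂ u₁ u₂
  refine ⟨M, C, fun f hf A hA => ?_⟩
  have hs := (tsupport_complexify_subset f).trans hf
  have h := tensorPair_eq u₁ u₂ (fun z hz => h₁ z (hs hz)) fun z hz => h₂ z (hs hz)
  change ‖tensorPair u₁ u₂ (complexify f)‖ ≤ C * A
  rw [h]
  exact H _ _ hA

/-- The tensor product of two distributions. -/
def tensorDist (u₁ : 𝓓'(U₁, ℂ)) (u₂ : 𝓓'(U₂, ℂ)) : 𝓓'(prodOpens U₁ U₂, ℂ) :=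
  (⟨tensorRealLin u₁ u₂, continuous_tensorRealLin u₁ u₂⟩ : 𝓓(prodOpens U₁ U₂, ℝ) →L[ℝ] ℂ)

theorem pair_tensorDist {χ₁ : 𝓓(U₁, ℝ)} {χ₂ : 𝓓(U₂, ℝ)} (u₁ : 𝓓'(U₁, ℂ)) (u₂ : 𝓓'(U₂, ℂ))
    {φ : 𝓓(prodOpens U₁ U₂, ℂ)} (h₁ : ∀ z ∈ tsupport φ, χ₁ z.1 = 1)
    (h₂ : ∀ z ∈ tsupport φ, χ₂ z.2 = 1) :
    pair φ (tensorDist u₁ u₂) = tensorForm χ₁ χ₂ u₁ u₂ φ := by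
  rw [← tensorPair_eq u₁ u₂ h₁ h₂]
  change tensorPairLin u₁ u₂ _ + Complex.I * tensorPairLin u₁ u₂ _ = tensorPairLin u₁ u₂ φ
  rw [← smul_eq_mul, ← map_smul, ← map_add]
  congr 1
  ext z
  simp only [FunLike.coe_add, FunLike.coe_smul, Pi.add_apply, Pi.smul_apply, complexify_apply,
    TestFunction.postcompCLM_apply, Function.comp_apply, Complex.reCLM_apply, Complex.imCLM_apply,
    smul_eq_mul]
  rw [mul_comm, Complex.re_add_im]

theorem tensorDist_add_left (u₁ v₁ : 𝓓'(U₁, ℂ)) (u₂ : 𝓓'(U₂, ℂ)) :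
    tensorDist (u₁ + v₁) u₂ = tensorDist u₁ u₂ + tensorDist v₁ u₂ := by
  ext f
  exact tensorForm_add_left _ _ _ _ _ _

theorem tensorDist_smul_left (c : ℂ) (u₁ : 𝓓'(U₁, ℂ)) (u₂ : 𝓓'(U₂, ℂ)) :
    tensorDist (c • u₁) u₂ = c • tensorDist u₁ u₂ := by
  ext f
  exact tensorForm_smul_left _ _ _ _ _ _

theorem tensorDist_add_right (u₁ : 𝓓'(U₁, ℂ)) (u₂ v₂ : 𝓓'(U₂, ℂ)) :
    tensorDist u₁ (u₂ + v₂) = tensorDist u₁ u₂ + tensorDist u₁ v₂ := by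
  ext f
  exact tensorForm_add_right _ _ _ _ _ _

theorem tensorDist_smul_right (c : ℂ) (u₁ : 𝓓'(U₁, ℂ)) (u₂ : 𝓓'(U₂, ℂ)) :
    tensorDist u₁ (c • u₂) = c • tensorDist u₁ u₂ := by
  ext f
  exact tensorForm_smul_right _ _ _ _ _ _

theorem tsupport_tensor_subset (φ₁ : 𝓓(U₁, ℝ)) (φ₂ : 𝓓(U₂, ℝ)) :
    tsupport (tensor φ₁ φ₂) ⊆ tsupport φ₁ ×ˢ tsupport φ₂ :=
  closure_minimal (fun _ hz => ⟨subset_tsupport _ (left_ne_zero_of_mul hz),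
    subset_tsupport _ (right_ne_zero_of_mul hz)⟩)
    ((isClosed_tsupport φ₁).prod (isClosed_tsupport φ₂))

theorem sliceFst_wave_tensor (φ₁ : 𝓓(U₁, ℝ)) (φ₂ : 𝓓(U₂, ℝ)) (ξ : StrongDual ℝ E₁)
    (η ζ : StrongDual ℝ E₂) : sliceFst (wave (tensor φ₁ φ₂) (ξ.coprod η)) ζ =
      ft (wave φ₂ η) ζ • wave φ₁ ξ := by
  ext x
  change ∫ y, wave (tensor φ₁ φ₂) (ξ.coprod η) (x, y) * character ζ y =
    ft (wave φ₂ η) ζ * wave φ₁ ξ x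
  rw [ft, ← integral_mul_const]
  refine integral_congr_ae (.of_forall fun y => ?_)
  simp only [wave_apply, character_coprod]
  change ((φ₁ x * φ₂ y : ℝ) : ℂ) * _ * _ = _
  push_cast
  ring

theorem cut_smul {E : Type*} [NormedAddCommGroup E] [NormedSpace ℝ E] {Ω : Opens E}
    (f : 𝓓(Ω, ℝ)) (c : ℂ) (φ : 𝓓(Ω, ℂ)) : cut f (c • φ) = c • cut f φ := by
  ext x
  change (f x : ℂ) * (c * φ x) = c * ((f x : ℂ) * φ x)
  ring

/-- The localized Fourier transform of a tensor product is the product of those of the factors. -/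
theorem localFourier_tensorDist (φ₁ : 𝓓(U₁, ℝ)) (φ₂ : 𝓓(U₂, ℝ)) (ξ : StrongDual ℝ E₁)
    (η : StrongDual ℝ E₂) (u₁ : 𝓓'(U₁, ℂ)) (u₂ : 𝓓'(U₂, ℂ)) :
    localFourier (tensor φ₁ φ₂) (ξ.coprod η) (tensorDist u₁ u₂) =
      localFourier φ₁ ξ u₁ * localFourier φ₂ η u₂ := by
  obtain ⟨χ₁, h₁, -⟩ := exists_cutoff (Ω := U₁) φ₁.hasCompactSupport.isCompact U₁.isOpen
    φ₁.tsupport_subset subset_rfl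
  obtain ⟨χ₂, h₂, -⟩ := exists_cutoff (Ω := U₂) φ₂.hasCompactSupport.isCompact U₂.isOpen
    φ₂.tsupport_subset subset_rfl
  have hs : tsupport (wave (tensor φ₁ φ₂) (ξ.coprod η)) ⊆ tsupport φ₁ ×ˢ tsupport φ₂ :=
    (tsupport_wave_subset _ _).trans (tsupport_tensor_subset _ _)
  rw [localFourier_eq_pair, pair_tensorDist u₁ u₂ (fun z hz => h₁ _ (hs hz).1)
    (fun z hz => h₂ _ (hs hz).2), tensorForm_eq]
  simp_rw [sliceFst_wave_tensor, cut_smul, pair_smul_left,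
    cut_eq_self h₁ (tsupport_wave_subset φ₁ ξ), ← mul_assoc]
  rw [integral_mul_const, ← mul_assoc, ← pair_cut, cut_eq_self h₂ (tsupport_wave_subset φ₂ η),
    mul_comm]
  rfl

theorem wave_zero_right {E : Type*} [NormedAddCommGroup E] [NormedSpace ℝ E] {Ω : Opens E}
    (f : 𝓓(Ω, ℝ)) : wave f 0 = complexify f := by
  ext x
  simp [wave_apply, complexify_apply, character]

theorem localFourier_zero_right {E : Type*} [NormedAddCommGroup E] [NormedSpace ℝ E] {Ω : Opens E}
    (f : 𝓓(Ω, ℝ)) (u : 𝓓'(Ω, ℂ)) : localFourier f 0 u = u f := by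
  rw [localFourier_eq_pair, wave_zero_right, pair_complexify]

theorem tensorDist_tensor (φ₁ : 𝓓(U₁, ℝ)) (φ₂ : 𝓓(U₂, ℝ)) (u₁ : 𝓓'(U₁, ℂ)) (u₂ : 𝓓'(U₂, ℂ)) :
    tensorDist u₁ u₂ (tensor φ₁ φ₂) = u₁ φ₁ * u₂ φ₂ := by
  have h := localFourier_tensorDist φ₁ φ₂ 0 0 u₁ u₂
  rwa [coprod_eq_zero_iff.2 ⟨rfl, rfl⟩, localFourier_zero_right, localFourier_zero_right,
    localFourier_zero_right] at h

end TensorDistribution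

/-! ### Domination by seminorms -/

section Domination

variable {M : Type*} [AddCommGroup M] [Module ℂ M]

/-- A function is dominated by a set of seminorms if it is bounded by a multiple of a finite sum of
seminorms of the set. -/
def Dominated (P : Set (ExtSeminorm M)) (q : M → ℝ≥0∞) : Prop :=
  ∃ (s : Finset (ExtSeminorm M)) (C : ℝ≥0∞), C ≠ ⊤ ∧ (s : Set (ExtSeminorm M)) ⊆ P ∧
    ∀ u, q u ≤ C * ∑ p ∈ s, p u

variable {P : Set (ExtSeminorm M)}

theorem dominated_of_mem {p : ExtSeminorm M} (hp : p ∈ P) : Dominated P p :=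
  ⟨{p}, 1, ENNReal.one_ne_top, by simpa using hp, fun u => by simp⟩

theorem dominated_zero : Dominated P fun _ => 0 :=
  ⟨∅, 1, ENNReal.one_ne_top, by simp, fun u => by simp⟩

theorem Dominated.mono {q q' : M → ℝ≥0∞} (h : Dominated P q) (hq : ∀ u, q' u ≤ q u) :
    Dominated P q' := by
  obtain ⟨s, C, hC, hs, H⟩ := h
  exact ⟨s, C, hC, hs, fun u => (hq u).trans (H u)⟩

theorem Dominated.const_mul {q : M → ℝ≥0∞} (h : Dominated P q) {c : ℝ≥0∞} (hc : c ≠ ⊤) :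
    Dominated P fun u => c * q u := by
  obtain ⟨s, C, hC, hs, H⟩ := h
  refine ⟨s, c * C, ENNReal.mul_ne_top hc hC, hs, fun u => ?_⟩
  rw [mul_assoc]
  exact mul_le_mul' le_rfl (H u)

theorem Dominated.add {q q' : M → ℝ≥0∞} (h : Dominated P q) (h' : Dominated P q') :
    Dominated P fun u => q u + q' u := by
  classical
  obtain ⟨s, C, hC, hs, H⟩ := h
  obtain ⟨s', C', hC', hs', H'⟩ := h'
  refine ⟨s ∪ s', C + C', ENNReal.add_ne_top.2 ⟨hC, hC'⟩, by simpa using ⟨hs, hs'⟩, fun u => ?_⟩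
  rw [add_mul]
  refine add_le_add ((H u).trans ?_) ((H' u).trans ?_)
  · exact mul_le_mul' le_rfl (Finset.sum_le_sum_of_subset Finset.subset_union_left)
  · exact mul_le_mul' le_rfl (Finset.sum_le_sum_of_subset Finset.subset_union_right)

theorem Dominated.lt_top {q : M → ℝ≥0∞} (h : Dominated P q) {u : M} (hu : ∀ p ∈ P, p u < ⊤) :
    q u < ⊤ := by
  obtain ⟨s, C, hC, hs, H⟩ := h
  refine (H u).trans_lt (ENNReal.mul_lt_top hC.lt_top ?_)
  exact ENNReal.sum_lt_top.2 fun p hp => hu p (hs hp)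

end Domination

/-! ### Integrals of localized Fourier transforms -/

section Symbols

variable {E : Type*} [NormedAddCommGroup E] [NormedSpace ℝ E] {Ω : Opens E}
  [MeasureSpace E] [FiniteDimensional ℝ E] [BorelSpace E] [(volume : Measure E).IsAddHaarMeasure]

/-- A set of functions of a covector with common bounds of polynomial growth, and of rapid decay
on `V`. -/
def RapidlyBounded (ℋ : Set (StrongDual ℝ E → ℂ)) (V : Set (StrongDual ℝ E)) : Prop :=
  (∃ (m : ℕ) (C : ℝ), 0 ≤ C ∧ ∀ h ∈ ℋ, ∀ ξ, ‖h ξ‖ ≤ C * (1 + ‖ξ‖) ^ m) ∧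
  ∀ n : ℕ, ∃ C : ℝ, 0 ≤ C ∧ ∀ h ∈ ℋ, ∀ ξ ∈ V, (1 + ‖ξ‖) ^ n * ‖h ξ‖ ≤ C

theorem NormallyBounded.rapidlyBounded {Γ : Set (E × StrongDual ℝ E)} {𝒰 : Set 𝓓'(Ω, ℂ)}
    (h : NormallyBounded Γ 𝒰) {χ : 𝓓(Ω, ℝ)} {V : Set (StrongDual ℝ E)}
    (hV : IsClosedCovectorCone V) (hd : Disjoint (tsupport χ ×ˢ V) Γ) :
    RapidlyBounded ((fun u ξ => localFourier χ ξ u) '' 𝒰) V := by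
  refine ⟨?_, fun n => ?_⟩
  · obtain ⟨m, C, hC, H⟩ := h.1.growth χ
    exact ⟨m, C, hC, forall_mem_image.2 H⟩
  · obtain ⟨C, H⟩ := h.2 χ V hV hd n
    exact ⟨|C|, abs_nonneg C, forall_mem_image.2 fun u hu ξ hξ =>
      (H u hu ξ hξ).trans (le_abs_self C)⟩

/-- Integrals of a localized Fourier transform against functions which decay rapidly outside of
`V` are dominated by the seminorms of the normal topology. -/
theorem dominated_integral {Γ : Set (E × StrongDual ℝ E)} {χ : 𝓓(Ω, ℝ)}
    {V : Set (StrongDual ℝ E)} (hV : IsClosedCovectorCone V)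
    (hd : Disjoint (tsupport χ ×ˢ V) Γ) {𝒢 : Set (StrongDual ℝ E → ℂ)}
    (h𝒢 : RapidlyBounded 𝒢 Vᶜ) : Dominated (normalSeminorms Ω Γ)
      fun u => ⨆ G ∈ 𝒢, ‖∫ η, localFourier χ η u * G η ∂dualHaar E‖ₑ := by
  obtain ⟨⟨m, C, hC, hgrow⟩, hrapid⟩ := h𝒢
  set d := decayExp E
  -- On `V` the integrand is bounded by a Fourier seminorm. Outside of `V` its value at `η` is the
  -- pairing of `u` with a wave of frequency `η`, multiplied by a rapidly decreasing factor. These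
  -- multiples of waves form a bounded set, so that a strong seminorm applies.
  let ι := {p : (StrongDual ℝ E → ℂ) × StrongDual ℝ E // p.1 ∈ 𝒢 ∧ p.2 ∉ V}
  let c : ι → ℂ := fun i => (((1 + ‖i.1.2‖) ^ d : ℝ) : ℂ) * i.1.1 i.1.2
  have hcn : ∀ i, ‖c i‖ = (1 + ‖i.1.2‖) ^ d * ‖i.1.1 i.1.2‖ := fun i => by
    rw [norm_mul, Complex.norm_of_nonneg (by positivity)]
  set B' : Set 𝓓(Ω, ℂ) := range fun i : ι => c i • modulate (complexify χ) i.1.2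
  have hB' : Bornology.IsVonNBounded ℝ B' := by
    refine isVonNBounded_smul_modulate (fun _ : ι => complexify χ) (fun i => i.1.2) c
      χ.hasCompactSupport.isCompact χ.tsupport_subset (fun _ => tsupport_complexify_subset χ)
      ((fourierBounded_singleton _).mono range_const_subset) fun M => ?_
    obtain ⟨A, -, hA⟩ := hrapid (M + d)
    refine ⟨A, fun i => ?_⟩
    rw [hcn]
    refine le_trans (le_of_eq ?_) (hA _ i.2.1 _ i.2.2)
    rw [pow_add]; ring
  set J := ∫⁻ η, ENNReal.ofReal (((1 + ‖η‖) ^ d)⁻¹) ∂dualHaar E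
  have hJ : J < ⊤ := (integrable_decay (E := E)).lintegral_lt_top
  refine Dominated.mono (((dominated_of_mem (p := fourierSeminorm (m + d) χ V)
    (Or.inr ⟨_, χ, V, hV, hd, rfl⟩)).const_mul (c := ENNReal.ofReal C) ENNReal.ofReal_ne_top).add
    (dominated_of_mem (p := strongSeminorm B') (Or.inl ⟨B', hB', rfl⟩))|>.const_mul hJ.ne)
    fun u => iSup₂_le fun G hG => ?_
  refine (enorm_integral_le_lintegral_enorm _).trans ?_
  rw [mul_comm J, ← lintegral_const_mul _ (by fun_prop)]
  refine lintegral_mono fun η => ?_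
  have hp : 0 < (1 + ‖η‖) ^ d := by positivity
  by_cases hη : η ∈ V
  · have h1 : ENNReal.ofReal ((1 + ‖η‖) ^ (m + d)) * ‖localFourier χ η u‖ₑ ≤
        fourierSeminorm (m + d) χ V u :=
      le_iSup (fun i : V => ENNReal.ofReal ((1 + ‖i.1‖) ^ (m + d)) * ‖localFourier χ i.1 u‖ₑ)
        ⟨η, hη⟩
    calc ‖localFourier χ η u * G η‖ₑ = ‖localFourier χ η u‖ₑ * ‖G η‖ₑ := enorm_mul _ _
      _ ≤ ‖localFourier χ η u‖ₑ * ENNReal.ofReal (C * (1 + ‖η‖) ^ m) := by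
        gcongr
        exact enorm_le_ofReal (hgrow G hG η)
      _ = ENNReal.ofReal C * (ENNReal.ofReal ((1 + ‖η‖) ^ (m + d)) * ‖localFourier χ η u‖ₑ) *
          ENNReal.ofReal (((1 + ‖η‖) ^ d)⁻¹) := by
        rw [ENNReal.ofReal_mul hC, show (1 + ‖η‖) ^ m = (1 + ‖η‖) ^ (m + d) * ((1 + ‖η‖) ^ d)⁻¹ by
          rw [pow_add, mul_inv_cancel_right₀ hp.ne'], ENNReal.ofReal_mul (by positivity)]
        ring
      _ ≤ _ := by
        gcongr
        exact (mul_le_mul_right h1 _).trans le_self_add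
  · have h1 : ‖c ⟨(G, η), hG, hη⟩ * localFourier χ η u‖ₑ ≤ strongSeminorm B' u := by
      have h2 := enorm_pair_le_strongSeminorm (B := B') ⟨⟨(G, η), hG, hη⟩, rfl⟩ u
      rwa [pair_smul_left] at h2
    calc ‖localFourier χ η u * G η‖ₑ
        = ‖c ⟨(G, η), hG, hη⟩ * localFourier χ η u‖ₑ * ENNReal.ofReal (((1 + ‖η‖) ^ d)⁻¹) := by
          rw [← ofReal_norm, ← ofReal_norm, ← ENNReal.ofReal_mul (norm_nonneg _), norm_mul,
            norm_mul, hcn]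
          congr 1
          field_simp
      _ ≤ _ := by
        gcongr
        exact h1.trans le_add_self

end Symbols

/-! ### Kernels on pairs of covectors -/

section Kernels

variable {E₁ : Type*} [NormedAddCommGroup E₁] [NormedSpace ℝ E₁]
  {E₂ : Type*} [NormedAddCommGroup E₂] [NormedSpace ℝ E₂]

/-- A set of kernels with common bounds of polynomial growth, and of rapid decay in the region
where each variable either lies outside of the given cone or is small with respect to the other
one. -/
def KernelBounded (𝒦 : Set (StrongDual ℝ E₁ → StrongDual ℝ E₂ → ℂ)) (V₁ : Set (StrongDual ℝ E₁))
    (V₂ : Set (StrongDual ℝ E₂)) (ε : ℝ) : Prop :=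
  (∃ (m : ℕ) (C : ℝ), 0 ≤ C ∧ ∀ k ∈ 𝒦, ∀ ξ η, ‖k ξ η‖ ≤ C * ((1 + ‖ξ‖) ^ m * (1 + ‖η‖) ^ m)) ∧
  ∀ n : ℕ, ∃ C : ℝ, 0 ≤ C ∧ ∀ k ∈ 𝒦, ∀ ξ η, (ξ ∉ V₁ ∨ ‖ξ‖ ≤ ε * ‖η‖) →
    (η ∉ V₂ ∨ ‖η‖ ≤ ε * ‖ξ‖) → (1 + ‖ξ‖) ^ n * (1 + ‖η‖) ^ n * ‖k ξ η‖ ≤ C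

theorem KernelBounded.flip {𝒦 : Set (StrongDual ℝ E₁ → StrongDual ℝ E₂ → ℂ)}
    {V₁ : Set (StrongDual ℝ E₁)} {V₂ : Set (StrongDual ℝ E₂)} {ε : ℝ}
    (h : KernelBounded 𝒦 V₁ V₂ ε) : KernelBounded ((fun k η ξ => k ξ η) '' 𝒦) V₂ V₁ ε := by
  obtain ⟨⟨m, C, hC, H⟩, hr⟩ := h
  refine ⟨⟨m, C, hC, forall_mem_image.2 fun k hk η ξ => ?_⟩, fun n => ?_⟩
  · rw [mul_comm ((1 + ‖η‖) ^ m)]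
    exact H k hk ξ η
  · obtain ⟨C, hC, H⟩ := hr n
    refine ⟨C, hC, forall_mem_image.2 fun k hk η ξ h1 h2 => ?_⟩
    rw [mul_comm ((1 + ‖η‖) ^ n)]
    exact H k hk ξ η h2 h1

variable [FiniteDimensional ℝ E₁]

/-- Partial integration of a kernel against functions which decay rapidly on `V₁`. -/
theorem KernelBounded.rapidlyBounded_integral
    {𝒦 : Set (StrongDual ℝ E₁ → StrongDual ℝ E₂ → ℂ)} {V₁ : Set (StrongDual ℝ E₁)}
    {V₂ : Set (StrongDual ℝ E₂)} {ε : ℝ} (hε : 0 < ε) (h𝒦 : KernelBounded 𝒦 V₁ V₂ ε)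
    {ℋ : Set (StrongDual ℝ E₁ → ℂ)} (hℋ : RapidlyBounded ℋ V₁) :
    RapidlyBounded {G | ∃ h ∈ ℋ, ∃ k ∈ 𝒦, G = fun η => ∫ ξ, h ξ * k ξ η ∂dualHaar E₁} V₂ᶜ := by
  obtain ⟨⟨mh, Ch, hCh, Hh⟩, Rh⟩ := hℋ
  obtain ⟨⟨mk, Ck, hCk, Hk⟩, Rk⟩ := h𝒦
  set d := decayExp E₁
  set J := ∫ ξ, ((1 + ‖ξ‖) ^ d)⁻¹ ∂dualHaar E₁
  have hJ : 0 ≤ J := integral_nonneg fun ξ => by positivity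
  -- The bound away from the region where the second variable lies in `V₂` and is not small.
  have hB : ∀ n : ℕ, ∃ C : ℝ, 0 ≤ C ∧ ∀ h ∈ ℋ, ∀ k ∈ 𝒦, ∀ ξ η, (η ∉ V₂ ∨ ‖η‖ ≤ ε * ‖ξ‖) →
      (1 + ‖ξ‖) ^ d * (1 + ‖η‖) ^ n * ‖h ξ * k ξ η‖ ≤ C := by
    intro n
    obtain ⟨C₁, hC₁, H₁⟩ := Rk (mh + d + n)
    obtain ⟨C₂, hC₂, H₂⟩ := Rh (n + mk + mk + d)
    refine ⟨max (Ch * C₁) ((1 + ε⁻¹) ^ (n + mk) * Ck * C₂), le_max_of_le_left (by positivity),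
      fun h hh k hk ξ η hη => ?_⟩
    have hξ1 : 1 ≤ 1 + ‖ξ‖ := by linarith [norm_nonneg ξ]
    have hη1 : 1 ≤ 1 + ‖η‖ := by linarith [norm_nonneg η]
    rw [norm_mul]
    by_cases hξ : ξ ∉ V₁ ∨ ‖ξ‖ ≤ ε * ‖η‖
    · refine le_trans ?_ (le_max_left _ _)
      calc _ ≤ (1 + ‖ξ‖) ^ d * (1 + ‖η‖) ^ (mh + d + n) * ((Ch * (1 + ‖ξ‖) ^ mh) * ‖k ξ η‖) := by
            gcongr
            · omega
            · exact Hh h hh ξ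
        _ = Ch * ((1 + ‖ξ‖) ^ (mh + d) * (1 + ‖η‖) ^ (mh + d + n) * ‖k ξ η‖) := by
            rw [pow_add _ mh d]; ring
        _ ≤ Ch * ((1 + ‖ξ‖) ^ (mh + d + n) * (1 + ‖η‖) ^ (mh + d + n) * ‖k ξ η‖) := by
            have := pow_le_pow_right₀ hξ1 (Nat.le_add_right (mh + d) n)
            gcongr ?_ * (?_ * _ * _)
        _ ≤ _ := by
            gcongr
            exact H₁ k hk ξ η hξ hη
    · refine le_trans ?_ (le_max_right _ _)
      push Not at hξ
      have h1 : 1 + ‖η‖ ≤ (1 + ε⁻¹) * (1 + ‖ξ‖) := by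
        have h2 : ‖η‖ ≤ ε⁻¹ * ‖ξ‖ := by
          rw [← div_eq_inv_mul, le_div_iff₀ hε, mul_comm]
          exact hξ.2.le
        nlinarith [norm_nonneg ξ, inv_pos.2 hε]
      calc _ ≤ (1 + ‖ξ‖) ^ d * (1 + ‖η‖) ^ n *
            (‖h ξ‖ * (Ck * ((1 + ‖ξ‖) ^ mk * (1 + ‖η‖) ^ mk))) := by
            gcongr
            exact Hk k hk ξ η
        _ = (1 + ‖η‖) ^ (n + mk) * (Ck * ((1 + ‖ξ‖) ^ (mk + d) * ‖h ξ‖)) := by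
            rw [pow_add, pow_add]; ring
        _ ≤ ((1 + ε⁻¹) * (1 + ‖ξ‖)) ^ (n + mk) * (Ck * ((1 + ‖ξ‖) ^ (mk + d) * ‖h ξ‖)) := by
            gcongr
        _ = (1 + ε⁻¹) ^ (n + mk) * Ck * ((1 + ‖ξ‖) ^ (n + mk + mk + d) * ‖h ξ‖) := by
            rw [mul_pow, pow_add _ mk d, pow_add _ (n + mk + mk) d, pow_add _ (n + mk) mk]; ring
        _ ≤ _ := by
            have := inv_pos.2 hε
            gcongr
            exact H₂ h hh ξ hξ.1
  have hint : ∀ h ∈ ℋ, ∀ k ∈ 𝒦, ∀ η, ∀ A : ℝ, (∀ ξ, (1 + ‖ξ‖) ^ d * ‖h ξ * k ξ η‖ ≤ A) →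
      ‖∫ ξ, h ξ * k ξ η ∂dualHaar E₁‖ ≤ A * J := by
    intro h _ k _ η A hA
    refine (norm_integral_le_of_norm_le ((integrable_decay (E := E₁)).const_mul A)
      (.of_forall fun ξ => ?_)).trans (le_of_eq (integral_const_mul _ _))
    rw [← div_eq_mul_inv, le_div_iff₀ (by positivity), mul_comm]
    exact hA ξ
  refine ⟨?_, fun n => ?_⟩
  · obtain ⟨C₀, hC₀, H₀⟩ := hB 0
    set m' := mh + mk + d + mk
    have hε' := inv_pos.2 hε
    refine ⟨m', (C₀ + Ch * Ck * (1 + ε⁻¹) ^ (mh + mk + d)) * J, by positivity, ?_⟩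
    rintro _ ⟨h, hh, k, hk, rfl⟩ η
    have hη1 : 1 ≤ 1 + ‖η‖ := by linarith [norm_nonneg η]
    rw [mul_right_comm]
    refine hint h hh k hk η _ fun ξ => ?_
    rw [add_mul]
    by_cases hη : η ∉ V₂ ∨ ‖η‖ ≤ ε * ‖ξ‖
    · have h1 := H₀ h hh k hk ξ η hη
      rw [pow_zero, mul_one] at h1
      refine h1.trans ((le_mul_of_one_le_right hC₀ (one_le_pow₀ hη1)).trans
        (le_add_of_nonneg_right (by positivity)))
    · push Not at hη
      refine le_trans ?_ (le_add_of_nonneg_left (by positivity))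
      have h1 : 1 + ‖ξ‖ ≤ (1 + ε⁻¹) * (1 + ‖η‖) := by
        have h2 : ‖ξ‖ ≤ ε⁻¹ * ‖η‖ := by
          rw [← div_eq_inv_mul, le_div_iff₀ hε, mul_comm]
          exact hη.2.le
        nlinarith [norm_nonneg η]
      rw [norm_mul]
      calc _ ≤ (1 + ‖ξ‖) ^ d *
            ((Ch * (1 + ‖ξ‖) ^ mh) * (Ck * ((1 + ‖ξ‖) ^ mk * (1 + ‖η‖) ^ mk))) := by
            gcongr
            · exact Hh h hh ξ
            · exact Hk k hk ξ η
        _ = Ch * Ck * (1 + ‖ξ‖) ^ (mh + mk + d) * (1 + ‖η‖) ^ mk := by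
            rw [pow_add, pow_add]; ring
        _ ≤ Ch * Ck * ((1 + ε⁻¹) * (1 + ‖η‖)) ^ (mh + mk + d) * (1 + ‖η‖) ^ mk := by gcongr
        _ = _ := by rw [mul_pow, pow_add _ (mh + mk + d) mk]; ring
  · obtain ⟨C, hC, H⟩ := hB n
    refine ⟨C * J, by positivity, ?_⟩
    rintro _ ⟨h, hh, k, hk, rfl⟩ η hη
    have hp : 0 < (1 + ‖η‖) ^ n := by positivity
    have h1 := hint h hh k hk η (C / (1 + ‖η‖) ^ n) fun ξ => by
      rw [le_div_iff₀ hp]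
      refine le_trans (le_of_eq ?_) (H h hh k hk ξ η (Or.inl hη))
      ring
    calc _ ≤ (1 + ‖η‖) ^ n * (C / (1 + ‖η‖) ^ n * J) := by gcongr
      _ = C * J := by field_simp

end Kernels

/-! ### Cones over a point of a product -/

section ConicGeometry

variable {E : Type*} [NormedAddCommGroup E] [NormedSpace ℝ E] {Ω : Opens E}

/-- The fiber of a cone over a point, with the origin added. -/
def fiberCone (Γ : Set (E × StrongDual ℝ E)) (x : E) : Set (StrongDual ℝ E) :=
  {ξ | ξ = 0 ∨ (x, ξ) ∈ Γ}

theorem zero_mem_fiberCone (Γ : Set (E × StrongDual ℝ E)) (x : E) : 0 ∈ fiberCone Γ x := Or.inl rfl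

theorem isClosed_fiberCone {Γ : Set (E × StrongDual ℝ E)} (hΓ : IsClosedCone Ω Γ) {x : E}
    (hx : x ∈ Ω) : IsClosed (fiberCone Γ x) := by
  have h : fiberCone Γ x = {0} ∪ Prod.mk x ⁻¹' closure Γ := by
    ext ξ
    refine ⟨fun h => h.imp id fun h => subset_closure h, fun h => ?_⟩
    by_cases h0 : ξ = 0
    · exact Or.inl h0
    · exact Or.inr (hΓ.closed _ (h.resolve_left h0) hx h0)
  rw [h]
  exact isClosed_singleton.union (isClosed_closure.preimage (Continuous.prodMk_right x))

theorem smul_fiberCone {Γ : Set (E × StrongDual ℝ E)} (hΓ : IsCone Ω Γ) (x : E) {t : ℝ}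
    (ht : 0 < t) {ξ : StrongDual ℝ E} (hξ : ξ ∈ fiberCone Γ x) : t • ξ ∈ fiberCone Γ x := by
  rcases hξ with rfl | h
  · exact Or.inl (smul_zero t)
  · exact Or.inr (hΓ.smul_mem _ h t ht)

theorem infDist_smul_fiberCone {Γ : Set (E × StrongDual ℝ E)} (hΓ : IsCone Ω Γ) (x : E) {t : ℝ}
    (ht : 0 < t) (ξ : StrongDual ℝ E) :
    Metric.infDist (t • ξ) (fiberCone Γ x) = t * Metric.infDist ξ (fiberCone Γ x) := by
  have h : ∀ (t : ℝ), 0 < t → ∀ ξ : StrongDual ℝ E,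
      Metric.infDist (t • ξ) (fiberCone Γ x) ≤ t * Metric.infDist ξ (fiberCone Γ x) := by
    intro t ht ξ
    rw [← div_le_iff₀' ht, Metric.le_infDist ⟨0, zero_mem_fiberCone Γ x⟩]
    intro η hη
    rw [div_le_iff₀' ht]
    refine (Metric.infDist_le_dist_of_mem (smul_fiberCone hΓ x ht hη)).trans (le_of_eq ?_)
    rw [dist_eq_norm, show t • ξ - t • η = t • (ξ - η) from (smul_sub t ξ η).symm,
      norm_smul, Real.norm_of_nonneg ht.le, dist_eq_norm]
  refine le_antisymm (h t ht ξ) ?_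
  have := h t⁻¹ (inv_pos.2 ht) (t • ξ)
  rwa [smul_smul, inv_mul_cancel₀ ht.ne', one_smul, ← div_eq_inv_mul, le_div_iff₀' ht] at this

/-- The covectors which are far from the fiber of a cone. -/
def farCone (Γ : Set (E × StrongDual ℝ E)) (x : E) (δ : ℝ) : Set (StrongDual ℝ E) :=
  {ξ | δ * ‖ξ‖ ≤ Metric.infDist ξ (fiberCone Γ x)}

theorem isClosedCovectorCone_farCone {Γ : Set (E × StrongDual ℝ E)} (hΓ : IsCone Ω Γ) (x : E)
    (δ : ℝ) : IsClosedCovectorCone (farCone Γ x δ) := by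
  refine ⟨isClosed_le (by fun_prop) (Metric.continuous_infDist_pt _), fun ξ hξ t ht => ?_⟩
  change δ * ‖t • ξ‖ ≤ _
  rw [infDist_smul_fiberCone hΓ x ht, norm_smul, Real.norm_of_nonneg ht.le, mul_left_comm]
  exact mul_le_mul_of_nonneg_left hξ ht.le

theorem notMem_of_mem_farCone {Γ : Set (E × StrongDual ℝ E)} (hΓ : IsCone Ω Γ) {x : E}
    {δ : ℝ} (hδ : 0 < δ) {ξ : StrongDual ℝ E} (hξ : ξ ∈ farCone Γ x δ) : (x, ξ) ∉ Γ := by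
  intro h
  have h1 : δ * ‖ξ‖ ≤ Metric.infDist ξ (fiberCone Γ x) := hξ
  have h0 : ξ ∈ fiberCone Γ x := Or.inr h
  rw [Metric.infDist_zero_of_mem h0] at h1
  have h2 : 0 < ‖ξ‖ := norm_pos_iff.2 (hΓ.subset _ h).2
  nlinarith

variable {E₁ : Type*} [NormedAddCommGroup E₁] [NormedSpace ℝ E₁]
  {E₂ : Type*} [NormedAddCommGroup E₂] [NormedSpace ℝ E₂]
  {U₁ : Opens E₁} {U₂ : Opens E₂}

theorem coprod_comp_inl_inr (ζ : StrongDual ℝ (E₁ × E₂)) :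
    (ζ.comp (.inl ℝ E₁ E₂)).coprod (ζ.comp (.inr ℝ E₁ E₂)) = ζ := by
  ext z <;> simp

/-- The covectors of a product whose opposites have components close to the fibers of two
cones. -/
def nearCone (Γ₁ : Set (E₁ × StrongDual ℝ E₁)) (Γ₂ : Set (E₂ × StrongDual ℝ E₂)) (x : E₁) (y : E₂)
    (δ : ℝ) : Set (StrongDual ℝ (E₁ × E₂)) :=
  {ζ | Metric.infDist (-(ζ.comp (.inl ℝ E₁ E₂))) (fiberCone Γ₁ x) ≤ δ * ‖ζ‖ ∧
    Metric.infDist (-(ζ.comp (.inr ℝ E₁ E₂))) (fiberCone Γ₂ y) ≤ δ * ‖ζ‖}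

theorem isClosedCovectorCone_nearCone {Γ₁ : Set (E₁ × StrongDual ℝ E₁)}
    {Γ₂ : Set (E₂ × StrongDual ℝ E₂)} (hΓ₁ : IsCone U₁ Γ₁) (hΓ₂ : IsCone U₂ Γ₂) (x : E₁) (y : E₂)
    (δ : ℝ) : IsClosedCovectorCone (nearCone Γ₁ Γ₂ x y δ) := by
  refine ⟨IsClosed.inter (isClosed_le ?_ (continuous_const.mul continuous_norm))
    (isClosed_le ?_ (continuous_const.mul continuous_norm)), fun ζ hζ t ht => ⟨?_, ?_⟩⟩
  · exact (Metric.continuous_infDist_pt _).comp (continuous_id.clm_comp continuous_const).neg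
  · exact (Metric.continuous_infDist_pt _).comp (continuous_id.clm_comp continuous_const).neg
  · rw [show -((t • ζ).comp (.inl ℝ E₁ E₂)) = t • -(ζ.comp (.inl ℝ E₁ E₂)) by ext z; simp,
      infDist_smul_fiberCone hΓ₁ x ht, norm_smul,
      Real.norm_of_nonneg ht.le, mul_left_comm]
    exact mul_le_mul_of_nonneg_left hζ.1 ht.le
  · rw [show -((t • ζ).comp (.inr ℝ E₁ E₂)) = t • -(ζ.comp (.inr ℝ E₁ E₂)) by ext z; simp,
      infDist_smul_fiberCone hΓ₂ y ht, norm_smul,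
      Real.norm_of_nonneg ht.le, mul_left_comm]
    exact mul_le_mul_of_nonneg_left hζ.2 ht.le

theorem neg_coprod_mem_nearCone {Γ₁ : Set (E₁ × StrongDual ℝ E₁)}
    {Γ₂ : Set (E₂ × StrongDual ℝ E₂)} {x : E₁} {y : E₂} {δ : ℝ} (hδ : 0 < δ)
    {ξ : StrongDual ℝ E₁} {η : StrongDual ℝ E₂} (hξ : ξ ∉ farCone Γ₁ x δ ∨ ‖ξ‖ ≤ δ * ‖η‖)
    (hη : η ∉ farCone Γ₂ y δ ∨ ‖η‖ ≤ δ * ‖ξ‖) : -(ξ.coprod η) ∈ nearCone Γ₁ Γ₂ x y δ := by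
  have h1 : -((-(ξ.coprod η)).comp (.inl ℝ E₁ E₂)) = ξ := by ext z; simp
  have h2 : -((-(ξ.coprod η)).comp (.inr ℝ E₁ E₂)) = η := by ext z; simp
  refine ⟨?_, ?_⟩
  · rw [h1, norm_neg]
    rcases hξ with h | h
    · exact (not_le.1 h).le.trans (by gcongr; exact norm_fst_le_norm_coprod ξ η)
    · refine (Metric.infDist_le_dist_of_mem (zero_mem_fiberCone Γ₁ x)).trans ?_
      rw [dist_zero_right]
      exact h.trans (by gcongr; exact norm_snd_le_norm_coprod ξ η)
  · rw [h2, norm_neg]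
    rcases hη with h | h
    · exact (not_le.1 h).le.trans (by gcongr; exact norm_snd_le_norm_coprod ξ η)
    · refine (Metric.infDist_le_dist_of_mem (zero_mem_fiberCone Γ₂ y)).trans ?_
      rw [dist_zero_right]
      exact h.trans (by gcongr; exact norm_fst_le_norm_coprod ξ η)

variable [FiniteDimensional ℝ E₁] [FiniteDimensional ℝ E₂]

/-- A closed cone disjoint from the opposite of the product cone does not contain covectors with
opposite components close to the two fibers, by compactness of the unit sphere. -/
theorem exists_nearCone_disjoint {Γ₁ : Set (E₁ × StrongDual ℝ E₁)}
    {Γ₂ : Set (E₂ × StrongDual ℝ E₂)} (hΓ₁ : IsClosedCone U₁ Γ₁) (hΓ₂ : IsClosedCone U₂ Γ₂)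
    {Λ : Set ((E₁ × E₂) × StrongDual ℝ (E₁ × E₂))} (hΛ : IsClosedCone (prodOpens U₁ U₂) Λ)
    (h : ∀ z ∈ Λ, (z.1, -z.2) ∉ dotProd U₁ U₂ Γ₁ Γ₂) {x : E₁} {y : E₂} (hx : x ∈ U₁)
    (hy : y ∈ U₂) : ∃ δ : ℝ, 0 < δ ∧ ∀ ζ ∈ nearCone Γ₁ Γ₂ x y δ, ((x, y), ζ) ∉ Λ := by
  have hS := isCompact_fiber_sphere hΛ (x := (x, y)) ⟨hx, hy⟩
  set S := {ζ : StrongDual ℝ (E₁ × E₂) | ((x, y), ζ) ∈ Λ ∧ ‖ζ‖ = 1}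
  let g : StrongDual ℝ (E₁ × E₂) → ℝ := fun ζ =>
    max (Metric.infDist (-(ζ.comp (.inl ℝ E₁ E₂))) (fiberCone Γ₁ x))
      (Metric.infDist (-(ζ.comp (.inr ℝ E₁ E₂))) (fiberCone Γ₂ y))
  have hg : Continuous g :=
    ((Metric.continuous_infDist_pt _).comp (continuous_id.clm_comp continuous_const).neg).max
      ((Metric.continuous_infDist_pt _).comp (continuous_id.clm_comp continuous_const).neg)
  have hpos : ∀ ζ ∈ S, 0 < g ζ := by
    intro ζ hζ
    by_contra hcon
    have h1 : Metric.infDist (-(ζ.comp (.inl ℝ E₁ E₂))) (fiberCone Γ₁ x) = 0 :=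
      le_antisymm ((le_max_left _ _).trans (not_lt.1 hcon)) Metric.infDist_nonneg
    have h2 : Metric.infDist (-(ζ.comp (.inr ℝ E₁ E₂))) (fiberCone Γ₂ y) = 0 :=
      le_antisymm ((le_max_right _ _).trans (not_lt.1 hcon)) Metric.infDist_nonneg
    rw [← (isClosed_fiberCone hΓ₁ hx).mem_iff_infDist_zero ⟨0, zero_mem_fiberCone _ _⟩] at h1
    rw [← (isClosed_fiberCone hΓ₂ hy).mem_iff_infDist_zero ⟨0, zero_mem_fiberCone _ _⟩] at h2
    have hz : -ζ = (-(ζ.comp (.inl ℝ E₁ E₂))).coprod (-(ζ.comp (.inr ℝ E₁ E₂))) := by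
      rw [← neg_coprod, coprod_comp_inl_inr]
    have hne : -ζ ≠ 0 := neg_ne_zero.2 (hΛ.subset _ hζ.1).2
    refine h _ hζ.1 ⟨x, _, y, _, congrArg (Prod.mk (x, y)) hz, ?_⟩
    rcases h1 with h1 | h1 <;> rcases h2 with h2 | h2
    · exact absurd (hz.trans (coprod_eq_zero_iff.2 ⟨h1, h2⟩)) hne
    · exact Or.inr (Or.inr ⟨hx, h1, h2⟩)
    · exact Or.inr (Or.inl ⟨h1, hy, h2⟩)
    · exact Or.inl ⟨h1, h2⟩
  obtain ⟨δ, hδ, hδS⟩ : ∃ δ : ℝ, 0 < δ ∧ ∀ ζ ∈ S, δ < g ζ := by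
    rcases S.eq_empty_or_nonempty with hE | hne
    · exact ⟨1, one_pos, fun ζ hζ => by simp [hE] at hζ⟩
    · obtain ⟨ζ, hζ, hmin⟩ := hS.exists_isMinOn hne hg.continuousOn
      exact ⟨g ζ / 2, half_pos (hpos ζ hζ), fun ζ' hζ' =>
        (half_lt_self (hpos ζ hζ)).trans_le (hmin hζ')⟩
  refine ⟨δ, hδ, fun ζ hζ hζΛ => ?_⟩
  have hp : 0 < ‖ζ‖ := norm_pos_iff.2 (hΛ.subset _ hζΛ).2
  have h1 := (isClosedCovectorCone_nearCone hΓ₁.toIsCone hΓ₂.toIsCone x y δ).2 ζ hζ _ (inv_pos.2 hp)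
  have hn : ‖‖ζ‖⁻¹ • ζ‖ = 1 := by rw [norm_smul, norm_inv, norm_norm, inv_mul_cancel₀ hp.ne']
  have h2 := hδS _ ⟨hΛ.smul_mem _ hζΛ _ (inv_pos.2 hp), hn⟩
  refine absurd h2 (not_lt.2 (max_le ?_ ?_))
  · simpa only [hn, mul_one] using h1.1
  · simpa only [hn, mul_one] using h1.2

end ConicGeometry

/-! ### The tensor product tested on dual bounded sets -/

section TensorEstimate

/-- Domination of suprema of pairings is a local property in the test functions. -/
theorem dominated_of_local {E : Type*} [NormedAddCommGroup E] [NormedSpace ℝ E] {Ω : Opens E}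
    [FiniteDimensional ℝ E] {M ι : Type*} [AddCommGroup M] [Module ℂ M] {P : Set (ExtSeminorm M)}
    (𝒰 : Set ι) (T : ι → M → 𝓓'(Ω, ℂ)) {K : Set E} (hK : IsCompact K) (hKΩ : K ⊆ Ω)
    {B : Set 𝓓(Ω, ℂ)} (hB : ∀ φ ∈ B, tsupport φ ⊆ K)
    (h : ∀ x ∈ Ω, ∃ O ∈ 𝓝 x, ∀ g : 𝓓(Ω, ℝ), tsupport g ⊆ O →
      Dominated P fun u => ⨆ i ∈ 𝒰, ⨆ φ ∈ B, ‖pair (cut g φ) (T i u)‖ₑ) :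
    Dominated P fun u => ⨆ i ∈ 𝒰, ⨆ φ ∈ B, ‖pair φ (T i u)‖ₑ := by
  obtain ⟨f, hf, -⟩ := exists_cutoff hK Ω.isOpen hKΩ subset_rfl
  have H : Dominated P fun u => ⨆ i ∈ 𝒰, ⨆ φ ∈ B, ‖pair (cut f φ) (T i u)‖ₑ := by
    refine local_induction (P := fun f => Dominated P fun u =>
      ⨆ i ∈ 𝒰, ⨆ φ ∈ B, ‖pair (cut f φ) (T i u)‖ₑ) ?_ ?_ f fun x hx => ?_
    · refine dominated_zero.mono fun u => iSup₂_le fun i _ => iSup₂_le fun φ _ => ?_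
      rw [cut_zero, show pair (0 : 𝓓(Ω, ℂ)) (T i u) = 0 from map_zero (pairLin (T i u)), enorm_zero]
    · refine fun f g hf hg => (hf.add hg).mono fun u => iSup₂_le fun i hi => iSup₂_le fun φ hφ => ?_
      rw [cut_add, pair_add_left]
      refine (enorm_add_le _ _).trans (add_le_add ?_ ?_)
      · exact le_iSup₂_of_le i hi (le_iSup₂_of_le φ hφ le_rfl)
      · exact le_iSup₂_of_le i hi (le_iSup₂_of_le φ hφ le_rfl)
    · obtain ⟨O, hO, HO⟩ := h x (f.tsupport_subset hx)
      exact ⟨O, hO, fun g hg _ => HO g hg⟩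
  refine H.mono fun u => iSup₂_mono fun i _ => iSup₂_mono fun φ hφ => ?_
  rw [cut_eq_self hf (hB φ hφ)]

variable {E₁ : Type*} [NormedAddCommGroup E₁] [NormedSpace ℝ E₁]
  {E₂ : Type*} [NormedAddCommGroup E₂] [NormedSpace ℝ E₂]
  {U₁ : Opens E₁} {U₂ : Opens E₂}
  [FiniteDimensional ℝ E₁] [MeasureSpace E₁] [BorelSpace E₁]
  [(volume : Measure E₁).IsAddHaarMeasure]
  [FiniteDimensional ℝ E₂] [MeasureSpace E₂] [BorelSpace E₂]
  [(volume : Measure E₂).IsAddHaarMeasure]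

/-- The Fourier transforms of the localizations of a bounded set of test functions, as kernels. -/
def ftKernels (g : 𝓓(prodOpens U₁ U₂, ℝ)) (B : Set 𝓓(prodOpens U₁ U₂, ℂ)) :
    Set (StrongDual ℝ E₁ → StrongDual ℝ E₂ → ℂ) :=
  (fun φ ξ η => ft (cut g φ) (-(ξ.coprod η))) '' B

/-- Near each point the frequency space of a product splits in such a way that the Fourier
transforms of a bounded set of test functions decay rapidly wherever those of the factors do not. -/
theorem exists_local_kernel {Γ₁ : Set (E₁ × StrongDual ℝ E₁)}
    {Γ₂ : Set (E₂ × StrongDual ℝ E₂)} (hΓ₁ : IsClosedCone U₁ Γ₁) (hΓ₂ : IsClosedCone U₂ Γ₂)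
    {Λ : Set ((E₁ × E₂) × StrongDual ℝ (E₁ × E₂))} (hΛ : IsClosedCone (prodOpens U₁ U₂) Λ)
    (h : ∀ z ∈ Λ, (z.1, -z.2) ∉ dotProd U₁ U₂ Γ₁ Γ₂)
    {K : Set (E₁ × E₂)} (hK : IsCompact K) (hKU : K ⊆ prodOpens U₁ U₂)
    {B : Set 𝓓(prodOpens U₁ U₂, ℂ)} (hBK : ∀ φ ∈ B, tsupport φ ⊆ K)
    (hB : NormallyBounded Λ (toDistribution '' B)) (z : E₁ × E₂) (hz : z ∈ prodOpens U₁ U₂) :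
    ∃ O ∈ 𝓝 z, ∀ g : 𝓓(prodOpens U₁ U₂, ℝ), tsupport g ⊆ O →
      ∃ (χ₁ : 𝓓(U₁, ℝ)) (χ₂ : 𝓓(U₂, ℝ)) (V₁ : Set (StrongDual ℝ E₁)) (V₂ : Set (StrongDual ℝ E₂))
        (ε : ℝ), (∀ z ∈ tsupport g, χ₁ z.1 = 1) ∧ (∀ z ∈ tsupport g, χ₂ z.2 = 1) ∧
        IsClosedCovectorCone V₁ ∧ IsClosedCovectorCone V₂ ∧ Disjoint (tsupport χ₁ ×ˢ V₁) Γ₁ ∧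
        Disjoint (tsupport χ₂ ×ˢ V₂) Γ₂ ∧ 0 < ε ∧ KernelBounded (ftKernels g B) V₁ V₂ ε := by
  obtain ⟨x, y⟩ := z
  obtain ⟨δ, hδ, hδΛ⟩ := exists_nearCone_disjoint hΓ₁ hΓ₂ hΛ h hz.1 hz.2
  have hV₁ := isClosedCovectorCone_farCone hΓ₁.toIsCone x δ
  have hV₂ := isClosedCovectorCone_farCone hΓ₂.toIsCone y δ
  have hVR := isClosedCovectorCone_nearCone hΓ₁.toIsCone hΓ₂.toIsCone x y δ
  obtain ⟨O, hO, hOΛ⟩ := exists_tube hΛ hz hVR hδΛ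
  obtain ⟨O₁, hO₁, hd₁⟩ := exists_tube hΓ₁ hz.1 hV₁ fun ξ hξ =>
    notMem_of_mem_farCone hΓ₁.toIsCone hδ hξ
  obtain ⟨O₂, hO₂, hd₂⟩ := exists_tube hΓ₂ hz.2 hV₂ fun ξ hξ =>
    notMem_of_mem_farCone hΓ₂.toIsCone hδ hξ
  refine ⟨O ∩ interior O₁ ×ˢ interior O₂, inter_mem hO (prod_mem_nhds (interior_mem_nhds.2 hO₁)
    (interior_mem_nhds.2 hO₂)), fun g hg => ?_⟩
  obtain ⟨χ₁, h₁, hs₁⟩ := exists_cutoff (Ω := U₁) (K := Prod.fst '' tsupport g)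
    (g.hasCompactSupport.isCompact.image continuous_fst)
    (isOpen_interior.inter U₁.isOpen) (O := interior O₁ ∩ U₁) (by
      rintro _ ⟨w, hw, rfl⟩
      exact ⟨(hg hw).2.1, (g.tsupport_subset hw).1⟩) inter_subset_right
  obtain ⟨χ₂, h₂, hs₂⟩ := exists_cutoff (Ω := U₂) (K := Prod.snd '' tsupport g)
    (g.hasCompactSupport.isCompact.image continuous_snd)
    (isOpen_interior.inter U₂.isOpen) (O := interior O₂ ∩ U₂) (by
      rintro _ ⟨w, hw, rfl⟩
      exact ⟨(hg hw).2.2, (g.tsupport_subset hw).2⟩) inter_subset_right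
  refine ⟨χ₁, χ₂, _, _, δ, fun w hw => h₁ _ ⟨w, hw, rfl⟩, fun w hw => h₂ _ ⟨w, hw, rfl⟩, hV₁, hV₂,
    hd₁.mono_left (prod_mono_left ((hs₁.trans inter_subset_left).trans interior_subset)),
    hd₂.mono_left (prod_mono_left ((hs₂.trans inter_subset_left).trans interior_subset)), hδ,
    ?_, fun n => ?_⟩
  · obtain ⟨m, A, hA, HA⟩ := exists_ft_growth hK hKU hBK hB.1
    obtain ⟨C, hC, HC⟩ := exists_ft_cut_bound g m
    refine ⟨m, C * A, by positivity, forall_mem_image.2 fun φ hφ ξ η => ?_⟩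
    refine ((HC φ A).2 (HA φ hφ) _).trans ?_
    rw [← mul_pow, norm_neg]
    gcongr
    nlinarith [norm_coprod_le ξ η, mul_nonneg (norm_nonneg ξ) (norm_nonneg η)]
  · obtain ⟨C, HC⟩ := hB.2 g _ hVR (hOΛ.mono_left (prod_mono_left (hg.trans inter_subset_left)))
      (n + n)
    refine ⟨|C|, abs_nonneg C, forall_mem_image.2 fun φ hφ ξ η hξ hη => ?_⟩
    have h3 := HC _ (mem_image_of_mem _ hφ) _ (neg_coprod_mem_nearCone hδ hξ hη)
    rw [localFourier_toDistribution] at h3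
    refine le_trans ?_ (h3.trans (le_abs_self C))
    rw [norm_neg, pow_add]
    gcongr
    · exact norm_fst_le_norm_coprod ξ η
    · exact norm_snd_le_norm_coprod ξ η

/-- The integral over the first covector is evaluated first: the result integrates the Fourier
transform of `χ₂ u₂` against a function of the second covector. -/
theorem tensorForm_eq_integral_snd (χ₁ : 𝓓(U₁, ℝ)) (χ₂ : 𝓓(U₂, ℝ)) (u₁ : 𝓓'(U₁, ℂ))
    (u₂ : 𝓓'(U₂, ℂ)) (φ : 𝓓(prodOpens U₁ U₂, ℂ)) : tensorForm χ₁ χ₂ u₁ u₂ φ =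
      invConst E₁ * invConst E₂ * ∫ η, localFourier χ₂ η u₂ *
        ∫ ξ, localFourier χ₁ ξ u₁ * ft φ (-(ξ.coprod η)) ∂dualHaar E₁ ∂dualHaar E₂ := by
  rw [tensorForm, integral_prod_symm _ (integrable_tensor_integrand χ₁ χ₂ u₁ u₂ φ)]
  congr 2
  ext η
  rw [← integral_const_mul]
  congr 1
  ext ξ
  ring

/-- The integral over the second covector is evaluated first. -/
theorem tensorForm_eq_integral_fst (χ₁ : 𝓓(U₁, ℝ)) (χ₂ : 𝓓(U₂, ℝ)) (u₁ : 𝓓'(U₁, ℂ))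
    (u₂ : 𝓓'(U₂, ℂ)) (φ : 𝓓(prodOpens U₁ U₂, ℂ)) : tensorForm χ₁ χ₂ u₁ u₂ φ =
      invConst E₁ * invConst E₂ * ∫ ξ, localFourier χ₁ ξ u₁ *
        ∫ η, localFourier χ₂ η u₂ * ft φ (-(ξ.coprod η)) ∂dualHaar E₂ ∂dualHaar E₁ := by
  rw [tensorForm, integral_prod _ (integrable_tensor_integrand χ₁ χ₂ u₁ u₂ φ)]
  simp_rw [← integral_const_mul, mul_assoc]

/-- The tensor products with the elements of a normally bounded set, tested on a bounded set of
test functions, are dominated by the seminorms of the normal topology in the second factor. -/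
theorem dominated_tensorDist_right {Γ₁ : Set (E₁ × StrongDual ℝ E₁)}
    {Γ₂ : Set (E₂ × StrongDual ℝ E₂)} (hΓ₁ : IsClosedCone U₁ Γ₁) (hΓ₂ : IsClosedCone U₂ Γ₂)
    {𝒰 : Set 𝓓'(U₁, ℂ)} (h𝒰 : NormallyBounded Γ₁ 𝒰) {B : Set 𝓓(prodOpens U₁ U₂, ℂ)}
    (hB : IsDualBounded (prodOpens U₁ U₂) (dotProd U₁ U₂ Γ₁ Γ₂) B) :
    Dominated (normalSeminorms U₂ Γ₂)
      fun u₂ => ⨆ u₁ ∈ 𝒰, ⨆ φ ∈ B, ‖pair φ (tensorDist u₁ u₂)‖ₑ := by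
  obtain ⟨⟨K, hK, hKU, hBK⟩, Λ, hΛ, hΛd, hBΛ⟩ := hB.normallyBounded
  refine dominated_of_local 𝒰 (fun u₁ u₂ => tensorDist u₁ u₂) hK hKU hBK fun z hz => ?_
  obtain ⟨O, hO, HO⟩ := exists_local_kernel hΓ₁ hΓ₂ hΛ hΛd hK hKU hBK hBΛ z hz
  refine ⟨O, hO, fun g hg => ?_⟩
  obtain ⟨χ₁, χ₂, V₁, V₂, ε, h₁, h₂, hV₁, hV₂, hd₁, hd₂, hε, hker⟩ := HO g hg
  have hQ := dominated_integral hV₂ hd₂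
    (hker.rapidlyBounded_integral hε (h𝒰.rapidlyBounded hV₁ hd₁))
  refine (hQ.const_mul (c := ‖invConst E₁ * invConst E₂‖ₑ) enorm_ne_top).mono fun u₂ =>
    iSup₂_le fun u₁ hu₁ => iSup₂_le fun φ hφ => ?_
  have hs := (tsupport_cut_subset g φ).trans inter_subset_left
  rw [pair_tensorDist u₁ u₂ (fun z hz => h₁ z (hs hz)) (fun z hz => h₂ z (hs hz)),
    tensorForm_eq_integral_snd, enorm_mul]
  have hG : (fun η : StrongDual ℝ E₂ =>
      ∫ ξ, localFourier χ₁ ξ u₁ * ft (cut g φ) (-(ξ.coprod η)) ∂dualHaar E₁) ∈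
      {G | ∃ h ∈ (fun u ξ => localFourier χ₁ ξ u) '' 𝒰, ∃ k ∈ ftKernels g B,
        G = fun η => ∫ ξ, h ξ * k ξ η ∂dualHaar E₁} :=
    ⟨_, mem_image_of_mem _ hu₁, _, mem_image_of_mem _ hφ, rfl⟩
  exact mul_le_mul_right (le_iSup₂ (f := fun (G : StrongDual ℝ E₂ → ℂ) (_ : G ∈ {G | ∃ h ∈
      (fun u ξ => localFourier χ₁ ξ u) '' 𝒰, ∃ k ∈ ftKernels g B, G = fun η =>
        ∫ ξ, h ξ * k ξ η ∂dualHaar E₁}) => ‖∫ η, localFourier χ₂ η u₂ * G η ∂dualHaar E₂‖ₑ) _ hG) _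

/-- The estimate of `dominated_tensorDist_right` with the factors exchanged. -/
theorem dominated_tensorDist_left {Γ₁ : Set (E₁ × StrongDual ℝ E₁)}
    {Γ₂ : Set (E₂ × StrongDual ℝ E₂)} (hΓ₁ : IsClosedCone U₁ Γ₁) (hΓ₂ : IsClosedCone U₂ Γ₂)
    {𝒰 : Set 𝓓'(U₂, ℂ)} (h𝒰 : NormallyBounded Γ₂ 𝒰) {B : Set 𝓓(prodOpens U₁ U₂, ℂ)}
    (hB : IsDualBounded (prodOpens U₁ U₂) (dotProd U₁ U₂ Γ₁ Γ₂) B) :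
    Dominated (normalSeminorms U₁ Γ₁)
      fun u₁ => ⨆ u₂ ∈ 𝒰, ⨆ φ ∈ B, ‖pair φ (tensorDist u₁ u₂)‖ₑ := by
  obtain ⟨⟨K, hK, hKU, hBK⟩, Λ, hΛ, hΛd, hBΛ⟩ := hB.normallyBounded
  refine dominated_of_local 𝒰 (fun u₂ u₁ => tensorDist u₁ u₂) hK hKU hBK fun z hz => ?_
  obtain ⟨O, hO, HO⟩ := exists_local_kernel hΓ₁ hΓ₂ hΛ hΛd hK hKU hBK hBΛ z hz
  refine ⟨O, hO, fun g hg => ?_⟩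
  obtain ⟨χ₁, χ₂, V₁, V₂, ε, h₁, h₂, hV₁, hV₂, hd₁, hd₂, hε, hker⟩ := HO g hg
  have hQ := dominated_integral hV₁ hd₁
    (hker.flip.rapidlyBounded_integral hε (h𝒰.rapidlyBounded hV₂ hd₂))
  refine (hQ.const_mul (c := ‖invConst E₁ * invConst E₂‖ₑ) enorm_ne_top).mono fun u₁ =>
    iSup₂_le fun u₂ hu₂ => iSup₂_le fun φ hφ => ?_
  have hs := (tsupport_cut_subset g φ).trans inter_subset_left
  rw [pair_tensorDist u₁ u₂ (fun z hz => h₁ z (hs hz)) (fun z hz => h₂ z (hs hz)),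
    tensorForm_eq_integral_fst, enorm_mul]
  have hG : (fun ξ : StrongDual ℝ E₁ =>
      ∫ η, localFourier χ₂ η u₂ * ft (cut g φ) (-(ξ.coprod η)) ∂dualHaar E₂) ∈
      {G | ∃ h ∈ (fun u η => localFourier χ₂ η u) '' 𝒰, ∃ k ∈ (fun k η ξ => k ξ η) '' ftKernels g B,
        G = fun ξ => ∫ η, h η * k η ξ ∂dualHaar E₂} :=
    ⟨_, mem_image_of_mem _ hu₂, _, mem_image_of_mem _ (mem_image_of_mem _ hφ), rfl⟩
  exact mul_le_mul_right (le_iSup₂ (f := fun (G : StrongDual ℝ E₁ → ℂ) (_ : G ∈ {G | ∃ h ∈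
      (fun u η => localFourier χ₂ η u) '' 𝒰, ∃ k ∈ (fun k η ξ => k ξ η) '' ftKernels g B,
        G = fun ξ => ∫ η, h η * k η ξ ∂dualHaar E₂}) =>
    ‖∫ ξ, localFourier χ₁ ξ u₁ * G ξ ∂dualHaar E₁‖ₑ) _ hG) _

end TensorEstimate

/-! ### Wave front sets of tensor products -/

section TensorSpace

variable {E₁ : Type*} [NormedAddCommGroup E₁] [NormedSpace ℝ E₁]
  {E₂ : Type*} [NormedAddCommGroup E₂] [NormedSpace ℝ E₂]
  {U₁ : Opens E₁} {U₂ : Opens E₂}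

theorem dotProd_mono {γ₁ Γ₁ : Set (E₁ × StrongDual ℝ E₁)} {γ₂ Γ₂ : Set (E₂ × StrongDual ℝ E₂)}
    (h₁ : Γ₁ ⊆ γ₁) (h₂ : Γ₂ ⊆ γ₂) : dotProd U₁ U₂ Γ₁ Γ₂ ⊆ dotProd U₁ U₂ γ₁ γ₂ := by
  rintro z ⟨x, ξ, y, η, rfl, h⟩
  exact ⟨x, ξ, y, η, rfl, h.imp (And.imp (@h₁ _) (@h₂ _))
    (Or.imp (And.imp_left (@h₁ _)) (And.imp_right (And.imp_right (@h₂ _))))⟩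

theorem IsDualBounded.mono_cone {E : Type*} [NormedAddCommGroup E] [NormedSpace ℝ E]
    {Ω : Opens E} [MeasureSpace E] [OpensMeasurableSpace E] {γ Γ : Set (E × StrongDual ℝ E)}
    (h : Γ ⊆ γ) {B : Set 𝓓(Ω, ℂ)} (hB : IsDualBounded Ω γ B) : IsDualBounded Ω Γ B := by
  obtain ⟨h1, Λ, h2, h3, h4⟩ := hB
  exact ⟨h1, Λ, h2, fun z hz hz' => h3 z hz (h hz'), h4⟩

variable [FiniteDimensional ℝ E₁] [MeasureSpace E₁] [BorelSpace E₁]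
  [(volume : Measure E₁).IsAddHaarMeasure]
  [FiniteDimensional ℝ E₂] [MeasureSpace E₂] [BorelSpace E₂]
  [(volume : Measure E₂).IsAddHaarMeasure]

theorem NormallyBounded.lt_top {Γ : Set (E₁ × StrongDual ℝ E₁)} {u : 𝓓'(U₁, ℂ)}
    (h : NormallyBounded Γ {u}) {p : ExtSeminorm 𝓓'(U₁, ℂ)} (hp : p ∈ normalSeminorms U₁ Γ) :
    p u < ⊤ := by
  simpa using normallyBounded_iff Γ _ |>.1 h p hp

/-- The tensor product is bounded on dual bounded sets, and this locates its wave front sets. -/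
theorem tensorDist_mem_fullSpace {γ₁ : Set (E₁ × StrongDual ℝ E₁)}
    {γ₂ : Set (E₂ × StrongDual ℝ E₂)} {u₁ : 𝓓'(U₁, ℂ)} {u₂ : 𝓓'(U₂, ℂ)}
    (h₁ : WF u₁ ⊆ γ₁) (h₂ : WF u₂ ⊆ γ₂) : tensorDist u₁ u₂ ∈ fullSpace U₁ U₂ γ₁ γ₂ := by
  have hc₁ : IsClosedCone U₁ (WF u₁) := WFset_singleton u₁ ▸ isClosedCone_WFset {u₁}
  have hc₂ : IsClosedCone U₂ (WF u₂) := WFset_singleton u₂ ▸ isClosedCone_WFset {u₂}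
  have hc := isCone_dotProd hc₁.toIsCone hc₂.toIsCone
  have H : ∀ B, IsDualBounded (prodOpens U₁ U₂) (dotProd U₁ U₂ (WF u₁) (WF u₂)) B →
      ∃ C : ℝ, ∀ φ ∈ B, ‖pair φ (tensorDist u₁ u₂)‖ ≤ C := by
    intro B hB
    have h := (dominated_tensorDist_right hc₁ hc₂ (normallyBounded_singleton u₁) hB).lt_top
      (u := u₂) fun p hp => (normallyBounded_singleton u₂).lt_top hp
    refine ⟨(⨆ u ∈ ({u₁} : Set _), ⨆ φ ∈ B, ‖pair φ (tensorDist u u₂)‖ₑ).toReal, fun φ hφ => ?_⟩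
    rw [← toReal_enorm]
    refine ENNReal.toReal_mono h.ne ?_
    rw [iSup_singleton]
    exact le_iSup₂ (f := fun φ (_ : φ ∈ B) => ‖pair φ (tensorDist u₁ u₂)‖ₑ) φ hφ
  exact ⟨(DWF_subset_of_bounded hc _ H).trans (dotProd_mono h₁ h₂),
    (WF_subset_closure_of_bounded hc _ H).trans (closure_mono (dotProd_mono h₁ h₂))⟩

end TensorSpace

/-! ### Products of Fourier transforms in the regions of `I_β` -/

section ExtraEstimate

variable {E : Type*} [NormedAddCommGroup E] [NormedSpace ℝ E] {Ω : Opens E}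
  [MeasureSpace E] [FiniteDimensional ℝ E] [BorelSpace E] [(volume : Measure E).IsAddHaarMeasure]
  {F : Type*} [NormedAddCommGroup F] [NormedSpace ℝ F] {Ω' : Opens F}
  [MeasureSpace F] [FiniteDimensional ℝ F] [BorelSpace F] [(volume : Measure F).IsAddHaarMeasure]

theorem one_add_add_le {a b D : ℝ} {k : ℕ} (ha : 0 ≤ a) (hD : 0 < D)
    (h : b ≤ D * a ^ k) : 1 + a + b ≤ (1 + D) * (1 + a) ^ (k + 1) := by
  have h1 : a ^ k ≤ (1 + a) ^ (k + 1) := (pow_le_pow_left₀ ha (by linarith) k).trans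
    (pow_le_pow_right₀ (by linarith) (Nat.le_succ k))
  have h2 : 1 + a ≤ (1 + a) ^ (k + 1) := le_self_pow₀ (by linarith) k.succ_ne_zero
  nlinarith [mul_le_mul_of_nonneg_left h1 hD.le]

/-- In the region where the first covector dominates and lies in a cone on which the first factor
decays rapidly, the second factor is only needed up to a strong seminorm. -/
theorem dominated_of_rapidOn {Γ : Set (F × StrongDual ℝ F)} {𝒰 : Set 𝓓'(Ω, ℂ)} {φ : 𝓓(Ω, ℝ)}
    {V : Set (StrongDual ℝ E)} (h𝒰 : RapidOn 𝒰 φ V) (ψ : 𝓓(Ω', ℝ)) {ι : Type*}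
    (u : ι → 𝓓'(Ω, ℂ)) (ξ : ι → StrongDual ℝ E) (η : ι → StrongDual ℝ F) {D : ℝ} (hD : 0 < D)
    (k l : ℕ) (hu : ∀ i, u i ∈ 𝒰) (hξ : ∀ i, ξ i ∈ V) (hη : ∀ i, ‖η i‖ ≤ D * ‖ξ i‖ ^ k) :
    Dominated (normalSeminorms Ω' Γ) fun v => ⨆ i, ENNReal.ofReal ((1 + ‖ξ i‖ + ‖η i‖) ^ l) *
      (‖localFourier φ (ξ i) (u i)‖ₑ * ‖localFourier ψ (η i) v‖ₑ) := by
  let c : ι → ℂ := fun i => (((1 + ‖ξ i‖ + ‖η i‖) ^ l : ℝ) : ℂ) * localFourier φ (ξ i) (u i)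
  have hcn : ∀ i, ‖c i‖ = (1 + ‖ξ i‖ + ‖η i‖) ^ l * ‖localFourier φ (ξ i) (u i)‖ := fun i => by
    rw [norm_mul, Complex.norm_of_nonneg (by positivity)]
  have hB : Bornology.IsVonNBounded ℝ (range fun i => c i • modulate (complexify ψ) (η i)) := by
    refine isVonNBounded_smul_modulate (fun _ => complexify ψ) η c
      ψ.hasCompactSupport.isCompact ψ.tsupport_subset (fun _ => tsupport_complexify_subset ψ)
      ((fourierBounded_singleton _).mono range_const_subset) fun M => ?_
    obtain ⟨C, HC⟩ := h𝒰 ((k + 1) * (l + M))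
    refine ⟨(1 + D) ^ (l + M) * C, fun i => ?_⟩
    calc ‖c i‖ * (1 + ‖η i‖) ^ M
        ≤ (1 + ‖ξ i‖ + ‖η i‖) ^ l * ‖localFourier φ (ξ i) (u i)‖ * (1 + ‖ξ i‖ + ‖η i‖) ^ M := by
          rw [hcn]
          gcongr
          linarith [norm_nonneg (ξ i)]
      _ = (1 + ‖ξ i‖ + ‖η i‖) ^ (l + M) * ‖localFourier φ (ξ i) (u i)‖ := by rw [pow_add]; ring
      _ ≤ ((1 + D) * (1 + ‖ξ i‖) ^ (k + 1)) ^ (l + M) * ‖localFourier φ (ξ i) (u i)‖ := by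
          gcongr
          exact one_add_add_le (norm_nonneg _) hD (hη i)
      _ = (1 + D) ^ (l + M) *
          ((1 + ‖ξ i‖) ^ ((k + 1) * (l + M)) * ‖localFourier φ (ξ i) (u i)‖) := by
          rw [mul_pow, ← pow_mul, mul_assoc]
      _ ≤ _ := by
          gcongr
          exact HC _ (hu i) _ (hξ i)
  refine (dominated_of_mem (p := strongSeminorm _) (Or.inl ⟨_, hB, rfl⟩)).mono fun v =>
    iSup_le fun i => ?_
  refine le_trans (le_of_eq ?_) (enorm_pair_le_strongSeminorm (mem_range_self i) v)
  rw [pair_smul_left, enorm_mul, ← mul_assoc]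
  congr 1
  rw [enorm_mul, ← ofReal_norm (((_ : ℝ) : ℂ)), Complex.norm_of_nonneg (by positivity)]

/-- In the region where the second covector dominates and lies in a cone avoiding `Γ`, the product
is controlled by a Fourier seminorm of the second factor. -/
theorem dominated_of_growth {Γ : Set (F × StrongDual ℝ F)} {𝒰 : Set 𝓓'(Ω, ℂ)}
    (h𝒰 : StronglyBounded 𝒰) (φ : 𝓓(Ω, ℝ)) {ψ : 𝓓(Ω', ℝ)} {V : Set (StrongDual ℝ F)}
    (hV : IsClosedCovectorCone V) (hd : Disjoint (tsupport ψ ×ˢ V) Γ) {ι : Type*}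
    (u : ι → 𝓓'(Ω, ℂ)) (ξ : ι → StrongDual ℝ E) (η : ι → StrongDual ℝ F) {D : ℝ} (hD : 0 < D)
    (k l : ℕ) (hu : ∀ i, u i ∈ 𝒰) (hη : ∀ i, η i ∈ V) (hξ : ∀ i, ‖ξ i‖ ≤ D * ‖η i‖ ^ k) :
    Dominated (normalSeminorms Ω' Γ) fun v => ⨆ i, ENNReal.ofReal ((1 + ‖ξ i‖ + ‖η i‖) ^ l) *
      (‖localFourier φ (ξ i) (u i)‖ₑ * ‖localFourier ψ (η i) v‖ₑ) := by
  obtain ⟨M, C, hC, HC⟩ := h𝒰.growth φ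
  refine ((dominated_of_mem (p := fourierSeminorm ((k + 1) * (l + M)) ψ V)
    (Or.inr ⟨_, ψ, V, hV, hd, rfl⟩)).const_mul
    (c := ENNReal.ofReal (C * (1 + D) ^ (l + M))) ENNReal.ofReal_ne_top).mono fun v =>
    iSup_le fun i => ?_
  have h1 : (1 + ‖ξ i‖ + ‖η i‖) ^ l * ‖localFourier φ (ξ i) (u i)‖ ≤
      C * (1 + D) ^ (l + M) * (1 + ‖η i‖) ^ ((k + 1) * (l + M)) := by
    calc (1 + ‖ξ i‖ + ‖η i‖) ^ l * ‖localFourier φ (ξ i) (u i)‖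
        ≤ (1 + ‖η i‖ + ‖ξ i‖) ^ l * (C * (1 + ‖η i‖ + ‖ξ i‖) ^ M) := by
          rw [add_right_comm]
          gcongr
          refine (HC _ (hu i) _).trans ?_
          gcongr
          linarith [norm_nonneg (η i)]
      _ = C * (1 + ‖η i‖ + ‖ξ i‖) ^ (l + M) := by rw [pow_add]; ring
      _ ≤ C * ((1 + D) * (1 + ‖η i‖) ^ (k + 1)) ^ (l + M) := by
          gcongr
          exact one_add_add_le (norm_nonneg _) hD (hξ i)
      _ = _ := by rw [mul_pow, ← pow_mul, mul_assoc]
  have h2 := ENNReal.ofReal_le_ofReal h1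
  rw [ENNReal.ofReal_mul (by positivity), ENNReal.ofReal_mul (by positivity),
    ofReal_norm] at h2
  rw [← mul_assoc]
  refine (mul_le_mul_left h2 _).trans ?_
  rw [mul_assoc]
  gcongr
  exact le_iSup (fun ζ : V => ENNReal.ofReal ((1 + ‖ζ.1‖) ^ ((k + 1) * (l + M))) *
    ‖localFourier ψ ζ.1 v‖ₑ) ⟨η i, hη i⟩

end ExtraEstimate

/-! ### The seminorms of `I_β` of tensor products -/

section BetaEstimate

variable {E₁ : Type*} [NormedAddCommGroup E₁] [NormedSpace ℝ E₁]
  {E₂ : Type*} [NormedAddCommGroup E₂] [NormedSpace ℝ E₂]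
  {U₁ : Opens E₁} {U₂ : Opens E₂}
  [FiniteDimensional ℝ E₁] [MeasureSpace E₁] [BorelSpace E₁]
  [(volume : Measure E₁).IsAddHaarMeasure]
  [FiniteDimensional ℝ E₂] [MeasureSpace E₂] [BorelSpace E₂]
  [(volume : Measure E₂).IsAddHaarMeasure]
  {γ₁ Γ₁ : Set (E₁ × StrongDual ℝ E₁)} {γ₂ Γ₂ : Set (E₂ × StrongDual ℝ E₂)}

theorem prodSeminorm_tensorDist_le {A : Set (StrongDual ℝ E₁ × StrongDual ℝ E₂)} {l : ℕ}
    {φ₁ : 𝓓(U₁, ℝ)} {φ₂ : 𝓓(U₂, ℝ)} {u₁ : 𝓓'(U₁, ℂ)} {u₂ : 𝓓'(U₂, ℂ)} {C : ℝ≥0∞}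
    (h : ∀ ζ : A, ENNReal.ofReal ((1 + ‖ζ.1.1‖ + ‖ζ.1.2‖) ^ l) *
      (‖localFourier φ₁ ζ.1.1 u₁‖ₑ * ‖localFourier φ₂ ζ.1.2 u₂‖ₑ) ≤ C) :
    prodSeminorm l A (tensor φ₁ φ₂) (tensorDist u₁ u₂) ≤ C := by
  refine iSup_le fun ζ => ?_
  rw [localFourier_tensorDist, enorm_mul]
  exact h ζ

/-- The seminorms of `I_β` of the tensor products with the elements of a normally bounded set are
dominated by the seminorms of the normal topology in the second factor. -/
theorem dominated_beta_right (h₁ : Γ₁ ⊆ γ₁) (h₂ : Γ₂ ⊆ γ₂) (hΓ₁ : IsClosedCone U₁ Γ₁)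
    (hΓ₂ : IsClosedCone U₂ Γ₂) {𝒰 : Set 𝓓'(U₁, ℂ)} (h𝒰 : NormallyBounded Γ₁ 𝒰)
    {p : ExtSeminorm 𝓓'(prodOpens U₁ U₂, ℂ)} (hp : p ∈ betaSeminorms U₁ U₂ γ₁ γ₂) :
    Dominated (normalSeminorms U₂ Γ₂) fun u₂ => ⨆ u₁ ∈ 𝒰, p (tensorDist u₁ u₂) := by
  rcases hp with ⟨B, hB, rfl⟩ | ⟨φ₁, φ₂, V₁, V₂, D, k, l, hV₁, hV₂, hd₁, hd₂, hD, -, rfl | rfl⟩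
  · refine (dominated_tensorDist_right hΓ₁ hΓ₂ h𝒰 (hB.mono_cone (dotProd_mono h₁ h₂))).mono
      fun u₂ => iSup₂_mono fun u₁ _ => iSup_le fun φ => ?_
    rw [one_mul]
    exact le_iSup₂_of_le (f := fun φ (_ : φ ∈ B) => ‖pair φ (tensorDist u₁ u₂)‖ₑ) φ.1 φ.2 le_rfl
  · let A : Set (StrongDual ℝ E₁ × StrongDual ℝ E₂) := region₁ D k ∩ univ ×ˢ V₂
    refine (dominated_of_growth h𝒰.1 φ₁ hV₂ (hd₂.mono_right h₂) (fun i : 𝒰 × A => i.1.1)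
      (fun i => i.2.1.1) (fun i => i.2.1.2) hD k l (fun i => i.1.2) (fun i => i.2.2.2.2)
      (fun i => i.2.2.1)).mono fun u₂ => iSup₂_le fun u₁ hu₁ =>
        prodSeminorm_tensorDist_le fun ζ => ?_
    exact le_iSup (fun i : 𝒰 × A => ENNReal.ofReal ((1 + ‖i.2.1.1‖ + ‖i.2.1.2‖) ^ l) *
      (‖localFourier φ₁ i.2.1.1 i.1.1‖ₑ * ‖localFourier φ₂ i.2.1.2 u₂‖ₑ)) (⟨u₁, hu₁⟩, ζ)
  · let A : Set (StrongDual ℝ E₁ × StrongDual ℝ E₂) := region₂ D k ∩ V₁ ×ˢ univ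
    refine (dominated_of_rapidOn (h𝒰.2 φ₁ V₁ hV₁ (hd₁.mono_right h₁)) φ₂
      (fun i : 𝒰 × A => i.1.1) (fun i => i.2.1.1) (fun i => i.2.1.2) hD k l (fun i => i.1.2)
      (fun i => i.2.2.2.1) (fun i => i.2.2.1)).mono fun u₂ => iSup₂_le fun u₁ hu₁ =>
        prodSeminorm_tensorDist_le fun ζ => ?_
    exact le_iSup (fun i : 𝒰 × A => ENNReal.ofReal ((1 + ‖i.2.1.1‖ + ‖i.2.1.2‖) ^ l) *
      (‖localFourier φ₁ i.2.1.1 i.1.1‖ₑ * ‖localFourier φ₂ i.2.1.2 u₂‖ₑ)) (⟨u₁, hu₁⟩, ζ)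

/-- The estimate of `dominated_beta_right` with the factors exchanged. -/
theorem dominated_beta_left (h₁ : Γ₁ ⊆ γ₁) (h₂ : Γ₂ ⊆ γ₂) (hΓ₁ : IsClosedCone U₁ Γ₁)
    (hΓ₂ : IsClosedCone U₂ Γ₂) {𝒰 : Set 𝓓'(U₂, ℂ)} (h𝒰 : NormallyBounded Γ₂ 𝒰)
    {p : ExtSeminorm 𝓓'(prodOpens U₁ U₂, ℂ)} (hp : p ∈ betaSeminorms U₁ U₂ γ₁ γ₂) :
    Dominated (normalSeminorms U₁ Γ₁) fun u₁ => ⨆ u₂ ∈ 𝒰, p (tensorDist u₁ u₂) := by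
  rcases hp with ⟨B, hB, rfl⟩ | ⟨φ₁, φ₂, V₁, V₂, D, k, l, hV₁, hV₂, hd₁, hd₂, hD, -, rfl | rfl⟩
  · refine (dominated_tensorDist_left hΓ₁ hΓ₂ h𝒰 (hB.mono_cone (dotProd_mono h₁ h₂))).mono
      fun u₁ => iSup₂_mono fun u₂ _ => iSup_le fun φ => ?_
    rw [one_mul]
    exact le_iSup₂_of_le (f := fun φ (_ : φ ∈ B) => ‖pair φ (tensorDist u₁ u₂)‖ₑ) φ.1 φ.2 le_rfl
  · let A : Set (StrongDual ℝ E₁ × StrongDual ℝ E₂) := region₁ D k ∩ univ ×ˢ V₂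
    refine (dominated_of_rapidOn (h𝒰.2 φ₂ V₂ hV₂ (hd₂.mono_right h₂)) φ₁
      (fun i : 𝒰 × A => i.1.1) (fun i => i.2.1.2) (fun i => i.2.1.1) hD k l (fun i => i.1.2)
      (fun i => i.2.2.2.2) (fun i => i.2.2.1)).mono fun u₁ => iSup₂_le fun u₂ hu₂ =>
        prodSeminorm_tensorDist_le fun ζ => ?_
    rw [add_right_comm, mul_comm ‖localFourier φ₁ _ _‖ₑ]
    exact le_iSup (fun i : 𝒰 × A => ENNReal.ofReal ((1 + ‖i.2.1.2‖ + ‖i.2.1.1‖) ^ l) *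
      (‖localFourier φ₂ i.2.1.2 i.1.1‖ₑ * ‖localFourier φ₁ i.2.1.1 u₁‖ₑ)) (⟨u₂, hu₂⟩, ζ)
  · let A : Set (StrongDual ℝ E₁ × StrongDual ℝ E₂) := region₂ D k ∩ V₁ ×ˢ univ
    refine (dominated_of_growth h𝒰.1 φ₂ hV₁ (hd₁.mono_right h₁) (fun i : 𝒰 × A => i.1.1)
      (fun i => i.2.1.2) (fun i => i.2.1.1) hD k l (fun i => i.1.2) (fun i => i.2.2.2.1)
      (fun i => i.2.2.1)).mono fun u₁ => iSup₂_le fun u₂ hu₂ =>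
        prodSeminorm_tensorDist_le fun ζ => ?_
    rw [add_right_comm, mul_comm ‖localFourier φ₁ _ _‖ₑ]
    exact le_iSup (fun i : 𝒰 × A => ENNReal.ofReal ((1 + ‖i.2.1.2‖ + ‖i.2.1.1‖) ^ l) *
      (‖localFourier φ₂ i.2.1.2 i.1.1‖ₑ * ‖localFourier φ₁ i.2.1.1 u₁‖ₑ)) (⟨u₂, hu₂⟩, ζ)

theorem tensorDist_mem_finitePart {u₁ : 𝓓'(U₁, ℂ)} {u₂ : 𝓓'(U₂, ℂ)} (h₁ : WF u₁ ⊆ γ₁)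
    (h₂ : WF u₂ ⊆ γ₂) :
    tensorDist u₁ u₂ ∈ ExtSeminorm.finitePart (betaSeminorms U₁ U₂ γ₁ γ₂) := by
  intro p hp
  have hc₁ : IsClosedCone U₁ (WF u₁) := WFset_singleton u₁ ▸ isClosedCone_WFset {u₁}
  have hc₂ : IsClosedCone U₂ (WF u₂) := WFset_singleton u₂ ▸ isClosedCone_WFset {u₂}
  simpa using (dominated_beta_right h₁ h₂ hc₁ hc₂ (normallyBounded_singleton u₁) hp).lt_top
    (u := u₂) fun q hq => (normallyBounded_singleton u₂).lt_top hq

end BetaEstimate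

/-! ### Continuity of dominated seminorms -/

section ExtSeminormTopology

variable {M : Type*} [AddCommGroup M] [Module ℂ M] {P : Set (ExtSeminorm M)}

theorem ExtSeminorm.nhds_eq (P : Set (ExtSeminorm M)) (u : M) :
    @nhds M (ExtSeminorm.uniformSpace P).toTopologicalSpace u =
      ⨅ p ∈ P, ⨅ ε > 0, 𝓟 {v | p (v - u) < ε} := by
  let := ExtSeminorm.uniformSpace P
  rw [nhds_eq_comap_uniformity, ExtSeminorm.uniformity_eq]
  simp only [comap_iInf, comap_principal]
  refine iInf_congr fun p => iInf_congr fun _ => iInf_congr fun ε => iInf_congr fun _ => ?_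
  congr 1
  ext v
  change p (u - v) < ε ↔ p (v - u) < ε
  rw [← p.map_neg, neg_sub]

theorem Dominated.tendsto {q : M → ℝ≥0∞} (h : Dominated P q) (u : M) :
    Tendsto (fun v => q (v - u)) (@nhds M (ExtSeminorm.uniformSpace P).toTopologicalSpace u)
      (𝓝 0) := by
  obtain ⟨s, C, hC, hs, H⟩ := h
  have hp : ∀ p ∈ s, Tendsto (fun v => p (v - u))
      (@nhds M (ExtSeminorm.uniformSpace P).toTopologicalSpace u) (𝓝 0) := by
    intro p hp
    refine ENNReal.tendsto_nhds_zero.2 fun ε hε => ?_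
    rw [ExtSeminorm.nhds_eq]
    refine mem_of_superset ?_ fun v (hv : p (v - u) < ε) => hv.le
    exact mem_iInf_of_mem p (mem_iInf_of_mem (hs hp) (mem_iInf_of_mem ε (mem_iInf_of_mem hε
      (mem_principal_self _))))
  have h1 := ENNReal.Tendsto.const_mul (tendsto_finsetSum s hp) (Or.inr hC)
  rw [Finset.sum_const_zero, mul_zero] at h1
  exact tendsto_of_tendsto_of_tendsto_of_le_of_le tendsto_const_nhds h1 (fun _ => zero_le)
    fun v => H (v - u)

/-- The supremum of an extended seminorm over a family of linear images. -/
def ExtSeminorm.iSupComp {N ι : Type*} [AddCommGroup N] [Module ℂ N] (p : ExtSeminorm N)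
    (S : Set ι) (L : ι → M →ₗ[ℂ] N) : ExtSeminorm M where
  toFun u := ⨆ i ∈ S, p (L i u)
  add_le u v := by
    refine iSup₂_le fun i hi => ?_
    rw [map_add]
    exact (p.add_le _ _).trans (add_le_add (le_iSup₂ (f := fun i (_ : i ∈ S) => p (L i u)) i hi)
      (le_iSup₂ (f := fun i (_ : i ∈ S) => p (L i v)) i hi))
  smul_eq c u := by
    simp_rw [ENNReal.mul_iSup, map_smul, p.smul_eq]

end ExtSeminormTopology

/-! ### Seminorms on the inductive limit -/

section InductiveLimit

variable {E : Type*} [NormedAddCommGroup E] [NormedSpace ℝ E] [FiniteDimensional ℝ E]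
  {Ω : Opens E} {γ : Set (E × StrongDual ℝ E)}

namespace SpaceIII

instance : IsTopologicalAddGroup (SpaceIII Ω γ) := topologicalAddGroup_sInf fun _ ht => ht.1

instance : ContinuousSMul ℂ (SpaceIII Ω γ) := continuousSMul_sInf fun _ ht => ht.2.1

theorem val_add (u v : SpaceIII Ω γ) : (u + v).val = u.val + v.val := rfl

theorem val_sub (u v : SpaceIII Ω γ) : (u - v).val = u.val - v.val := rfl

theorem val_smul (c : ℂ) (u : SpaceIII Ω γ) : (c • u).val = c • u.val := rfl

theorem real_smul_eq (r : ℝ) (u : SpaceIII Ω γ) : r • u = (r : ℂ) • u := by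
  refine Subtype.ext ?_
  change r • u.val = (r : ℂ) • u.val
  ext φ
  change r • u.val φ = (r : ℂ) • u.val φ
  simp

theorem tendsto_sub_nhds (u : SpaceIII Ω γ) :
    Tendsto (fun v : SpaceIII Ω γ => v - u) (𝓝 u) (𝓝 0) := by
  have h : Continuous fun v : SpaceIII Ω γ => v - u := continuous_id.sub continuous_const
  simpa using h.tendsto u

theorem WF_subset (u : SpaceIII Ω γ) : WF u.val ⊆ γ := u.2.2

variable [MeasureSpace E] [BorelSpace E] [(volume : Measure E).IsAddHaarMeasure]

theorem lt_top_of_dominated {q : ExtSeminorm 𝓓'(Ω, ℂ)}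
    (H : ∀ Γ ⊆ γ, IsClosedCone Ω Γ → Dominated (normalSeminorms Ω Γ) q) (u : SpaceIII Ω γ) :
    q u.val < ⊤ := by
  have hc : IsClosedCone Ω (WF u.val) := WFset_singleton u.val ▸ isClosedCone_WFset {u.val}
  exact (H _ u.WF_subset hc).lt_top fun p hp => (normallyBounded_singleton u.val).lt_top hp

/-- The finite part of an extended seminorm as a seminorm on the inductive limit. -/
def toSeminorm (q : ExtSeminorm 𝓓'(Ω, ℂ)) (hq : ∀ u : SpaceIII Ω γ, q u.val < ⊤) :
    Seminorm ℂ (SpaceIII Ω γ) :=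
  .of (fun u => (q u.val).toReal)
    (fun u v => by
      rw [← ENNReal.toReal_add (hq u).ne (hq v).ne]
      exact ENNReal.toReal_mono (ENNReal.add_ne_top.2 ⟨(hq u).ne, (hq v).ne⟩) (q.add_le _ _))
    (fun c u => by
      change (q (c • u.val)).toReal = _
      rw [q.smul_eq, ENNReal.toReal_mul, toReal_enorm])

/-- An extended seminorm which is continuous on each step of the inductive limit is continuous on
the inductive limit. -/
theorem tendsto_of_dominated {q : ExtSeminorm 𝓓'(Ω, ℂ)}
    (H : ∀ Γ ⊆ γ, IsClosedCone Ω Γ → Dominated (normalSeminorms Ω Γ) q) :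
    Tendsto (fun u : SpaceIII Ω γ => q u.val) (𝓝 0) (𝓝 0) := by
  have hq := lt_top_of_dominated H
  -- The topology of the single seminorm `q` is one of the locally convex topologies whose infimum
  -- defines the inductive limit.
  let s := toSeminorm q hq
  let S : SeminormedAddCommGroup (SpaceIII Ω γ) := s.toAddGroupSeminorm.toSeminormedAddCommGroup
  have hnorm : ∀ u : SpaceIII Ω γ, S.toNorm.norm u = (q u.val).toReal := fun u => rfl
  let t : TopologicalSpace (SpaceIII Ω γ) :=
    S.toPseudoMetricSpace.toUniformSpace.toTopologicalSpace
  have hC : @ContinuousSMul ℂ _ _ _ t := by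
    let N : @NormedSpace ℂ (SpaceIII Ω γ) _ S :=
      { toModule := inferInstance
        norm_smul_le := fun c u => (map_smul_eq_mul s c u).le }
    exact @IsBoundedSMul.continuousSMul ℂ (SpaceIII Ω γ) _ S.toPseudoMetricSpace _ _ _
      (@NormedSpace.toIsBoundedSMul ℂ (SpaceIII Ω γ) _ S N)
  have hR : @LocallyConvexSpace ℝ (SpaceIII Ω γ) _ _ _ _ t := by
    let N : @NormedSpace ℝ (SpaceIII Ω γ) _ S :=
      { toModule := inferInstance
        norm_smul_le := fun c u => by
          rw [real_smul_eq]
          exact (map_smul_eq_mul s (c : ℂ) u).le.trans (by rw [Complex.norm_real]; rfl) }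
    exact @NormedSpace.toLocallyConvexSpace (SpaceIII Ω γ) S N
  have hG : @IsTopologicalAddGroup _ t _ :=
    @SeminormedAddCommGroup.toIsTopologicalAddGroup (SpaceIII Ω γ) S
  have hI : ∀ (Γ : Set (E × StrongDual ℝ E)) (h : Γ ⊆ γ), IsClosedCone Ω Γ →
      @Continuous _ _ (normalTopology Ω Γ) t (incl Ω γ h) := by
    intro Γ h hΓ
    let := normalTopology Ω Γ
    refine continuous_iff_continuousAt.2 fun u => ?_
    refine (@tendsto_iff_norm_sub_tendsto_zero _ _ S _ _ _).2 ?_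
    have h1 : Tendsto (fun v : wfSpace Ω Γ Γ => q (v.1 - u.1)) (𝓝 u) (𝓝 0) := by
      refine ((H Γ h hΓ).tendsto u.1).comp ?_
      exact @Continuous.tendsto _ _ _ (ExtSeminorm.uniformSpace _).toTopologicalSpace _
        continuous_induced_dom u
    have h2 := (ENNReal.tendsto_toReal ENNReal.zero_ne_top).comp h1
    exact h2
  have hle : instTopologicalSpace Ω γ ≤ t :=
    @sInf_le (TopologicalSpace (SpaceIII Ω γ)) _ _ _ ⟨hG, hC, hR, hI⟩
  have h3 : Tendsto (fun u : SpaceIII Ω γ => (q u.val).toReal) (@nhds _ t 0) (𝓝 0) :=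
    @tendsto_norm_zero (SpaceIII Ω γ) S.toSeminormedAddGroup
  have h4 := (ENNReal.tendsto_ofReal h3).mono_left (nhds_mono hle)
  rw [ENNReal.ofReal_zero] at h4
  exact h4.congr fun u => ENNReal.ofReal_toReal (hq u).ne

/-- Continuous seminorms are bounded on compact sets. -/
theorem bddAbove_of_isCompact {q : ExtSeminorm 𝓓'(Ω, ℂ)}
    (H : ∀ Γ ⊆ γ, IsClosedCone Ω Γ → Dominated (normalSeminorms Ω Γ) q) {K : Set (SpaceIII Ω γ)}
    (hK : IsCompact K) : (⨆ u ∈ val '' K, q u) < ⊤ := by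
  rw [iSup_image]
  refine hK.induction_on (p := fun S => (⨆ u ∈ S, q u.val) < ⊤) (by simp)
    (fun s t hst ht => (biSup_mono hst).trans_lt ht) (fun s t hs ht => ?_) fun u _ => ?_
  · rw [iSup_union]
    exact max_lt hs ht
  · refine ⟨_, mem_nhdsWithin_of_mem_nhds
      (((tendsto_of_dominated H).comp u.tendsto_sub_nhds).eventually (gt_mem_nhds one_pos)), ?_⟩
    refine lt_of_le_of_lt (iSup₂_le fun v (hv : q (v - u).val < 1) => ?_)
      (ENNReal.add_lt_top.2 ⟨ENNReal.one_lt_top, lt_top_of_dominated H u⟩)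
    have h2 := q.add_le (v - u).val u.val
    rw [val_sub, sub_add_cancel] at h2
    exact h2.trans (by gcongr; exact hv.le)

theorem dominated_strongSeminorm {B : Set 𝓓(Ω, ℂ)} (hB : Bornology.IsVonNBounded ℝ B)
    (Γ : Set (E × StrongDual ℝ E)) : Dominated (normalSeminorms Ω Γ) (strongSeminorm B) :=
  dominated_of_mem (Or.inl ⟨B, hB, rfl⟩)

theorem stronglyBounded_of_isCompact {K : Set (SpaceIII Ω γ)} (hK : IsCompact K) :
    StronglyBounded (val '' K) := fun B hB =>
  (iSup_strongSeminorm_lt_top_iff B _).1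
    (bddAbove_of_isCompact (fun _ _ _ => dominated_strongSeminorm hB _) hK)

theorem continuous_pair_val (φ : 𝓓(Ω, ℂ)) : Continuous fun u : SpaceIII Ω γ => pair φ u.val := by
  let L : SpaceIII Ω γ →+ ℂ := AddMonoidHom.mk' (fun u => pair φ u.val) fun u v => by
    rw [val_add, map_add]
  refine continuous_of_continuousAt_zero L ?_
  have hB : Bornology.IsVonNBounded ℝ ({φ} : Set 𝓓(Ω, ℂ)) := Bornology.isVonNBounded_singleton φ
  have h1 := tendsto_of_dominated (γ := γ) fun Γ _ _ => dominated_strongSeminorm hB Γ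
  have h2 : Tendsto (fun u : SpaceIII Ω γ => ‖pair φ u.val‖ₑ) (𝓝 0) (𝓝 0) :=
    tendsto_of_tendsto_of_tendsto_of_le_of_le tendsto_const_nhds h1 (fun _ => zero_le)
      fun u => enorm_pair_le_strongSeminorm (mem_singleton φ) u.val
  have h3 := (ENNReal.tendsto_toReal ENNReal.zero_ne_top).comp h2
  change Tendsto _ _ _
  rw [map_zero]
  refine tendsto_zero_iff_norm_tendsto_zero.2 (h3.congr fun u => ?_)
  exact toReal_enorm _

end SpaceIII

end InductiveLimit

/-! ### Convex compact sets of the inductive limit -/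

section Baire

variable {E : Type*} [NormedAddCommGroup E] [NormedSpace ℝ E] [FiniteDimensional ℝ E]
  [MeasureSpace E] [BorelSpace E] [(volume : Measure E).IsAddHaarMeasure]
  {Ω : Opens E} {γ : Set (E × StrongDual ℝ E)}

/-- If a weighted Fourier transform is bounded at each point of a convex compact set, with a
cutoff, a weight and a cone taken from a countable list, then it is uniformly bounded for one member
of the list: this is Baire's theorem on the compact set. -/
theorem exists_uniform_bound {K : Set (SpaceIII Ω γ)} (hK : IsCompact K) (hKc : Convex ℝ K)
    (hne : K.Nonempty) (φ : ℕ → 𝓓(Ω, ℝ)) (V : ℕ → Set (StrongDual ℝ E)) (k : ℕ → ℕ)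
    (H : ∀ u ∈ K, ∃ (n : ℕ) (C : ℝ), ∀ ξ ∈ V n,
      (1 + ‖ξ‖) ^ k n * ‖localFourier (φ n) ξ u.val‖ ≤ C) :
    ∃ (n : ℕ) (C : ℝ), ∀ u ∈ K, ∀ ξ ∈ V n,
      (1 + ‖ξ‖) ^ k n * ‖localFourier (φ n) ξ u.val‖ ≤ C := by
  have := hne.to_subtype
  have := isCompact_iff_compactSpace.1 hK
  let A : ℕ × ℕ → Set K := fun i => {u | ∀ ξ ∈ V i.1,
    (1 + ‖ξ‖) ^ k i.1 * ‖localFourier (φ i.1) ξ u.1.val‖ ≤ i.2}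
  have hA : ∀ i, IsClosed (A i) := fun i => by
    simp only [A, ofPred_forall]
    refine isClosed_iInter fun ξ => isClosed_iInter fun _ => isClosed_le ?_ continuous_const
    exact continuous_const.mul ((SpaceIII.continuous_pair_val _).comp continuous_subtype_val).norm
  have hU : ⋃ i, A i = univ := by
    refine eq_univ_of_forall fun u => ?_
    obtain ⟨n, C, hC⟩ := H u.1 u.2
    obtain ⟨N, hN⟩ := exists_nat_ge C
    exact mem_iUnion.2 ⟨(n, N), fun ξ hξ => (hC ξ hξ).trans hN⟩
  -- The compact set `K` is a countable union of the closed sets `A i`, one of which has an interior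
  -- point `u₀` relative to `K`.
  obtain ⟨⟨n, N⟩, u₀, hu₀⟩ := nonempty_interior_of_iUnion_of_closed hA hU
  obtain ⟨O, hO, hOA⟩ := mem_nhds_subtype _ _ _ |>.1 (mem_interior_iff_mem_nhds.1 hu₀)
  -- The homothetic images of `K` with center `u₀` and a small ratio are in the neighborhood `O`.
  have ht : ∀ᶠ t : ℝ in 𝓝 0, ∀ u ∈ K, u₀.1 + (t : ℂ) • (u - u₀.1) ∈ O := by
    refine hK.eventually_forall_of_forall_eventually fun u _ => ?_
    have hc : Continuous fun z : ℝ × SpaceIII Ω γ => u₀.1 + (z.1 : ℂ) • (z.2 - u₀.1) :=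
      continuous_const.add ((Complex.continuous_ofReal.comp continuous_fst).smul
        (continuous_snd.sub continuous_const))
    refine hc.continuousAt.eventually_mem ?_
    simpa using hO
  obtain ⟨t, ⟨htO, ht1⟩, ht0⟩ := ((ht.and (gt_mem_nhds one_pos)).filter_mono
    nhdsWithin_le_nhds |>.and self_mem_nhdsWithin : ∀ᶠ t : ℝ in 𝓝[>] 0, _).exists
  have ht0 : 0 < t := ht0
  refine ⟨n, N + t⁻¹ * (N + N), fun u hu ξ hξ => ?_⟩
  have hw : u₀.1 + (t : ℂ) • (u - u₀.1) ∈ K := by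
    rw [← SpaceIII.real_smul_eq]
    exact hKc.add_smul_sub_mem u₀.2 hu ⟨ht0.le, ht1.le⟩
  have h0 := (interior_subset hu₀ : u₀ ∈ A (n, N)) ξ hξ
  have h1 := (hOA (show (⟨_, hw⟩ : K) ∈ _ from htO u hu) : _ ∈ A (n, N)) ξ hξ
  simp only at h0 h1
  set F : 𝓓'(Ω, ℂ) →ₗ[ℂ] ℂ := localFourier (φ n) ξ
  set a := (1 + ‖ξ‖) ^ k n
  have ha : 0 ≤ a := by positivity
  have h2 : F u.val = F u₀.1.val + (t : ℂ)⁻¹ *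
      (F (u₀.1 + (t : ℂ) • (u - u₀.1)).val - F u₀.1.val) := by
    have htc : (t : ℂ) ≠ 0 := by exact_mod_cast ht0.ne'
    rw [SpaceIII.val_add, SpaceIII.val_smul, SpaceIII.val_sub, map_add, map_smul, map_sub,
      smul_eq_mul]
    field_simp
    ring
  have h3 : ‖F u.val‖ ≤ ‖F u₀.1.val‖ + t⁻¹ *
      (‖F (u₀.1 + (t : ℂ) • (u - u₀.1)).val‖ + ‖F u₀.1.val‖) := by
    rw [h2]
    refine (norm_add_le _ _).trans ?_
    rw [norm_mul, norm_inv, Complex.norm_of_nonneg ht0.le]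
    gcongr
    exact norm_sub_le _ _
  calc a * ‖F u.val‖ ≤ a * (‖F u₀.1.val‖ + t⁻¹ *
      (‖F (u₀.1 + (t : ℂ) • (u - u₀.1)).val‖ + ‖F u₀.1.val‖)) := by gcongr
    _ = a * ‖F u₀.1.val‖ + t⁻¹ *
      (a * ‖F (u₀.1 + (t : ℂ) • (u - u₀.1)).val‖ + a * ‖F u₀.1.val‖) := by ring
    _ ≤ _ := by gcongr

/-- The wave front set of a convex compact set of the inductive limit is contained in the cone. With
`StronglyBounded.normallyBounded` this means that the compact set is bounded in one of the steps. -/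
theorem WFset_subset_of_isCompact {K : Set (SpaceIII Ω γ)} (hK : IsCompact K)
    (hKc : Convex ℝ K) : WFset (SpaceIII.val '' K) ⊆ γ := by
  rintro ⟨x, ξ⟩ ⟨hx, hξ, H⟩
  by_contra hz
  simp only at hx hξ H
  have hne : K.Nonempty := by
    by_contra hE
    rw [not_nonempty_iff_eq_empty] at hE
    refine H ⟨univ, univ_mem, univ, univ_mem, ⟨isClosed_univ, fun _ _ _ _ => mem_univ _⟩,
      fun φ _ k => ⟨0, ?_⟩⟩
    simp [hE]
  have hδ : ∀ n : ℕ, (0 : ℝ) < 1 / (n + 1) := fun n => Nat.one_div_pos_of_nat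
  -- Uniform rapid decay fails for each `n`, with one cutoff and one exponent that do not depend on
  -- the bound. Countably many choices suffice for all the elements of `K`.
  have H' : ∀ n : ℕ, ∃ (φ : 𝓓(Ω, ℝ)) (k : ℕ), tsupport φ ⊆ Metric.ball x (1 / (n + 1)) ∧
      ∀ C : ℝ, ¬ ∀ u ∈ K, ∀ ζ ∈ coneNhd ξ (1 / ((n : ℝ) + 1)),
        (1 + ‖ζ‖) ^ k * ‖localFourier φ ζ u.val‖ ≤ C := by
    intro n
    by_contra! hcon
    refine H ⟨_, Metric.ball_mem_nhds x (hδ n), _, coneNhd_mem_nhds hξ (hδ n),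
      isClosedCovectorCone_coneNhd _ _, fun φ hφ k => ?_⟩
    obtain ⟨C, hC⟩ := hcon φ k hφ
    exact ⟨C, forall_mem_image.2 hC⟩
  choose φ k hφ hk using H'
  have hpt : ∀ u ∈ K, ∃ (n : ℕ) (C : ℝ), ∀ ζ ∈ coneNhd ξ (1 / ((n : ℝ) + 1)),
      (1 + ‖ζ‖) ^ k n * ‖localFourier (φ n) ζ u.val‖ ≤ C := by
    intro u _
    have hu : ¬ (x, ξ) ∈ WF u.val := fun h => hz (u.WF_subset h)
    simp only [WF, mem_ofPred_eq, not_and, not_not] at hu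
    obtain ⟨O, hO, V, hV, hVc, HV⟩ := hu hx hξ
    obtain ⟨r, hr, hrO⟩ := Metric.mem_nhds_iff.1 hO
    obtain ⟨δ, hδ0, hδV⟩ := exists_coneNhd_subset hξ hV hVc.2
    obtain ⟨n, hn⟩ := exists_nat_one_div_lt (lt_min hr hδ0)
    obtain ⟨C, hC⟩ := HV (φ n) ((hφ n).trans ((Metric.ball_subset_ball
      (hn.le.trans (min_le_left _ _))).trans hrO)) (k n)
    refine ⟨n, max C ‖localFourier (φ n) 0 u.val‖, fun ζ hζ => ?_⟩
    rcases eq_or_ne ζ 0 with rfl | h0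
    · simp
    · exact (hC ζ (hδV ζ (coneNhd_mono (hn.le.trans (min_le_right _ _)) hζ) h0)).trans
        (le_max_left _ _)
  obtain ⟨n, C, hC⟩ := exists_uniform_bound hK hKc hne φ _ k hpt
  exact hk n C hC

end Baire

/-! ### Hypocontinuity of the tensor product -/

section Hypocontinuity

variable {E₁ : Type*} [NormedAddCommGroup E₁] [NormedSpace ℝ E₁]
  {E₂ : Type*} [NormedAddCommGroup E₂] [NormedSpace ℝ E₂]
  {U₁ : Opens E₁} {U₂ : Opens E₂}
  [FiniteDimensional ℝ E₁] [MeasureSpace E₁] [BorelSpace E₁]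
  [(volume : Measure E₁).IsAddHaarMeasure]
  [FiniteDimensional ℝ E₂] [MeasureSpace E₂] [BorelSpace E₂]
  [(volume : Measure E₂).IsAddHaarMeasure]
  {γ₁ Γ₁ : Set (E₁ × StrongDual ℝ E₁)} {γ₂ Γ₂ : Set (E₂ × StrongDual ℝ E₂)}

/-- The tensor product as a bilinear map between spaces of distributions. -/
def tensorBilin : 𝓓'(U₁, ℂ) →ₗ[ℂ] 𝓓'(U₂, ℂ) →ₗ[ℂ] 𝓓'(prodOpens U₁ U₂, ℂ) :=
  LinearMap.mk₂ ℂ tensorDist tensorDist_add_left tensorDist_smul_left tensorDist_add_right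
    tensorDist_smul_right

theorem tendsto_iSup_tensor_right (h₁ : Γ₁ ⊆ γ₁) (hΓ₁ : IsClosedCone U₁ Γ₁) {𝒰 : Set 𝓓'(U₁, ℂ)}
    (h𝒰 : NormallyBounded Γ₁ 𝒰) {p : ExtSeminorm 𝓓'(prodOpens U₁ U₂, ℂ)}
    (hp : p ∈ betaSeminorms U₁ U₂ γ₁ γ₂) :
    Tendsto (fun u₂ : SpaceIII U₂ γ₂ => ⨆ u₁ ∈ 𝒰, p (tensorDist u₁ u₂.val)) (𝓝 0) (𝓝 0) :=
  SpaceIII.tendsto_of_dominated (q := p.iSupComp 𝒰 fun u₁ => tensorBilin u₁) fun _ h₂ hΓ₂ =>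
    dominated_beta_right h₁ h₂ hΓ₁ hΓ₂ h𝒰 hp

theorem tendsto_iSup_tensor_left (h₂ : Γ₂ ⊆ γ₂) (hΓ₂ : IsClosedCone U₂ Γ₂) {𝒰 : Set 𝓓'(U₂, ℂ)}
    (h𝒰 : NormallyBounded Γ₂ 𝒰) {p : ExtSeminorm 𝓓'(prodOpens U₁ U₂, ℂ)}
    (hp : p ∈ betaSeminorms U₁ U₂ γ₁ γ₂) :
    Tendsto (fun u₁ : SpaceIII U₁ γ₁ => ⨆ u₂ ∈ 𝒰, p (tensorDist u₁.val u₂)) (𝓝 0) (𝓝 0) :=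
  SpaceIII.tendsto_of_dominated (q := p.iSupComp 𝒰 fun u₂ => tensorBilin.flip u₂) fun _ h₁ hΓ₁ =>
    dominated_beta_left h₁ h₂ hΓ₁ hΓ₂ h𝒰 hp

/-- Convergence in the space with the topology `I_β` is convergence for each of the seminorms. -/
theorem Beta.tendsto_nhds {ι : Type*} {l : Filter ι} {f : ι → Beta U₁ U₂ γ₁ γ₂}
    {b : Beta U₁ U₂ γ₁ γ₂} (h : ∀ p ∈ betaSeminorms U₁ U₂ γ₁ γ₂,
      Tendsto (fun i => p ((f i).val - b.val)) l (𝓝 0)) : Tendsto f l (𝓝 b) := by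
  have hn : 𝓝 b = comap Beta.val (@nhds _ (ExtSeminorm.uniformSpace
      (betaSeminorms U₁ U₂ γ₁ γ₂)).toTopologicalSpace b.val) :=
    @nhds_induced _ _ (ExtSeminorm.uniformSpace _).toTopologicalSpace Beta.val b
  rw [hn, tendsto_comap_iff, ExtSeminorm.nhds_eq]
  simp only [tendsto_iInf, tendsto_principal]
  exact fun p hp ε hε => (h p hp).eventually (gt_mem_nhds hε)

/-- The tensor product on the inductive limits. -/
def tensorMap : SpaceIII U₁ γ₁ →ₗ[ℂ] SpaceIII U₂ γ₂ →ₗ[ℂ] Beta U₁ U₂ γ₁ γ₂ :=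
  LinearMap.mk₂ ℂ (fun u₁ u₂ => ⟨tensorDist u₁.val u₂.val,
      tensorDist_mem_fullSpace u₁.WF_subset u₂.WF_subset,
      fun p hp => tensorDist_mem_finitePart u₁.WF_subset u₂.WF_subset p (Or.inr hp)⟩)
    (fun _ _ _ => Subtype.ext (tensorDist_add_left _ _ _))
    (fun _ _ _ => Subtype.ext (tensorDist_smul_left _ _ _))
    (fun _ _ _ => Subtype.ext (tensorDist_add_right _ _ _))
    (fun _ _ _ => Subtype.ext (tensorDist_smul_right _ _ _))

theorem continuous_tensorMap_right (u₁ : SpaceIII U₁ γ₁) :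
    Continuous fun u₂ : SpaceIII U₂ γ₂ => (tensorMap u₁ u₂ : Beta U₁ U₂ γ₁ γ₂) := by
  refine continuous_iff_continuousAt.2 fun v => Beta.tendsto_nhds fun p hp => ?_
  have hc : IsClosedCone U₁ (WF u₁.val) := WFset_singleton u₁.val ▸ isClosedCone_WFset {u₁.val}
  have h := (tendsto_iSup_tensor_right (γ₂ := γ₂) u₁.WF_subset hc
    (normallyBounded_singleton u₁.val) hp).comp v.tendsto_sub_nhds
  refine h.congr fun u₂ => ?_
  change (⨆ w ∈ ({u₁.val} : Set _), p (tensorBilin w (u₂.val - v.val))) = _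
  rw [iSup_singleton, map_sub]
  rfl

theorem continuous_tensorMap_left (u₂ : SpaceIII U₂ γ₂) :
    Continuous fun u₁ : SpaceIII U₁ γ₁ => (tensorMap u₁ u₂ : Beta U₁ U₂ γ₁ γ₂) := by
  refine continuous_iff_continuousAt.2 fun v => Beta.tendsto_nhds fun p hp => ?_
  have hc : IsClosedCone U₂ (WF u₂.val) := WFset_singleton u₂.val ▸ isClosedCone_WFset {u₂.val}
  have h := (tendsto_iSup_tensor_left (γ₁ := γ₁) u₂.WF_subset hc
    (normallyBounded_singleton u₂.val) hp).comp v.tendsto_sub_nhds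
  refine h.congr fun u₁ => ?_
  change (⨆ w ∈ ({u₂.val} : Set _), p (tensorBilin.flip w (u₁.val - v.val))) = _
  rw [iSup_singleton, map_sub]
  rfl

/-- Equicontinuity of a family of maps at `0` from uniform convergence. -/
theorem exists_nhds_forall_mem {X Y Z : Type*} [TopologicalSpace Y] [Zero Y] [TopologicalSpace Z]
    [Zero Z] {T : X → Y → Z} {K : Set X}
    (h : Tendsto (fun z : X × Y => T z.1 z.2) (𝓟 K ×ˢ 𝓝 0) (𝓝 0)) {W : Set Z}
    (hW : W ∈ 𝓝 (0 : Z)) : ∃ V ∈ 𝓝 (0 : Y), ∀ x ∈ K, ∀ y ∈ V, T x y ∈ W := by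
  obtain ⟨s, hs, V, hV, hsV⟩ := mem_prod_iff.1 (h hW)
  exact ⟨V, hV, fun x hx y hy => hsV (mk_mem_prod (hs hx) hy)⟩

/-- An absolutely convex compact set is normally bounded for its wave front set, which lies in the
cone. So the tensor products with its elements tend to zero uniformly for each seminorm of `I_β`. -/
theorem gammaHypocontinuous_tensorMap :
    GammaHypocontinuous
      (tensorMap : SpaceIII U₁ γ₁ →ₗ[ℂ] SpaceIII U₂ γ₂ →ₗ[ℂ] Beta U₁ U₂ γ₁ γ₂) := by
  refine ⟨continuous_tensorMap_right, continuous_tensorMap_left, fun K hK hKc W hW => ?_,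
    fun K hK hKc W hW => ?_⟩
  · refine exists_nhds_forall_mem (T := fun u₁ u₂ => tensorMap u₁ u₂)
      (Beta.tendsto_nhds fun p hp => ?_) hW
    have h := (tendsto_iSup_tensor_right (γ₂ := γ₂) (WFset_subset_of_isCompact hK hKc.2)
      (isClosedCone_WFset _) (SpaceIII.stronglyBounded_of_isCompact hK).normallyBounded hp).comp
      (tendsto_snd (f := 𝓟 K))
    refine tendsto_of_tendsto_of_tendsto_of_le_of_le' tendsto_const_nhds h
      (.of_forall fun _ => zero_le) ?_
    filter_upwards [(eventually_principal.2 fun u hu => hu : ∀ᶠ u in 𝓟 K, u ∈ K).prod_inl _]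
      with z hz
    change p (tensorDist z.1.val z.2.val - 0) ≤ _
    rw [sub_zero]
    exact le_iSup₂ (f := fun w (_ : w ∈ SpaceIII.val '' K) => p (tensorDist w z.2.val)) _
      (mem_image_of_mem _ hz)
  · refine exists_nhds_forall_mem (T := fun u₂ u₁ => tensorMap u₁ u₂)
      (Beta.tendsto_nhds fun p hp => ?_) hW
    have h := (tendsto_iSup_tensor_left (γ₁ := γ₁) (WFset_subset_of_isCompact hK hKc.2)
      (isClosedCone_WFset _) (SpaceIII.stronglyBounded_of_isCompact hK).normallyBounded hp).comp
      (tendsto_snd (f := 𝓟 K))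
    refine tendsto_of_tendsto_of_tendsto_of_le_of_le' tendsto_const_nhds h
      (.of_forall fun _ => zero_le) ?_
    filter_upwards [(eventually_principal.2 fun u hu => hu : ∀ᶠ u in 𝓟 K, u ∈ K).prod_inl _]
      with z hz
    change p (tensorDist z.2.val z.1.val - 0) ≤ _
    rw [sub_zero]
    exact le_iSup₂ (f := fun w (_ : w ∈ SpaceIII.val '' K) => p (tensorDist z.2.val w)) _
      (mem_image_of_mem _ hz)

end Hypocontinuity

end GenHormander

end

theorem proposition2p3 (d₁ d₂ : ℕ)
    (U₁ : TopologicalSpace.Opens (EuclideanSpace ℝ (Fin d₁)))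
    (U₂ : TopologicalSpace.Opens (EuclideanSpace ℝ (Fin d₂)))
    (γ₁ : Set (EuclideanSpace ℝ (Fin d₁) × StrongDual ℝ (EuclideanSpace ℝ (Fin d₁))))
    (γ₂ : Set (EuclideanSpace ℝ (Fin d₂) × StrongDual ℝ (EuclideanSpace ℝ (Fin d₂))))
    (hγ₁ : GenHormander.IsCone U₁ γ₁) (hγ₂ : GenHormander.IsCone U₂ γ₂) :
    CompleteSpace (GenHormander.FullBeta U₁ U₂ γ₁ γ₂) ∧
    CompleteSpace (GenHormander.Beta U₁ U₂ γ₁ γ₂) ∧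
    ∃ T : GenHormander.SpaceIII U₁ γ₁ →ₗ[ℂ] GenHormander.SpaceIII U₂ γ₂ →ₗ[ℂ]
        GenHormander.Beta U₁ U₂ γ₁ γ₂,
      (∀ u₁ u₂ φ₁ φ₂, (T u₁ u₂).val (GenHormander.tensor φ₁ φ₂) = u₁.val φ₁ * u₂.val φ₂) ∧
      GenHormander.GammaHypocontinuous T :=
  ⟨GenHormander.completeSpace_fullBeta hγ₁ hγ₂, GenHormander.completeSpace_beta hγ₁ hγ₂,
    GenHormander.tensorMap, fun u₁ u₂ φ₁ φ₂ => GenHormander.tensorDist_tensor φ₁ φ₂ u₁.val u₂.val,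
    GenHormander.gammaHypocontinuous_tensorMap⟩
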